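/- \textbf{Setting.} Fix integers $n,d\ge 1$ and let $m_1,\dots,m_\ell$ enumerate the monomials of degree at most $d$ in $n$ variables, $m(x)=(m_1(x),\dots,m_\ell(x))$. For a probability distribution $D$ on $\mathbb{R}^n$ and a polynomial $p$ write $\|p\|_2=\mathbf{E}_{X\sim D}[p(X)^2]^{1/2}$. Let $\epsilon>0$. The distribution $D$ (all of whose moments of degree at most $2d$ are assumed finite) is called \emph{reasonable} with parameters $Q_d,\Sigma,\gamma,\delta,T_{\max}$ if (i) $Q_d$ is a function with $\Pr_{X\sim D}[|p(X)|\ge T]\le Q_d(T)$ for every polynomial $p$ of degree at most $d$ with $\|p\|_2\le 1$ and every $T>0$; (ii) $\Sigma$ is an $\ell\times\ell$ matrix with $(1-\gamma)\,\mathbf{E}_{X\sim D}[m(X)m(X)^T]\preceq\Sigma\preceq(1+\gamma)\,\mathbf{E}_{X\sim D}[m(X)m(X)^T]$, where $\gamma\ge 0$ is smaller than a sufficiently small absolute constant; (iii) $\delta>0$ and $\delta\ge\int_0^\infty T\min\{\epsilon,Q_d(T)\}\,dT$; (iv) $Q_d\bigl(T_{\max}/(2\sqrt{\ell})\bigr)\le\epsilon/(10\ell)$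 and $T_{\max}\ge\sqrt{\ell}$. Let $f:\mathbb{R}^n\to[-1,1]$ be (measurable and) unknown. A set $S'$ of $N$ labelled samples is \emph{$\epsilon$-corrupted} if it is produced as follows: draw $x^{(1)},\dots,x^{(N)}$ independently from $D$ and label them by $f$; then an adversary, who sees the labelled sample and knows $f$, $D$ and the algorithm, replaces at most $\epsilon N$ of the pairs by arbitrary elements of $\mathbb{R}^n\times[-1,1]$ and presents the result in an arbitrary order. \textbf{Proposition.} There is an algorithm (one program, on a real-arithmetic random access machine with unit-cost arithmetic operations and unit-cost queries to $Q_d$) with the following property. Let $D$ be reasonable with known parameters $Q_d,\Sigma,\gamma,\delta,T_{\max}$. Given $n$, $d$, $\epsilon$, these parameters, and a set $S'$ of $\epsilon$-corrupted labelled samples of size $|S'|=\Theta(n^dT_{\max}^4/\epsilon^2)$ (any size $|S'|\ge C_0\,n^dT_{\max}^4/\epsilon^2$, for a suitable absolute constant $C_0$, will do), the algorithm runs in $\mathrm{poly}(|S'|)$ time and outputs numbers $v_1,\dots,v_\ell$ such that, with probability at least $9/10$, the following holds: for every polynomial $p=\sum_i a_im_i$ of degree at most $d$, $$\Bigl|\sum_i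 a_iv_i-\mathbf{E}_{X\sim D}[f(X)p(X)]\Bigr|\le O\Bigl(\|p\|_2\sqrt{\epsilon(\gamma+\delta+\epsilon)}\Bigr).$$ All hidden constants are absolute. -/

import Mathlib

open MeasureTheory

/-! ### A uniform real random access machine with an oracle -/

namespace RealRAM

/-- The memory: natural-number registers (used for counting and addressing) and
two-dimensional arrays of real numbers, `mem a i j` being entry `(i, j)` of array `a`. -/
structure Store where
  idx : ℕ → ℕ
  mem : ℕ → ℕ → ℕ → ℝ

/-- Index expressions: constants, registers, addition and truncated subtraction. -/
inductive NExp where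
  | const (k : ℕ)
  | reg (i : ℕ)
  | add (a b : NExp)
  | sub (a b : NExp)

def NExp.eval (s : Store) : NExp → ℕ
  | .const k => k
  | .reg i => s.idx i
  | .add a b => a.eval s + b.eval s
  | .sub a b => a.eval s - b.eval s

/-- Number of elementary operations in an index expression. -/
def NExp.size : NExp → ℕ
  | .const _ => 1
  | .reg _ => 1
  | .add a b => a.size + b.size + 1
  | .sub a b => a.size + b.size + 1

/-- Real expressions: rational constants, conversion of an index to a real number, memory access,
the four arithmetic operations, and a query to the oracle function. -/
inductive RExp where
  | const (q : ℚ)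
  | ofIdx (e : NExp)
  | get (arr : ℕ) (i j : NExp)
  | add (a b : RExp)
  | sub (a b : RExp)
  | mul (a b : RExp)
  | div (a b : RExp)
  | query (a : RExp)

noncomputable def RExp.eval (Q : ℝ → ℝ) (s : Store) : RExp → ℝ
  | .const q => (q : ℝ)
  | .ofIdx e => (e.eval s : ℝ)
  | .get arr i j => s.mem arr (i.eval s) (j.eval s)
  | .add a b => a.eval Q s + b.eval Q s
  | .sub a b => a.eval Q s - b.eval Q s
  | .mul a b => a.eval Q s * b.eval Q s
  | .div a b => a.eval Q s / b.eval Q s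
  | .query a => Q (a.eval Q s)

/-- Number of elementary operations in a real expression. -/
def RExp.size : RExp → ℕ
  | .const _ => 1
  | .ofIdx e => e.size + 1
  | .get _ i j => i.size + j.size + 1
  | .add a b => a.size + b.size + 1
  | .sub a b => a.size + b.size + 1
  | .mul a b => a.size + b.size + 1
  | .div a b => a.size + b.size + 1
  | .query a => a.size + 1

/-- Tests. -/
inductive BExp where
  | ltN (a b : NExp)
  | ltR (a b : RExp)
  | neg (a : BExp)
  | conj (a b : BExp)

def BExp.Holds (Q : ℝ → ℝ) (s : Store) : BExp → Prop
  | .ltN a b => a.eval s < b.eval s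
  | .ltR a b => a.eval Q s < b.eval Q s
  | .neg a => ¬ a.Holds Q s
  | .conj a b => a.Holds Q s ∧ b.Holds Q s

/-- Number of elementary operations in a test. -/
def BExp.size : BExp → ℕ
  | .ltN a b => a.size + b.size + 1
  | .ltR a b => a.size + b.size + 1
  | .neg a => a.size + 1
  | .conj a b => a.size + b.size + 1

/-- Programs. -/
inductive Cmd where
  | skip
  | setN (i : ℕ) (e : NExp)
  | setR (arr : ℕ) (i j : NExp) (e : RExp)
  | seq (c₁ c₂ : Cmd)
  | ite (b : BExp) (c₁ c₂ : Cmd)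
  | loop (b : BExp) (c : Cmd)

/-- Writing a natural number into a register. -/
def Store.writeN (s : Store) (i v : ℕ) : Store :=
  { s with idx := fun i' => if i' = i then v else s.idx i' }

/-- Writing a real number into entry `(i, j)` of array `arr`. -/
noncomputable def Store.writeR (s : Store) (arr i j : ℕ) (v : ℝ) : Store :=
  { s with mem := fun arr' i' j' =>
      if arr' = arr ∧ i' = i ∧ j' = j then v else s.mem arr' i' j' }

/-- `c.Runs Q s s' t`: the program `c`, started in memory `s` with oracle `Q`, halts in memory `s'`
after exactly `t` elementary steps. `loop b c` repeats `c` as long as `b` holds. -/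
inductive Cmd.Runs (Q : ℝ → ℝ) : Cmd → Store → Store → ℕ → Prop
  | skip (s : Store) : Cmd.Runs Q .skip s s 1
  | setN (s : Store) (i : ℕ) (e : NExp) :
      Cmd.Runs Q (.setN i e) s (s.writeN i (e.eval s)) (e.size + 1)
  | setR (s : Store) (arr : ℕ) (i j : NExp) (e : RExp) :
      Cmd.Runs Q (.setR arr i j e) s (s.writeR arr (i.eval s) (j.eval s) (e.eval Q s))
        (i.size + j.size + e.size + 1)
  | seq {c₁ c₂ : Cmd} {s s₁ s₂ : Store} {t₁ t₂ : ℕ} :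
      Cmd.Runs Q c₁ s s₁ t₁ → Cmd.Runs Q c₂ s₁ s₂ t₂ →
      Cmd.Runs Q (.seq c₁ c₂) s s₂ (t₁ + t₂)
  | iteTrue {b : BExp} {c₁ c₂ : Cmd} {s s₁ : Store} {t : ℕ} :
      b.Holds Q s → Cmd.Runs Q c₁ s s₁ t →
      Cmd.Runs Q (.ite b c₁ c₂) s s₁ (b.size + t)
  | iteFalse {b : BExp} {c₁ c₂ : Cmd} {s s₁ : Store} {t : ℕ} :
      ¬ b.Holds Q s → Cmd.Runs Q c₂ s s₁ t →
      Cmd.Runs Q (.ite b c₁ c₂) s s₁ (b.size + t)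
  | loopStop {b : BExp} {c : Cmd} {s : Store} :
      ¬ b.Holds Q s → Cmd.Runs Q (.loop b c) s s b.size
  | loopStep {b : BExp} {c : Cmd} {s s₁ s₂ : Store} {t₁ t₂ : ℕ} :
      b.Holds Q s → Cmd.Runs Q c s s₁ t₁ → Cmd.Runs Q (.loop b c) s₁ s₂ t₂ →
      Cmd.Runs Q (.loop b c) s s₂ (b.size + t₁ + t₂)

end RealRAM

namespace RobustChow

/-- Exponent vectors of the monomials of degree at most `d` in `n` variables. -/
abbrev Expo (n d : ℕ) : Type := {a : Fin n →₀ ℕ // ∑ j, a j ≤ d}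

/-- The `i`-th monomial, with respect to the enumeration `e` of the exponent vectors. -/
def monomialFn {n d ℓ : ℕ} (e : Fin ℓ ≃ Expo n d) (i : Fin ℓ) (x : Fin n → ℝ) : ℝ :=
  ∏ j, x j ^ (e i).1 j

/-- The norm `‖p‖₂ = E_{X ∼ D}[p(X)²]^{1/2}`. -/
noncomputable def polyNorm {n : ℕ} (D : Measure (Fin n → ℝ)) (p : MvPolynomial (Fin n) ℝ) : ℝ :=
  Real.sqrt (∫ x, (MvPolynomial.eval x p) ^ 2 ∂D)

/-- The moment matrix `E_{X ∼ D}[m(X) m(X)ᵀ]`. -/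
noncomputable def momentMatrix {n d ℓ : ℕ} (D : Measure (Fin n → ℝ)) (e : Fin ℓ ≃ Expo n d) :
    Matrix (Fin ℓ) (Fin ℓ) ℝ :=
  Matrix.of fun i j => ∫ x, monomialFn e i x * monomialFn e j x ∂D

/-- `D` is reasonable (for degree `d` and noise rate `ε`) with parameters
`Q`, `Sg`, `γ`, `δ`, `Tmax`. -/
structure IsReasonable {n d ℓ : ℕ} (D : Measure (Fin n → ℝ)) (e : Fin ℓ ≃ Expo n d) (ε : ℝ)
    (Q : ℝ → ℝ) (Sg : Matrix (Fin ℓ) (Fin ℓ) ℝ) (γ δ Tmax : ℝ) : Prop where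
  /-- the moments of degree at most `2d` exist -/
  memLp : ∀ p : MvPolynomial (Fin n) ℝ, p.totalDegree ≤ d →
    MemLp (fun x => MvPolynomial.eval x p) 2 D
  /-- concentration -/
  tail : ∀ p : MvPolynomial (Fin n) ℝ, p.totalDegree ≤ d → polyNorm D p ≤ 1 →
    ∀ T : ℝ, 0 < T → D.real {x | T ≤ |MvPolynomial.eval x p|} ≤ Q T
  /-- known approximations of the low-degree moments: `(1 - γ) M ⪯ Sg ⪯ (1 + γ) M` -/
  gamma_nonneg : 0 ≤ γ
  lower : (Sg - (1 - γ) • momentMatrix D e).PosSemidef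
  upper : ((1 + γ) • momentMatrix D e - Sg).PosSemidef
  /-- `δ ≥ ∫₀^∞ T min{ε, Q(T)} dT` -/
  delta_pos : 0 < δ
  delta_bound : ∫⁻ T in Set.Ioi (0 : ℝ), ENNReal.ofReal (T * min ε (Q T)) ≤ ENNReal.ofReal δ
  /-- the pruning threshold -/
  Tmax_tail : Q (Tmax / (2 * Real.sqrt ℓ)) ≤ ε / (10 * ℓ)
  Tmax_ge : Real.sqrt ℓ ≤ Tmax

/-- `S'` is obtained from the labelled sample `S` in the nasty model at noise rate `ε`: at most an
`ε`-fraction of the examples is replaced by arbitrary examples with labels in `[-1, 1]`, and the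
result, being an unordered collection, is presented in an arbitrary order. -/
def IsCorruption {n N : ℕ} (ε : ℝ) (S S' : Fin N → (Fin n → ℝ) × ℝ) : Prop :=
  (∀ i, (S' i).2 ∈ Set.Icc (-1 : ℝ) 1) ∧
  ∃ π : Equiv.Perm (Fin N), (({i | S' i ≠ S (π i)} : Set (Fin N)).ncard : ℝ) ≤ ε * N

/-- A finite matrix as an array, with zeros outside. -/
noncomputable def pad {a b : ℕ} (A : Fin a → Fin b → ℝ) (i j : ℕ) : ℝ :=
  if h : i < a ∧ j < b then A ⟨i, h.1⟩ ⟨j, h.2⟩ else 0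

/-- The initial memory. Registers `0, 1, 2, 3` hold `n, d, N, ℓ`; array `0` holds the scalars
`ε, γ, δ, Tmax`, array `1` the sample points, array `2` the labels, array `3` the matrix `Sg`, and
array `4` the exponent vectors that name the rows and columns of `Sg`. All else is zero. -/
noncomputable def inputStore {n d ℓ N : ℕ} (e : Fin ℓ ≃ Expo n d) (ε γ δ Tmax : ℝ)
    (Sg : Matrix (Fin ℓ) (Fin ℓ) ℝ) (S : Fin N → (Fin n → ℝ) × ℝ) : RealRAM.Store where
  idx := fun i => match i with
    | 0 => n
    | 1 => d
    | 2 => N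
    | 3 => ℓ
    | _ => 0
  mem := fun arr => match arr with
    | 0 => pad fun (_ : Fin 1) => ![ε, γ, δ, Tmax]
    | 1 => pad fun i => (S i).1
    | 2 => pad fun i (_ : Fin 1) => (S i).2
    | 3 => pad fun i j => Sg i j
    | 4 => pad fun i j => ((e i).1 j : ℝ)
    | _ => fun _ _ => 0

/-- The output: the first `ℓ` entries of the first column of array `5`. -/
def output (ℓ : ℕ) (s : RealRAM.Store) : Fin ℓ → ℝ := fun i => s.mem 5 i 0

/-- The numbers `v i` approximate the Chow parameters `E_{X ∼ D}[f(X) m_i(X)]`: for each polynomial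
`p = ∑ a_i m_i` of degree at most `d`, the number `∑ a_i v_i` differs from `E_{X ∼ D}[f(X) p(X)]` by
at most `η ‖p‖₂`. -/
def ApproximatesChow {n d ℓ : ℕ} (D : Measure (Fin n → ℝ)) (f : (Fin n → ℝ) → ℝ)
    (e : Fin ℓ ≃ Expo n d) (v : Fin ℓ → ℝ) (η : ℝ) : Prop :=
  ∀ p : MvPolynomial (Fin n) ℝ, p.totalDegree ≤ d →
    |(∑ i, p.coeff (e i).1 * v i) - ∫ x, f x * MvPolynomial.eval x p ∂D| ≤ η * polyNorm D p

end RobustChow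

/-! Let `u` be the whitened monomial vector (`exists_whitening`). Almost surely, every polynomial of
degree at most `d` is the inner product of `u` with a vector whose length is its 2-norm. All claims
thus become claims about linear functionals of one random vector, uniformly over directions.

Probability. Vectors longer than `Tmax / 2` are rare and are truncated to zero. For the truncated
vectors `v`, three kinds of sums are within `ε N` of their means uniformly over the unit ball, with
good probability: squares, excesses of squares over a level `T₀ ^ 2`, and correlations with `f`
(`measure_not_isGoodSample_le`). Symmetrization and contraction, applied to one sample point at a
time, yield a bound through the mean of `‖v‖ ^ 2` alone, without nets. The level `T₀` of
`exists_truncation` satisfies `ε * T₀ ^ 2 ≤ 2 * δ` and leaves a mean excess of at most `2 * δ`.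
Hence any `O(ε)` fraction of a good sample carries only `O(γ + δ + ε)` of the second moment in each
direction.

Filter. If the weighted second moment in some direction exceeds the known one by a factor `1 + 100 *
(γ + δ + ε)`, the surplus comes from the few bad points. Weight is removed in proportion to the
squared value beyond a threshold, so that bad points lose more than good ones (`filter_step`), and
some point loses all its weight. After `N` rounds no violating direction is left
(`exists_final_weights`). Cauchy-Schwarz then bounds what bad points contribute to the correlations
and what removed good points withheld from them (`abs_correlation_sub_le`). This part is
deterministic and covers all corruptions of a good sample at once, which is what an adaptive
adversary requires.

Machine. A violating direction is found exactly in real arithmetic: Gram-Schmidt with respect to the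
gap matrix meets a negative square, or an isotropic vector outside the kernel, unless the matrix is
positive semidefinite (`nonneg_of_gramSchmidt`). The filter is written in a small language of
bounded loops whose compilation to the machine is proved correct with polynomial cost. The program
performs no pruning: it neither reads `Tmax` nor queries `Q`, and long clean points are merely
counted among the bad ones. For `ε ≥ 1` the output zero is accurate enough. -/

namespace EmpiricalProcess

/-! ### Symmetrization, contraction and a maximal inequality over the unit ball -/

open Finset

variable {X E ι : Type*} [MeasurableSpace X] [NormedAddCommGroup E] [InnerProductSpace ℝ E]

/-- One coordinate of the symmetrization and contraction principles at the same time. -/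
theorem integral_sup_add_centered_le [MeasurableSpace E] [BorelSpace E] [SecondCountableTopology E]
    (D : Measure X) [IsProbabilityMeasure D]
    {v : X → E} (hv : Measurable v) {R : ℝ} (hR : ∀ x, ‖v x‖ ≤ R)
    {F : Finset ι} (hF : F.Nonempty) (a : ι → E) {g : ι → X → ℝ} (hg : ∀ i, Measurable (g i))
    {G : ℝ} (hG : ∀ i x, |g i x| ≤ G) {L : ℝ}
    (hL : ∀ i j x, |g i x - g j x| ≤ L * |inner ℝ (a i - a j) (v x)|) (h : ι → ℝ) :
    ∫ x, F.sup' hF (fun i => h i + (g i x - ∫ y, g i y ∂D)) ∂D ≤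
      ∫ x, (F.sup' hF (fun i => h i + 2 * L * inner ℝ (a i) (v x)) +
        F.sup' hF (fun i => h i - 2 * L * inner ℝ (a i) (v x))) / 2 ∂D := by
  have hgi : ∀ i, Integrable (g i) D := fun i =>
    Integrable.of_bound (hg i).aestronglyMeasurable G (ae_of_all _ fun x => hG i x)
  have sup_abs : ∀ (q : ι → ℝ) (C : ℝ), (∀ i ∈ F, |q i| ≤ C) → |F.sup' hF q| ≤ C := by
    intro q C hq
    obtain ⟨i, hi, h'⟩ := F.exists_mem_eq_sup' hF q
    rw [h']; exact hq i hi
  obtain ⟨H, hH⟩ : ∃ H, ∀ i ∈ F, |h i| ≤ H :=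
    ⟨F.sup' hF fun i => |h i|, fun i hi => F.le_sup' (fun i => |h i|) hi⟩
  obtain ⟨B, hB⟩ : ∃ B, ∀ i ∈ F, ‖a i‖ ≤ B :=
    ⟨F.sup' hF fun i => ‖a i‖, fun i hi => F.le_sup' (fun i => ‖a i‖) hi⟩
  have hin : ∀ i ∈ F, ∀ x, |inner ℝ (a i) (v x)| ≤ B * R := fun i hi x =>
    (abs_real_inner_le_norm _ _).trans (mul_le_mul (hB i hi) (hR x) (norm_nonneg _)
      ((norm_nonneg _).trans (hB i hi)))
  set Φ : X × X → ℝ := fun z => F.sup' hF (fun i => h i + (g i z.1 - g i z.2)) with hΦ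
  have hΦm : Measurable Φ := by
    have := Finset.measurable_sup' hF (f := fun i (z : X × X) => h i + (g i z.1 - g i z.2))
      (fun i _ => by have := hg i; fun_prop)
    convert this using 1
    ext z; simp [hΦ]
  have hΦb : ∀ z, |Φ z| ≤ H + (G + G) := fun z => sup_abs _ _ fun i hi =>
    (abs_add_le _ _).trans (add_le_add (hH i hi)
      ((abs_sub _ _).trans (add_le_add (hG i _) (hG i _))))
  have hΦi : Integrable Φ (D.prod D) :=
    Integrable.of_bound hΦm.aestronglyMeasurable _ (ae_of_all _ fun x => hΦb x)
  set Ψ : X → ℝ := fun x => (F.sup' hF (fun i => h i + 2 * L * inner ℝ (a i) (v x)) +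
        F.sup' hF (fun i => h i - 2 * L * inner ℝ (a i) (v x))) / 2 with hΨ
  have hΨi : Integrable Ψ D := by
    have m1 := Finset.measurable_sup' hF
      (f := fun i x => h i + 2 * L * inner ℝ (a i) (v x)) (fun i _ => by fun_prop)
    have m2 := Finset.measurable_sup' hF
      (f := fun i x => h i - 2 * L * inner ℝ (a i) (v x)) (fun i _ => by fun_prop)
    have hm : Measurable Ψ := by
      convert (m1.add m2).div_const 2 using 1
      ext x; simp [hΨ]
    refine Integrable.of_bound hm.aestronglyMeasurable (H + |2 * L| * (B * R))
      (ae_of_all _ fun x => ?_)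
    have b1 := sup_abs (fun i => h i + 2 * L * inner ℝ (a i) (v x)) (H + |2 * L| * (B * R))
      fun i hi => (abs_add_le _ _).trans (add_le_add (hH i hi) (by
        rw [abs_mul]; exact mul_le_mul_of_nonneg_left (hin i hi x) (abs_nonneg _)))
    have b2 := sup_abs (fun i => h i - 2 * L * inner ℝ (a i) (v x)) (H + |2 * L| * (B * R))
      fun i hi => (abs_sub _ _).trans (add_le_add (hH i hi) (by
        rw [abs_mul]; exact mul_le_mul_of_nonneg_left (hin i hi x) (abs_nonneg _)))
    rw [hΨ, Real.norm_eq_abs, abs_le]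
    rw [abs_le] at b1 b2
    constructor <;> linarith [b1.1, b1.2, b2.1, b2.2]
  -- Exchanging `x` and `y` plays the role of a random sign. With maximizers `i` and `j` of the two
  -- suprema, the sum is `h i + h j` plus the differences of `g i` and `g j` at `x` and at `y`. The
  -- Lipschitz bound turns these into absolute values of inner products, and the two suprema in `Ψ`,
  -- tested at `i` and `j`, provide both signs.
  have key : ∀ x y, Φ (x, y) + Φ (y, x) ≤ Ψ x + Ψ y := by
    intro x y
    obtain ⟨i, hi, h1⟩ := F.exists_mem_eq_sup' hF (fun i => h i + (g i x - g i y))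
    obtain ⟨j, hj, h2⟩ := F.exists_mem_eq_sup' hF (fun i => h i + (g i y - g i x))
    have hΨl : ∀ x, h i + h j + 2 * (L * |inner ℝ (a i - a j) (v x)|) ≤ 2 * Ψ x := by
      intro x
      have p1 := F.le_sup' (fun i => h i + 2 * L * inner ℝ (a i) (v x)) hi
      have p2 := F.le_sup' (fun i => h i - 2 * L * inner ℝ (a i) (v x)) hj
      have p3 := F.le_sup' (fun i => h i + 2 * L * inner ℝ (a i) (v x)) hj
      have p4 := F.le_sup' (fun i => h i - 2 * L * inner ℝ (a i) (v x)) hi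
      rw [inner_sub_left]
      simp only [hΨ]
      rcases abs_cases (inner ℝ (a i) (v x) - inner ℝ (a j) (v x)) with h | h <;> rw [h.1] <;>
        linarith
    have e1 := hΨl x
    have e2 := hΨl y
    have l1 := (le_abs_self _).trans (hL i j x)
    have l2 := (neg_le_abs _).trans (hL i j y)
    simp only [hΦ, h1, h2]
    linarith
  -- Jensen: the mean is that of an independent copy `y`, and the supremum of integrals is at most
  -- the integral of the supremum.
  have step1 : ∫ x, F.sup' hF (fun i => h i + (g i x - ∫ y, g i y ∂D)) ∂D ≤
      ∫ x, ∫ y, Φ (x, y) ∂D ∂D := by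
    refine integral_mono ?_ hΦi.integral_prod_left fun x => ?_
    · have hm := Finset.measurable_sup' hF
        (f := fun i x => h i + (g i x - ∫ y, g i y ∂D)) (fun i _ => by have := hg i; fun_prop)
      have hm' : Measurable fun x => F.sup' hF (fun i => h i + (g i x - ∫ y, g i y ∂D)) := by
        convert hm using 1
        ext x; simp
      refine Integrable.of_bound hm'.aestronglyMeasurable (H + (G + G)) (ae_of_all _ fun x => ?_)
      refine sup_abs _ _ fun i hi => (abs_add_le _ _).trans (add_le_add (hH i hi)
        ((abs_sub _ _).trans (add_le_add (hG i _) ?_)))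
      have := norm_integral_le_of_norm_le_const (μ := D) (f := g i) (C := G)
        (ae_of_all _ fun x => hG i x)
      simpa using this
    · refine Finset.sup'_le _ _ fun i hi => ?_
      have hc : h i + (g i x - ∫ y, g i y ∂D) = ∫ y, (h i + (g i x - g i y)) ∂D := by
        have hd : Integrable (fun y => g i x - g i y) D := (integrable_const _).sub (hgi i)
        rw [integral_add (integrable_const _) hd, integral_sub (integrable_const _) (hgi i)]
        simp
      rw [hc]
      refine integral_mono ((integrable_const _).add ((integrable_const _).sub (hgi i))) ?_
        fun y => F.le_sup' (fun i => h i + (g i x - g i y)) hi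
      exact Integrable.of_bound (hΦm.comp measurable_prodMk_left).aestronglyMeasurable _
        (ae_of_all _ fun y => hΦb (x, y))
  have e1 : ∫ x, ∫ y, Φ (x, y) ∂D ∂D = ∫ z, Φ z ∂(D.prod D) := (integral_prod _ hΦi).symm
  have e2 : ∫ z, Φ z.swap ∂(D.prod D) = ∫ z, Φ z ∂(D.prod D) := integral_prod_swap Φ
  have hsw : Integrable (fun z => Φ (Prod.swap z)) (D.prod D) := hΦi.swap
  have e3 : ∫ z, (Φ z + Φ z.swap) ∂(D.prod D) ≤ ∫ z, (Ψ z.1 + Ψ z.2) ∂(D.prod D) :=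
    integral_mono (hΦi.add hsw) ((hΨi.comp_fst D).add (hΨi.comp_snd D))
      fun z => key z.1 z.2
  rw [integral_add hΦi hsw, integral_add (hΨi.comp_fst D) (hΨi.comp_snd D),
    integral_fun_fst, integral_fun_snd] at e3
  simp only [probReal_univ, one_smul] at e3
  linarith

theorem abs_sup'_le {F : Finset ι} (hF : F.Nonempty) {q : ι → ℝ} {C : ℝ} (hq : ∀ i ∈ F, |q i| ≤ C) :
    |F.sup' hF q| ≤ C := by
  obtain ⟨i, hi, h'⟩ := F.exists_mem_eq_sup' hF q
  rw [h']; exact hq i hi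

theorem measurable_sup'_apply {Y : Type*} [MeasurableSpace Y] {F : Finset ι} (hF : F.Nonempty)
    {q : ι → Y → ℝ} (hq : ∀ i, Measurable (q i)) : Measurable fun y => F.sup' hF fun i => q i y := by
  convert Finset.measurable_sup' hF (f := q) (fun i _ => hq i) using 1
  ext y; simp

/-- Sample points are exchanged one at a time: each turns the drift `z` into `z + 2 L v(x)` or `z -
2 L v(x)` with equal weight, and by the parallelogram law the mean of `‖z‖ ^ 2` grows by `4 L²
‖v(x)‖²`. A bound quadratic in `‖z‖` passes through this induction, unlike the norm itself. The
parameter `c` comes from `‖z‖ ≤ (‖z‖ ^ 2 + c ^ 2) / (2 * c)` in the base case and is optimized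
later. -/
theorem integral_sup_sum_centered_le [MeasurableSpace E] [BorelSpace E]
    [SecondCountableTopology E] (D : Measure X) [IsProbabilityMeasure D]
    {v : X → E} (hv : Measurable v) {R : ℝ} (hR : ∀ x, ‖v x‖ ≤ R)
    {V : ℝ} (hV : ∫ x, ‖v x‖ ^ 2 ∂D ≤ V)
    {F : Finset ι} (hF : F.Nonempty) {a : ι → E} (ha : ∀ i, ‖a i‖ ≤ 1) {g : ι → X → ℝ}
    (hg : ∀ i, Measurable (g i)) {G : ℝ} (hG : ∀ i x, |g i x| ≤ G) {L : ℝ}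
    (hL : ∀ i j x, |g i x - g j x| ≤ L * |inner ℝ (a i - a j) (v x)|) {c : ℝ} (hc : 0 < c)
    (N : ℕ) (z : E) :
    ∫ x : Fin N → X, F.sup' hF (fun i => inner ℝ (a i) z + ∑ k, (g i (x k) - ∫ y, g i y ∂D))
        ∂(Measure.pi fun _ => D) ≤ (‖z‖ ^ 2 + N * (4 * L ^ 2 * V) + c ^ 2) / (2 * c) := by
  have haz : ∀ (i : ι) (z : E), |inner ℝ (a i) z| ≤ ‖z‖ := fun i z =>
    (abs_real_inner_le_norm _ _).trans (mul_le_of_le_one_left (norm_nonneg _) (ha i))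
  have hcen : ∀ i x, |g i x - ∫ y, g i y ∂D| ≤ 2 * G := by
    intro i x
    have := norm_integral_le_of_norm_le_const (μ := D) (f := g i) (C := G)
        (ae_of_all _ fun x => hG i x)
    simp only [Real.norm_eq_abs, probReal_univ, mul_one] at this
    exact (abs_sub _ _).trans (by linarith [hG i x])
  have hcm : ∀ i, Measurable fun x => g i x - ∫ y, g i y ∂D := fun i => (hg i).sub_const _
  have hsum : ∀ (N : ℕ) (i : ι) (x : Fin N → X), |∑ k, (g i (x k) - ∫ y, g i y ∂D)| ≤ N * (2 * G) := by
    intro N i x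
    refine (Finset.abs_sum_le_sum_abs _ _).trans ?_
    simpa using Finset.sum_le_card_nsmul univ _ _ fun k _ => hcen i (x k)
  have hsm : ∀ (N : ℕ) (i : ι), Measurable fun x : Fin N → X => ∑ k, (g i (x k) - ∫ y, g i y ∂D) :=
    fun N i => Finset.measurable_sum _ fun k _ => (hcm i).comp (measurable_pi_apply k)
  induction N generalizing z with
  | zero =>
    simp only [univ_eq_empty, sum_empty, add_zero, integral_const, probReal_univ, one_smul,
      Nat.cast_zero, zero_mul]
    refine (Finset.sup'_le _ _ fun i _ => (le_abs_self _).trans (haz i z)).trans ?_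
    rw [le_div_iff₀ (by positivity)]
    nlinarith [sq_nonneg (‖z‖ - c)]
  | succ N ih =>
    set P : Measure (Fin N → X) := Measure.pi fun _ => D
    set H : X × (Fin N → X) → ℝ := fun w => F.sup' hF (fun i => (inner ℝ (a i) z +
      ∑ k, (g i (w.2 k) - ∫ y, g i y ∂D)) + (g i w.1 - ∫ y, g i y ∂D)) with hH
    have hHi : Integrable H (D.prod P) := by
      refine Integrable.of_bound (C := ‖z‖ + N * (2 * G) + 2 * G) ?_ (ae_of_all _ fun w => ?_)
      · refine (measurable_sup'_apply hF fun i => ?_).aestronglyMeasurable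
        exact (((hsm N i).comp measurable_snd).const_add _).add ((hcm i).comp measurable_fst)
      · exact abs_sup'_le hF fun i _ => (abs_add_le _ _).trans
          (add_le_add ((abs_add_le _ _).trans (add_le_add (haz i z) (hsum N i _))) (hcen i _))
    have h1 := (measurePreserving_piFinSuccAbove (fun _ : Fin (N + 1) => D) 0).integral_comp'
      (g := H)
    set K : E → (Fin N → X) → ℝ := fun z' xs =>
      F.sup' hF (fun i => inner ℝ (a i) z' + ∑ k, (g i (xs k) - ∫ y, g i y ∂D)) with hK
    have hKm : Measurable fun w : E × (Fin N → X) => K w.1 w.2 :=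
      measurable_sup'_apply hF fun i =>
        (measurable_const.inner measurable_fst).add ((hsm N i).comp measurable_snd)
    have hKb : ∀ z' xs, |K z' xs| ≤ ‖z'‖ + N * (2 * G) := fun z' xs =>
      abs_sup'_le hF fun i _ => (abs_add_le _ _).trans (add_le_add (haz i z') (hsum N i _))
    have hR0 : ∀ x, ∀ t : ℝ, ‖z + t • v x‖ ≤ ‖z‖ + |t| * R := fun x t =>
      (norm_add_le _ _).trans (by
        rw [norm_smul]
        exact add_le_add_right (mul_le_mul_of_nonneg_left (hR x) (abs_nonneg _)) _)
    have hKi : ∀ t : ℝ, Integrable (fun w : X × (Fin N → X) => K (z + t • v w.1) w.2) (D.prod P) := by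
      intro t
      refine Integrable.of_bound (C := (‖z‖ + |t| * R) + N * (2 * G)) ?_ (ae_of_all _ fun w => ?_)
      · exact (hKm.comp (((hv.comp measurable_fst).const_smul t |>.const_add z).prodMk
          measurable_snd)).aestronglyMeasurable
      · exact (hKb _ _).trans (add_le_add_left (hR0 _ t) _)
    have hvi : Integrable (fun x => ‖v x‖ ^ 2) D := by
      refine Integrable.of_bound (C := R ^ 2) (by fun_prop) (ae_of_all _ fun x => ?_)
      rw [Real.norm_eq_abs, abs_of_nonneg (by positivity)]
      exact pow_le_pow_left₀ (norm_nonneg _) (hR x) 2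
    calc _ = ∫ w, H w ∂(D.prod P) := by
          rw [← h1]
          refine integral_congr_ae (ae_of_all _ fun x => ?_)
          simp only [hH]
          congr 1; ext i
          rw [Fin.sum_univ_succ]
          simp [Fin.tail]
          ring
      _ = ∫ xs, ∫ x, H (x, xs) ∂D ∂P := integral_prod_symm _ hHi
      _ ≤ ∫ xs, ∫ x, (K (z + (2 * L) • v x) xs + K (z + (-(2 * L)) • v x) xs) / 2 ∂D ∂P := by
          refine integral_mono hHi.integral_prod_right
            (((hKi (2 * L)).add (hKi (-(2 * L)))).div_const 2).integral_prod_right fun xs => ?_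
          refine (integral_sup_add_centered_le D hv hR hF a hg hG hL
            fun i => inner ℝ (a i) z + ∑ k, (g i (xs k) - ∫ y, g i y ∂D)).trans_eq ?_
          refine integral_congr_ae (ae_of_all _ fun x => ?_)
          simp only [hK, inner_add_right, inner_smul_right]
          congr 2 <;> congr 1 <;> ext i <;> ring
      _ = ∫ x, ∫ xs, (K (z + (2 * L) • v x) xs + K (z + (-(2 * L)) • v x) xs) / 2 ∂P ∂D :=
          (integral_integral_swap
            (((hKi (2 * L)).add (hKi (-(2 * L)))).div_const 2)).symm
      _ ≤ ∫ x, (‖z‖ ^ 2 + 4 * L ^ 2 * ‖v x‖ ^ 2 + N * (4 * L ^ 2 * V) + c ^ 2) / (2 * c) ∂D := by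
          refine integral_mono
            (((hKi (2 * L)).add (hKi (-(2 * L)))).div_const 2).integral_prod_left ?_ fun x => ?_
          · exact ((((integrable_const _).add (hvi.const_mul _)).add (integrable_const _)).add
              (integrable_const _)).div_const _
          · have hKx : ∀ z', Integrable (K z') P := fun z' =>
              Integrable.of_bound (hKm.comp measurable_prodMk_left).aestronglyMeasurable _
                (ae_of_all _ fun xs => hKb z' xs)
            dsimp only
            rw [integral_div, integral_add (hKx _) (hKx _)]
            have i1 := ih (z + (2 * L) • v x)
            have i2 := ih (z + (-(2 * L)) • v x)
            have par : ‖z + (2 * L) • v x‖ ^ 2 + ‖z + (-(2 * L)) • v x‖ ^ 2 =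
                2 * (‖z‖ ^ 2 + 4 * L ^ 2 * ‖v x‖ ^ 2) := by
              rw [norm_add_sq_real, norm_add_sq_real, inner_smul_right, inner_smul_right,
                norm_smul, norm_smul]
              simp only [mul_pow, Real.norm_eq_abs, sq_abs]
              ring
            refine (div_le_div_of_nonneg_right (add_le_add i1 i2) two_pos.le).trans_eq ?_
            rw [← add_div, div_div, div_eq_div_iff (by positivity) (by positivity)]
            linear_combination (2 * c) * par
      _ ≤ _ := by
          have e : ∀ x, ‖z‖ ^ 2 + 4 * L ^ 2 * ‖v x‖ ^ 2 + N * (4 * L ^ 2 * V) + c ^ 2 =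
              4 * L ^ 2 * ‖v x‖ ^ 2 + (‖z‖ ^ 2 + N * (4 * L ^ 2 * V) + c ^ 2) := fun x => by ring
          simp only [e]
          rw [integral_div, integral_add (hvi.const_mul _) (integrable_const _),
            integral_const_mul]
          simp only [integral_const, probReal_univ, one_smul]
          refine div_le_div_of_nonneg_right ?_ (by positivity)
          have := mul_le_mul_of_nonneg_left hV (show (0 : ℝ) ≤ 4 * L ^ 2 by positivity)
          push_cast
          linarith

open Classical in
/-- A one-sided maximal inequality for centered sums that are indexed by the unit ball. -/
theorem measure_exists_sum_centered_gt_le [MeasurableSpace E] [BorelSpace E]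
    [SecondCountableTopology E] (D : Measure X) [IsProbabilityMeasure D]
    {v : X → E} (hv : Measurable v) {R : ℝ} (hR : ∀ x, ‖v x‖ ≤ R)
    {V : ℝ} (hV : ∫ x, ‖v x‖ ^ 2 ∂D ≤ V) {g : E → X → ℝ}
    (hg : ∀ a, Measurable (g a)) (hg0 : ∀ x, g 0 x = 0) {G : ℝ}
    (hG : ∀ a ∈ Metric.closedBall (0 : E) 1, ∀ x, |g a x| ≤ G) {L : ℝ} (hL0 : 0 ≤ L)
    (hL : ∀ a ∈ Metric.closedBall (0 : E) 1, ∀ b ∈ Metric.closedBall (0 : E) 1, ∀ x,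
      |g a x - g b x| ≤ L * |inner ℝ (a - b) (v x)|) {c : ℝ} (hc : 0 < c)
    (N : ℕ) {s : ℝ} (hs : 0 < s) :
    Measure.pi (fun _ : Fin N => D)
      {x | ∃ a ∈ Metric.closedBall (0 : E) 1, s < ∑ k, (g a (x k) - ∫ y, g a y ∂D)} ≤
      ENNReal.ofReal ((N * (4 * L ^ 2 * V) + c ^ 2) / (2 * c) / s) := by
  set B := Metric.closedBall (0 : E) 1 with hB
  have h0 : (0 : E) ∈ B := by simp [hB]
  have hR0 : ∀ x : X, 0 ≤ R := fun x => (norm_nonneg _).trans (hR x)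
  have hgi : ∀ a ∈ B, Integrable (g a) D := fun a ha =>
    Integrable.of_bound (hg a).aestronglyMeasurable G (ae_of_all _ fun x => hG a ha x)
  set Z : B → (Fin N → X) → ℝ := fun a x => ∑ k, (g a (x k) - ∫ y, g a y ∂D) with hZ
  have hZm : ∀ a, Measurable (Z a) := fun a => Finset.measurable_sum _ fun k _ =>
    ((hg a).comp (measurable_pi_apply k)).sub_const _
  have : Nonempty B := ⟨⟨0, h0⟩⟩
  have : Nonempty X := nonempty_of_isProbabilityMeasure D
  obtain ⟨x₀⟩ := ‹Nonempty X›
  have hRn := hR0 x₀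
  have hlip : ∀ a b : B, ∀ x, |g a x - g b x| ≤ L * R * dist a b := fun a b x => by
    refine (hL a a.2 b b.2 x).trans ?_
    rw [Subtype.dist_eq, dist_eq_norm, mul_assoc, mul_comm R]
    exact mul_le_mul_of_nonneg_left ((abs_real_inner_le_norm _ _).trans
      (mul_le_mul_of_nonneg_left (hR x) (norm_nonneg _))) hL0
  -- Continuity in `a` reduces the uncountable union over the ball to a dense sequence, since `s < Z
  -- a x` is an open condition on `a`.
  have hcont : ∀ x, Continuous fun a => Z a x := by
    intro x
    refine continuous_finsetSum _ fun k _ => ?_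
    have hc1 : ∀ y, Continuous fun a : B => g a y := fun y =>
      (LipschitzWith.of_dist_le_mul (K := (L * R).toNNReal) fun a b => by
        rw [Real.dist_eq, Real.coe_toNNReal _ (by positivity)]
        exact hlip a b y).continuous
    have hc2 : Continuous fun a : B => ∫ y, g a y ∂D :=
      (LipschitzWith.of_dist_le_mul (K := (L * R).toNNReal) fun a b => by
        rw [Real.dist_eq, Real.coe_toNNReal _ (by positivity),
          ← integral_sub (hgi a a.2) (hgi b b.2)]
        have := norm_integral_le_of_norm_le_const (μ := D) (f := fun y => g a y - g b y)
          (ae_of_all _ fun x => hlip a b x)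
        simpa using this).continuous
    exact (hc1 _).sub hc2
  -- The vector zero is always included: since `g 0` vanishes, the supremum is nonnegative and
  -- Markov's inequality applies.
  let F : ℕ → Finset B := fun K => insert ⟨0, h0⟩ ((range K).image (TopologicalSpace.denseSeq B))
  have hF : ∀ K, (F K).Nonempty := fun K => insert_nonempty _ _
  let T : ℕ → Set (Fin N → X) := fun K => {x | s ≤ (F K).sup' (hF K) fun a => Z a x}
  have hbound : ∀ K, Measure.pi (fun _ : Fin N => D) (T K) ≤
      ENNReal.ofReal ((N * (4 * L ^ 2 * V) + c ^ 2) / (2 * c) / s) := by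
    intro K
    have h1 := integral_sup_sum_centered_le D hv hR hV (hF K) (a := fun a : B => (a : E))
      (fun a => mem_closedBall_zero_iff.1 a.2) (g := fun a => g a) (fun a => hg a)
      (fun a x => hG a a.2 x) (fun a b x => hL a a.2 b b.2 x) hc N 0
    simp only [inner_zero_right, zero_add, norm_zero, ne_eq, OfNat.ofNat_ne_zero,
      not_false_eq_true, zero_pow] at h1
    have hm : Measurable fun x => (F K).sup' (hF K) fun a => Z a x :=
      measurable_sup'_apply (hF K) hZm
    have hGn : 0 ≤ G := (abs_nonneg _).trans (hG 0 h0 x₀)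
    have hint : Integrable (fun x => (F K).sup' (hF K) fun a => Z a x)
        (Measure.pi fun _ : Fin N => D) := by
      refine Integrable.of_bound (C := N * (2 * G)) hm.aestronglyMeasurable
        (ae_of_all _ fun x => abs_sup'_le _ fun a _ => ?_)
      refine (Finset.abs_sum_le_sum_abs _ _).trans ?_
      refine (Finset.sum_le_card_nsmul univ _ (2 * G) fun k _ => ?_).trans (by simp)
      have := norm_integral_le_of_norm_le_const (μ := D) (f := g a) (C := G)
        (ae_of_all _ fun x => hG a a.2 x)
      simp only [Real.norm_eq_abs, probReal_univ, mul_one] at this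
      exact (abs_sub _ _).trans (by linarith [hG a a.2 (x k)])
    have hnn : ∀ x, 0 ≤ (F K).sup' (hF K) fun a => Z a x := fun x => by
      refine le_trans ?_ ((F K).le_sup' (fun a => Z a x) (mem_insert_self _ _))
      simp [hZ, hg0]
    have h2 := mul_meas_ge_le_integral_of_nonneg (ae_of_all _ hnn) hint s
    rw [← ofReal_measureReal]
    refine ENNReal.ofReal_le_ofReal ?_
    rw [le_div_iff₀ hs, mul_comm]
    exact h2.trans h1
  have hmono : Monotone T := by
    intro K K' hKK x hx
    have hx' : s ≤ (F K).sup' (hF K) fun a => Z a x := hx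
    refine le_trans hx' (Finset.sup'_mono (fun a => Z a x) ?_ (hF K))
    exact insert_subset_insert _ (image_subset_image (range_subset_range.2 hKK))
  calc _ ≤ Measure.pi (fun _ : Fin N => D) (⋃ K, T K) := by
        refine measure_mono ?_
        rintro x ⟨a, ha, hax⟩
        have ho : IsOpen {b : B | s < Z b x} := isOpen_lt continuous_const (hcont x)
        obtain ⟨_, hb, ⟨k, rfl⟩⟩ := (TopologicalSpace.denseRange_denseSeq B).inter_open_nonempty
          _ ho ⟨⟨a, ha⟩, hax⟩
        refine Set.mem_iUnion.2 ⟨k + 1, ?_⟩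
        refine (le_of_lt hb).trans ((F (k + 1)).le_sup' (fun a => Z a x) ?_)
        exact mem_insert_of_mem (mem_image_of_mem _ (self_mem_range_succ k))
    _ = ⨆ K, Measure.pi (fun _ : Fin N => D) (T K) := hmono.measure_iUnion
    _ ≤ _ := iSup_le hbound

end EmpiricalProcess

/-! ### Whitening -/

namespace RobustChow

/-- Whitening of a random vector with second moments, whose moment matrix may be singular. -/
theorem exists_whitening {X : Type*} [MeasurableSpace X] {ℓ : ℕ} (D : Measure X)
    {m : X → EuclideanSpace ℝ (Fin ℓ)} (hmm : Measurable m)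
    (hm : ∀ i, MemLp (fun x => m x i) 2 D) :
    ∃ (u : X → EuclideanSpace ℝ (Fin ℓ)) (b : EuclideanSpace ℝ (Fin ℓ) → EuclideanSpace ℝ (Fin ℓ)),
      Measurable u ∧
      (∀ c, ∃ c', ∀ x, inner ℝ c (u x) = inner ℝ c' (m x)) ∧
      (∀ c, ∫ x, inner ℝ c (u x) ^ 2 ∂D ≤ ‖c‖ ^ 2) ∧
      (∀ a, ‖b a‖ ^ 2 = ∫ x, inner ℝ a (m x) ^ 2 ∂D) ∧
      ∀ᵐ x ∂D, ∀ a, inner ℝ a (m x) = inner ℝ (b a) (u x) := by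
  set M : Matrix (Fin ℓ) (Fin ℓ) ℝ := Matrix.of fun i j => ∫ x, m x i * m x j ∂D with hM
  have hint : ∀ i j, Integrable (fun x => m x i * m x j) D := fun i j =>
    (hm i).integrable_mul (hm j)
  have hH : M.IsHermitian := by
    ext i j
    simp [hM, mul_comm]
  set w := hH.eigenvectorBasis
  set lam := hH.eigenvalues
  set P : Fin ℓ → X → ℝ := fun j x => inner ℝ (w j) (m x) with hP
  have hPL : ∀ j, MemLp (P j) 2 D := by
    intro j
    have : P j = fun x => ∑ i, w j i * m x i := by
      ext x
      simp [hP, PiLp.inner_apply, mul_comm]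
    rw [this]
    exact memLp_finsetSum _ fun i _ => (hm i).const_mul _
  have hPint : ∀ j k, Integrable (fun x => P j x * P k x) D := fun j k =>
    (hPL j).integrable_mul (hPL k)
  have hPP : ∀ j k, ∫ x, P j x * P k x ∂D = if j = k then lam k else 0 := by
    intro j k
    have e1 : ∀ x, P j x * P k x = ∑ i, ∑ i', w j i * w k i' * (m x i * m x i') := by
      intro x
      simp only [hP, PiLp.inner_apply, RCLike.inner_apply, conj_trivial, Finset.sum_mul_sum]
      exact Finset.sum_congr rfl fun i _ => Finset.sum_congr rfl fun i' _ => by ring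
    simp only [e1]
    rw [integral_finsetSum _ fun i _ => integrable_finsetSum _ fun i' _ => (hint i i').const_mul _]
    have e2 : ∀ i, ∫ x, ∑ i', w j i * w k i' * (m x i * m x i') ∂D =
        w j i * (M.mulVec (w k)) i := by
      intro i
      rw [integral_finsetSum _ fun i' _ => (hint i i').const_mul _]
      simp only [integral_const_mul, Matrix.mulVec, dotProduct, Finset.mul_sum, hM, Matrix.of_apply]
      exact Finset.sum_congr rfl fun i' _ => by ring
    simp only [e2]
    have e3 := hH.mulVec_eigenvectorBasis k
    rw [e3]
    have e4 := w.inner_eq_ite j k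
    rw [PiLp.inner_apply] at e4
    simp only [RCLike.inner_apply, conj_trivial] at e4
    rw [← mul_one (lam k), ← mul_zero (lam k), ← mul_ite, ← e4, Finset.mul_sum]
    exact Finset.sum_congr rfl fun i _ => by simp [w, lam]; ring
  have hlam : ∀ j, 0 ≤ lam j := fun j => by
    have := hPP j j
    rw [if_pos rfl] at this
    rw [← this]
    exact integral_nonneg fun x => mul_self_nonneg _
  have hsq : ∀ c : Fin ℓ → ℝ, ∫ x, (∑ j, c j * P j x) ^ 2 ∂D = ∑ j, c j ^ 2 * lam j := by
    intro c
    have e1 : ∀ x, (∑ j, c j * P j x) ^ 2 = ∑ j, ∑ k, c j * c k * (P j x * P k x) := by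
      intro x
      rw [sq, Finset.sum_mul_sum]
      exact Finset.sum_congr rfl fun i _ => Finset.sum_congr rfl fun i' _ => by ring
    simp only [e1]
    rw [integral_finsetSum _ fun i _ => integrable_finsetSum _ fun i' _ => (hPint i i').const_mul _]
    refine Finset.sum_congr rfl fun j _ => ?_
    rw [integral_finsetSum _ fun i' _ => (hPint j i').const_mul _]
    simp only [integral_const_mul, hPP]
    simp [sq]
  -- Coordinates in the eigenbasis of the moment matrix are rescaled to unit variance. For a zero
  -- eigenvalue the division yields zero; nothing is lost because `P j` then vanishes almost surely.
  -- This is why the last claim holds only almost everywhere and the second moments of `u` are only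
  -- bounded by those of an isotropic vector.
  refine ⟨fun x => WithLp.toLp 2 fun j => P j x / √(lam j),
    fun a => WithLp.toLp 2 fun j => √(lam j) * inner ℝ a (w j), ?_, ?_, ?_, ?_, ?_⟩
  · refine (WithLp.measurable_toLp 2 _).comp (measurable_pi_lambda _ fun j => ?_)
    exact (measurable_const.inner hmm).div_const _
  · intro c
    refine ⟨∑ j, (c j / √(lam j)) • w j, fun x => ?_⟩
    simp only [sum_inner, inner_smul_left, PiLp.inner_apply (x := c), RCLike.inner_apply,
      conj_trivial]
    exact Finset.sum_congr rfl fun j _ => by simp only [hP]; ring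
  · intro c
    have e1 : ∀ x, inner ℝ c (WithLp.toLp 2 fun j => P j x / √(lam j)) =
        ∑ j, (c j / √(lam j)) * P j x := fun x => by
      simp only [PiLp.inner_apply, RCLike.inner_apply, conj_trivial]
      exact Finset.sum_congr rfl fun j _ => by ring
    simp only [e1, hsq, EuclideanSpace.norm_sq_eq, Real.norm_eq_abs, sq_abs]
    refine Finset.sum_le_sum fun j _ => ?_
    rw [div_pow, Real.sq_sqrt (hlam j)]
    rcases (hlam j).eq_or_lt with h | h
    · rw [← h]; simp; positivity
    · rw [div_mul_cancel₀ _ h.ne']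
  · intro a
    have e1 : ∀ x, inner ℝ a (m x) = ∑ j, inner ℝ a (w j) * P j x := fun x =>
      (w.sum_inner_mul_inner a (m x)).symm
    simp only [e1, hsq, EuclideanSpace.norm_sq_eq, Real.norm_eq_abs, sq_abs]
    refine Finset.sum_congr rfl fun j _ => ?_
    rw [mul_pow, Real.sq_sqrt (hlam j), mul_comm]
  · have h0 : ∀ j, lam j = 0 → ∀ᵐ x ∂D, P j x = 0 := by
      intro j hj
      have := hPP j j
      rw [if_pos rfl, hj, integral_eq_zero_iff_of_nonneg (fun x => mul_self_nonneg _)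
        (hPint j j)] at this
      filter_upwards [this] with x hx
      exact mul_self_eq_zero.1 hx
    have h1 : ∀ᵐ x ∂D, ∀ j, lam j = 0 → P j x = 0 := ae_all_iff.2 fun j => by
      by_cases hj : lam j = 0
      · filter_upwards [h0 j hj] with x hx _ using hx
      · exact ae_of_all _ fun x h => absurd h hj
    filter_upwards [h1] with x hx a
    rw [← w.sum_inner_mul_inner a (m x), PiLp.inner_apply]
    refine Finset.sum_congr rfl fun j _ => ?_
    simp only [RCLike.inner_apply, conj_trivial]
    change inner ℝ a (w j) * P j x = _
    rcases (hlam j).eq_or_lt with h | h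
    · rw [hx j h.symm]; simp
    · have : √(lam j) ≠ 0 := (Real.sqrt_pos.2 h).ne'
      field_simp

/-! ### Polynomials as coefficient vectors -/

section Polynomials

variable {n d ℓ : ℕ} (e : Fin ℓ ≃ Expo n d)

theorem eq_sum_monomial {p : MvPolynomial (Fin n) ℝ} (hp : p.totalDegree ≤ d) :
    p = ∑ i, MvPolynomial.monomial (e i).1 (p.coeff (e i).1) := by
  ext α
  rw [MvPolynomial.coeff_sum]
  simp only [MvPolynomial.coeff_monomial]
  by_cases hα : ∑ j, α j ≤ d
  · rw [Finset.sum_eq_single (e.symm ⟨α, hα⟩)]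
    · simp
    · intro i _ hi
      rw [if_neg]
      intro h
      exact hi ((Equiv.eq_symm_apply e).2 (Subtype.ext h))
    · simp
  · rw [Finset.sum_eq_zero]
    · by_contra h
      have h1 := MvPolynomial.le_totalDegree (MvPolynomial.mem_support_iff.2 h)
      rw [Finsupp.sum_fintype _ _ (by simp)] at h1
      omega
    · intro i _
      rw [if_neg]
      rintro rfl
      exact hα (e i).2

theorem eval_eq_sum_monomialFn {p : MvPolynomial (Fin n) ℝ} (hp : p.totalDegree ≤ d)
    (x : Fin n → ℝ) : MvPolynomial.eval x p = ∑ i, p.coeff (e i).1 * monomialFn e i x := by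
  conv_lhs => rw [eq_sum_monomial e hp]
  simp [MvPolynomial.eval_monomial, monomialFn, Finsupp.prod_fintype]

theorem exists_polynomial_of_coeffs (a : Fin ℓ → ℝ) : ∃ p : MvPolynomial (Fin n) ℝ,
    p.totalDegree ≤ d ∧ ∀ x, MvPolynomial.eval x p = ∑ i, a i * monomialFn e i x := by
  refine ⟨∑ i, MvPolynomial.monomial (e i).1 (a i), ?_, fun x => ?_⟩
  · refine (MvPolynomial.totalDegree_finsetSum_le fun i _ => ?_)
    refine (MvPolynomial.totalDegree_monomial_le _ _).trans ?_
    have := (e i).2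
    rwa [Finsupp.sum_fintype _ _ (by simp)]
  · simp [MvPolynomial.eval_monomial, monomialFn, Finsupp.prod_fintype]

end Polynomials

/-! ### A truncation level from the tail bounds -/

theorem intervalIntegral_indicator_Ioi {T₀ y : ℝ} (hT : 0 ≤ T₀) (hy : 0 ≤ y) :
    ∫ t in (0 : ℝ)..y, (Set.Ioi T₀).indicator (fun t => 2 * t) t = max (y ^ 2 - T₀ ^ 2) 0 := by
  have hint : ∀ a b, IntervalIntegrable ((Set.Ioi T₀).indicator fun t => 2 * t) volume a b := by
    intro a b
    have : IntervalIntegrable (fun t : ℝ => 2 * t) volume a b :=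
      (by fun_prop : Continuous fun t : ℝ => 2 * t).intervalIntegrable a b
    rw [intervalIntegrable_iff] at this ⊢
    exact this.indicator measurableSet_Ioi
  have hz : ∀ b, 0 ≤ b → b ≤ T₀ →
      ∫ t in (0 : ℝ)..b, (Set.Ioi T₀).indicator (fun t => 2 * t) t = 0 := by
    intro b hb hbT
    rw [intervalIntegral.integral_of_le hb, setIntegral_congr_fun measurableSet_Ioc (g := 0)]
    · simp
    · intro t ht
      exact Set.indicator_of_notMem (fun h => absurd (ht.2.trans hbT) (not_le.2 h)) _
  rcases le_total y T₀ with h | h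
  · rw [hz y hy h, max_eq_right]
    nlinarith
  · rw [← intervalIntegral.integral_add_adjacent_intervals (hint 0 T₀) (hint T₀ y), hz T₀ hT le_rfl,
      max_eq_left (by nlinarith), zero_add, intervalIntegral.integral_of_le h,
      setIntegral_congr_fun measurableSet_Ioc (g := fun t => 2 * t),
      ← intervalIntegral.integral_of_le h]
    · rw [intervalIntegral.integral_const_mul, integral_id]
      ring
    · intro t ht
      exact Set.indicator_of_mem ht.1 _

/-- A truncation level beyond which the second moments of a family with tails `Q` are small. -/
theorem exists_truncation {X : Type*} [MeasurableSpace X] (D : Measure X) [IsProbabilityMeasure D]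
    (Pf : Set (X → ℝ)) (hmeas : ∀ h ∈ Pf, Measurable h)
    (hint : ∀ h ∈ Pf, Integrable (fun x => h x ^ 2) D) (hsq : ∀ h ∈ Pf, ∫ x, h x ^ 2 ∂D ≤ 1)
    {Q : ℝ → ℝ} (hQ : ∀ h ∈ Pf, ∀ T : ℝ, 0 < T → D.real {x | T ≤ |h x|} ≤ Q T)
    {ε δ : ℝ} (hε : 0 < ε) (hδ : 0 < δ)
    (hδQ : ∫⁻ T in Set.Ioi (0 : ℝ), ENNReal.ofReal (T * min ε (Q T)) ≤ ENNReal.ofReal δ) :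
    ∃ T₀ : ℝ, 0 ≤ T₀ ∧ ε * T₀ ^ 2 ≤ 2 * δ ∧
      ∀ h ∈ Pf, ∫ x, max (h x ^ 2 - T₀ ^ 2) 0 ∂D ≤ 2 * δ := by
  -- The levels are defined by the actual tails and not by `Q`, which need not be monotone; `A` is
  -- therefore upward closed. Chebyshev's inequality puts `1 / √ε` in it.
  set A : Set ℝ := {T | 0 < T ∧ ∀ h ∈ Pf, D.real {x | T ≤ |h x|} ≤ ε} with hA
  have hup : ∀ T ∈ A, ∀ T', T ≤ T' → T' ∈ A := fun T hT T' hTT =>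
    ⟨hT.1.trans_le hTT, fun h hh => (measureReal_mono fun x (hx : T' ≤ _) => hTT.trans hx).trans
      (hT.2 h hh)⟩
  have hAne : A.Nonempty := by
    refine ⟨1 / √ε, by positivity, fun h hh => ?_⟩
    have h1 := mul_meas_ge_le_integral_of_nonneg (ae_of_all D fun x => sq_nonneg (h x))
      (hint h hh) (1 / ε)
    have h2 : {x | 1 / √ε ≤ |h x|} ⊆ {x | 1 / ε ≤ h x ^ 2} := by
      intro x hx
      have hx' : 1 / √ε ≤ |h x| := hx
      have := pow_le_pow_left₀ (by positivity) hx' 2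
      rwa [div_pow, one_pow, Real.sq_sqrt hε.le, sq_abs] at this
    refine (measureReal_mono h2).trans ?_
    have h3 := h1.trans (hsq h hh)
    rw [div_mul_eq_mul_div, one_mul, div_le_one hε] at h3
    exact h3
  have hbdd : BddBelow A := ⟨0, fun T hT => hT.1.le⟩
  set T₀ := sInf A with hT₀
  have hT₀0 : 0 ≤ T₀ := le_csInf hAne fun T hT => hT.1.le
  have hhi : ∀ T, T₀ < T → T ∈ A := fun T hT => by
    obtain ⟨T', hT', hlt⟩ := exists_lt_of_csInf_lt hAne hT
    exact hup T' hT' T hlt.le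
  -- Below the infimum some member of the family has a tail above `ε`, which forces `Q T` above `ε`.
  -- The minimum in the definition of `δ` equals `ε` there.
  have hlo : ∀ T, 0 < T → T < T₀ → ε < Q T := fun T hT0 hT => by
    have : T ∉ A := fun h => absurd (csInf_le hbdd h) (not_le.2 hT)
    simp only [hA, Set.mem_ofPred_eq, not_and, not_forall] at this
    obtain ⟨h, hh, hlt⟩ := this hT0
    exact (not_le.1 hlt).trans_le (hQ h hh T hT0)
  refine ⟨T₀, hT₀0, ?_, fun h hh => ?_⟩
  · have h1 : ∫⁻ T in Set.Ioo 0 T₀, ENNReal.ofReal (T * ε) ≤ ENNReal.ofReal δ := by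
      refine le_trans ?_ hδQ
      refine (setLIntegral_mono' measurableSet_Ioo fun T hT => ?_).trans
        (lintegral_mono_set Set.Ioo_subset_Ioi_self)
      rw [min_eq_left (hlo T hT.1 hT.2).le]
    have h2 : ∫⁻ T in Set.Ioo 0 T₀, ENNReal.ofReal (T * ε) =
        ENNReal.ofReal (∫ T in Set.Ioo 0 T₀, T * ε) := by
      rw [ofReal_integral_eq_lintegral_ofReal]
      · exact ((by fun_prop : Continuous fun T : ℝ => T * ε).integrableOn_Icc (a := 0)
          (b := T₀)).mono_set Set.Ioo_subset_Icc_self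
      · exact (ae_restrict_iff' measurableSet_Ioo).2
          (ae_of_all _ fun T hT => mul_nonneg hT.1.le hε.le)
    rw [h2, ENNReal.ofReal_le_ofReal_iff hδ.le, ← integral_Ioc_eq_integral_Ioo,
      ← intervalIntegral.integral_of_le hT₀0, intervalIntegral.integral_mul_const,
      integral_id] at h1
    linarith
  · have hmax : Integrable (fun x => max (h x ^ 2 - T₀ ^ 2) 0) D := by
      have := (hint h hh).sub (integrable_const (T₀ ^ 2))
      exact this.sup (integrable_const 0)
    -- Layer cake formula: `2 t` on `t > T₀` is the derivative of the excess of `t ^ 2` over `T₀ ^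
    -- 2`. Beyond `T₀` both `ε` and `Q` bound the tails, so their minimum does.
    have h1 := lintegral_comp_eq_lintegral_meas_le_mul D (f := fun x => |h x|)
      (g := (Set.Ioi T₀).indicator fun t => 2 * t) (ae_of_all _ fun x => abs_nonneg _)
      (hmeas h hh).abs.aemeasurable (fun t _ => by
        have : IntervalIntegrable (fun t : ℝ => 2 * t) volume 0 t :=
          (by fun_prop : Continuous fun t : ℝ => 2 * t).intervalIntegrable 0 t
        rw [intervalIntegrable_iff] at this ⊢
        exact this.indicator measurableSet_Ioi)
      (ae_of_all _ fun t => Set.indicator_nonneg (fun t ht => by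
        have : T₀ < t := ht
        linarith) t)
    simp only [intervalIntegral_indicator_Ioi hT₀0 (abs_nonneg _), sq_abs] at h1
    rw [← ofReal_integral_eq_lintegral_ofReal hmax (ae_of_all _ fun x => le_max_right _ _)] at h1
    have h2 : ∫⁻ t in Set.Ioi (0 : ℝ), D {a | t ≤ |h a|} *
        ENNReal.ofReal ((Set.Ioi T₀).indicator (fun t => 2 * t) t) ≤ 2 * ENNReal.ofReal δ := by
      calc _ ≤ ∫⁻ T in Set.Ioi (0 : ℝ), 2 * ENNReal.ofReal (T * min ε (Q T)) := by
            refine setLIntegral_mono' measurableSet_Ioi fun t ht => ?_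
            have ht0 : 0 < t := ht
            by_cases htT : T₀ < t
            · rw [Set.indicator_of_mem (show t ∈ Set.Ioi T₀ from htT), ← ofReal_measureReal,
                ← ENNReal.ofReal_mul measureReal_nonneg,
                ← ENNReal.ofReal_ofNat 2, ← ENNReal.ofReal_mul (by norm_num)]
              refine ENNReal.ofReal_le_ofReal ?_
              have := le_min ((hhi t htT).2 h hh) (hQ h hh t ht0)
              nlinarith
            · rw [Set.indicator_of_notMem (show t ∉ Set.Ioi T₀ from htT)]
              simp
        _ = 2 * ∫⁻ T in Set.Ioi (0 : ℝ), ENNReal.ofReal (T * min ε (Q T)) :=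
            lintegral_const_mul' _ _ (by norm_num)
        _ ≤ _ := mul_le_mul_right hδQ 2
    rw [← h1, ← ENNReal.ofReal_ofNat 2, ← ENNReal.ofReal_mul (by norm_num),
      ENNReal.ofReal_le_ofReal_iff (by positivity)] at h2
    exact h2

end RobustChow

/-! ### Clean samples are good with high probability -/

namespace RobustChow

open EmpiricalProcess

/-- Vectors of norm greater than `R` are replaced by zero. -/
noncomputable def truncate {E : Type*} [NormedAddCommGroup E] (R : ℝ) (z : E) : E :=
  open Classical in if ‖z‖ ≤ R then z else 0

section truncate

variable {E : Type*} [NormedAddCommGroup E] {R : ℝ}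

theorem truncate_of_le {z : E} (h : ‖z‖ ≤ R) : truncate R z = z := if_pos h

theorem truncate_of_lt {z : E} (h : R < ‖z‖) : truncate R z = 0 := if_neg (not_le.2 h)

theorem norm_truncate_le (hR : 0 ≤ R) (z : E) : ‖truncate R z‖ ≤ R := by
  rcases le_or_gt ‖z‖ R with h | h
  · rwa [truncate_of_le h]
  · rwa [truncate_of_lt h, norm_zero]

theorem norm_truncate_le_norm (z : E) : ‖truncate R z‖ ≤ ‖z‖ := by
  rcases le_or_gt ‖z‖ R with h | h
  · rw [truncate_of_le h]
  · rw [truncate_of_lt h, norm_zero]; exact norm_nonneg _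

theorem measurable_truncate [MeasurableSpace E] [BorelSpace E] : Measurable (truncate (E := E) R) :=
  Measurable.ite (measurableSet_le measurable_norm measurable_const) measurable_id measurable_const

end truncate

/-- The properties of a clean sample on which the analysis of the filter relies. -/
structure IsGoodSample {X E : Type*} [MeasurableSpace X] [NormedAddCommGroup E]
    [InnerProductSpace ℝ E] (D : Measure X) (u : X → E) (f : X → ℝ) (R T₀ ε δ : ℝ) {N : ℕ}
    (x : Fin N → X) : Prop where
  few_large : (({k | R < ‖u (x k)‖} : Set (Fin N)).ncard : ℝ) ≤ 5 * ε * N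
  excess_le : ∀ a : E, ∑ k, max (inner ℝ a (truncate R (u (x k))) ^ 2 - T₀ ^ 2 * ‖a‖ ^ 2) 0 ≤
    N * ((2 * δ + ε) * ‖a‖ ^ 2)
  second_moment_le : ∀ a : E, ∑ k, inner ℝ a (truncate R (u (x k))) ^ 2 ≤ N * ((1 + ε) * ‖a‖ ^ 2)
  le_second_moment : ∀ a : E, N * (∫ y, inner ℝ a (u y) ^ 2 ∂D - (3 * δ + ε) * ‖a‖ ^ 2) ≤
    ∑ k, inner ℝ a (truncate R (u (x k))) ^ 2
  correlation : ∀ a : E, |∑ k, f (x k) * inner ℝ a (truncate R (u (x k))) -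
    N * ∫ y, f y * inner ℝ a (u y) ∂D| ≤ N * ((ε + 2 * √(ε * δ)) * ‖a‖)

theorem exists_mem_closedBall_smul_eq {E : Type*} [NormedAddCommGroup E] [NormedSpace ℝ E] (a : E) :
    ∃ a' ∈ Metric.closedBall (0 : E) 1, a = ‖a‖ • a' := by
  rcases eq_or_ne a 0 with rfl | h
  · exact ⟨0, by simp, by simp⟩
  · exact ⟨‖a‖⁻¹ • a, by simp [norm_smul, h], by rw [smul_inv_smul₀ (norm_ne_zero_iff.2 h)]⟩

theorem abs_max_sub_max_zero_le (s t c : ℝ) : |max (s - c) 0 - max (t - c) 0| ≤ |s - t| := by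
  have := abs_max_sub_max_le_abs (s - c) (t - c) 0
  simpa using this

section Probability

variable {X : Type*} [MeasurableSpace X] {E : Type*} [NormedAddCommGroup E] [InnerProductSpace ℝ E]
  [MeasurableSpace E] [BorelSpace E] [SecondCountableTopology E]

/-- With `L = 2 * R` and second moment at most `4 * R ^ 2`, the variance term is `64 * R ^ 4 * N`,
the square of the chosen `c = 8 * R ^ 2 * √N`. The expected supremum is thus at most `c`, and
Markov's inequality at `ε * N` gives `1 / 50` exactly when `400 * R ^ 2 ≤ ε * √N`; hence the number
`160000`. -/
theorem measure_exists_deviation_le (D : Measure X) [IsProbabilityMeasure D]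
    {v : X → E} (hv : Measurable v) {R : ℝ} (hR0 : 0 < R) (hR : ∀ x, ‖v x‖ ≤ R)
    (hV : ∫ x, ‖v x‖ ^ 2 ∂D ≤ 4 * R ^ 2) {g : E → X → ℝ}
    (hg : ∀ a, Measurable (g a)) (hg0 : ∀ x, g 0 x = 0)
    (hL : ∀ a ∈ Metric.closedBall (0 : E) 1, ∀ b ∈ Metric.closedBall (0 : E) 1, ∀ x,
      |g a x - g b x| ≤ 2 * R * |inner ℝ (a - b) (v x)|)
    {ε : ℝ} (hε : 0 < ε) {N : ℕ} (hN : 160000 * R ^ 4 / ε ^ 2 ≤ N) :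
    Measure.pi (fun _ : Fin N => D)
      {x | ∃ a ∈ Metric.closedBall (0 : E) 1, ε * N < ∑ k, (g a (x k) - ∫ y, g a y ∂D)} ≤
      ENNReal.ofReal (1 / 50) := by
  have hN0 : (0 : ℝ) < N := lt_of_lt_of_le (by positivity) hN
  have hs : (0 : ℝ) < √N := Real.sqrt_pos.2 hN0
  have hG : ∀ a ∈ Metric.closedBall (0 : E) 1, ∀ x, |g a x| ≤ 2 * R * R := by
    intro a ha x
    have h1 := hL a ha 0 (by simp) x
    rw [hg0, sub_zero, sub_zero] at h1
    refine h1.trans (mul_le_mul_of_nonneg_left ((abs_real_inner_le_norm _ _).trans ?_)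
      (by positivity))
    exact (mul_le_of_le_one_left (norm_nonneg _) (mem_closedBall_zero_iff.1 ha)).trans (hR x)
  refine (measure_exists_sum_centered_gt_le D hv hR hV hg hg0 hG (L := 2 * R) (by positivity) hL
    (c := 8 * R ^ 2 * √N) (by positivity) N (s := ε * N) (by positivity)).trans ?_
  refine ENNReal.ofReal_le_ofReal ?_
  rw [div_div, div_le_div_iff₀ (by positivity) (by norm_num), mul_pow (8 * R ^ 2),
    Real.sq_sqrt hN0.le]
  have h2 : 400 * R ^ 2 ≤ ε * √N := by
    rw [← Real.sqrt_sq (show 0 ≤ 400 * R ^ 2 by positivity), ← Real.sqrt_sq hε.le,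
      ← Real.sqrt_mul (by positivity)]
    refine Real.sqrt_le_sqrt ?_
    rw [div_le_iff₀ (by positivity)] at hN
    nlinarith
  have h3 := mul_le_mul_of_nonneg_right h2 (show 0 ≤ 16 * R ^ 2 * N by positivity)
  nlinarith [h3]

/-- Markov's inequality: the expected number of hits is at most `N * ε / 10`, one fiftieth of the
threshold. -/
theorem measure_many_large_le (D : Measure X) [IsProbabilityMeasure D] {A : Set X}
    (hA : MeasurableSet A) {ε : ℝ} (hε : 0 < ε) (hDA : D.real A ≤ ε / 10) (N : ℕ) :
    Measure.pi (fun _ : Fin N => D)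
      {x | 5 * ε * N < (({k | x k ∈ A} : Set (Fin N)).ncard : ℝ)} ≤ ENNReal.ofReal (1 / 50) := by
  classical
  rcases Nat.eq_zero_or_pos N with rfl | hN
  · refine le_trans (le_of_eq ?_) zero_le
    convert measure_empty (μ := Measure.pi fun _ : Fin 0 => D)
    ext x
    simp [Set.eq_empty_of_isEmpty]
  have hN0 : (0 : ℝ) < N := by exact_mod_cast hN
  set P := Measure.pi (fun _ : Fin N => D)
  set c : (Fin N → X) → ℝ := fun x => ∑ k, A.indicator 1 (x k) with hc
  have hcard : ∀ x : Fin N → X, (({k | x k ∈ A} : Set (Fin N)).ncard : ℝ) = c x := by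
    intro x
    rw [Set.ncard_eq_toFinset_card']
    simp [hc, Set.indicator_apply]
  have hmp : ∀ k : Fin N, MeasurePreserving (fun x : Fin N → X => x k) P D := fun k =>
    measurePreserving_eval (fun _ => D) k
  have hind : Integrable (A.indicator (1 : X → ℝ)) D := (integrable_const (1 : ℝ)).indicator hA
  have hik : ∀ k : Fin N, Integrable (fun x : Fin N → X => A.indicator (1 : X → ℝ) (x k)) P :=
    fun k => (hmp k).integrable_comp_of_integrable hind
  have hci : Integrable c P := integrable_finsetSum _ fun k _ => hik k
  have hcI : ∫ x, c x ∂P ≤ N * (ε / 10) := by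
    rw [hc, integral_finsetSum _ fun k _ => hik k]
    refine (Finset.sum_le_card_nsmul _ _ (ε / 10) fun k _ => ?_).trans (by simp)
    have h1 : ∫ x, A.indicator (1 : X → ℝ) (x k) ∂P = ∫ y, A.indicator (1 : X → ℝ) y ∂D := by
      rw [← (hmp k).map_eq, integral_map (hmp k).measurable.aemeasurable]
      rw [(hmp k).map_eq]
      exact hind.aestronglyMeasurable
    rw [h1, integral_indicator_one hA]
    exact hDA
  have h2 := mul_meas_ge_le_integral_of_nonneg (μ := P) (f := c)
    (ae_of_all _ fun x => Finset.sum_nonneg fun k _ => Set.indicator_nonneg (by simp) _) hci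
    (5 * ε * N)
  have h3 : {x : Fin N → X | 5 * ε * N < (({k | x k ∈ A} : Set (Fin N)).ncard : ℝ)} ⊆
      {x | 5 * ε * N ≤ c x} := fun x (hx : 5 * ε * N < _) => by
    rw [hcard] at hx; exact hx.le
  refine (measure_mono h3).trans ?_
  rw [← ofReal_measureReal]
  refine ENNReal.ofReal_le_ofReal ?_
  rw [le_div_iff₀ (by norm_num)]
  have h4 := h2.trans hcI
  have : 5 * ε * N * (P.real {x | 5 * ε * N ≤ c x} * 50 - 1) ≤ 0 := by nlinarith
  nlinarith [mul_pos hε hN0, nonpos_of_mul_nonpos_right this (by positivity)]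

/-- Five exceptional events of probability `1 / 50` each: too many long vectors, and upward
deviations of the excesses, of the squares, of their negatives and of the correlations. Homogeneity
extends the estimates from the unit ball to all vectors. What remains is to compare the means of
truncated and untruncated quantities. -/
theorem measure_not_isGoodSample_le (D : Measure X) [IsProbabilityMeasure D] {u : X → E}
    (hu : Measurable u) (huc : ∀ c, ∫ x, inner ℝ c (u x) ^ 2 ∂D ≤ ‖c‖ ^ 2)
    (hui : ∀ c, Integrable (fun x => inner ℝ c (u x) ^ 2) D) {R : ℝ} (hR : 1 ≤ 2 * R)
    (hun : Integrable (fun x => ‖u x‖ ^ 2) D) (hdim : ∫ x, ‖u x‖ ^ 2 ∂D ≤ 4 * R ^ 2)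
    {T₀ ε δ : ℝ} (hε : 0 < ε) (hδ : 0 < δ) (hT : ε * T₀ ^ 2 ≤ 2 * δ)
    (hexc : ∀ c : E, ‖c‖ ≤ 1 → ∫ x, max (inner ℝ c (u x) ^ 2 - T₀ ^ 2) 0 ∂D ≤ 2 * δ)
    (hlarge : D.real {x | R < ‖u x‖} ≤ ε / 10)
    {N : ℕ} (hN : 160000 * R ^ 4 / ε ^ 2 ≤ N)
    {f : X → ℝ} (hf : Measurable f) (hf1 : ∀ x, |f x| ≤ 1) :
    Measure.pi (fun _ : Fin N => D) {x | ¬ IsGoodSample D u f R T₀ ε δ x} ≤ 1 / 10 := by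
  have hR0 : 0 < R := by linarith
  set v : X → E := fun x => truncate R (u x) with hv
  have hvm : Measurable v := measurable_truncate.comp hu
  have hvR : ∀ x, ‖v x‖ ≤ R := fun x => norm_truncate_le hR0.le _
  have hvi : Integrable (fun x => ‖v x‖ ^ 2) D := by
    refine Integrable.of_bound (C := R ^ 2) (by fun_prop) (ae_of_all _ fun x => ?_)
    rw [Real.norm_eq_abs, abs_of_nonneg (by positivity)]
    exact pow_le_pow_left₀ (norm_nonneg _) (hvR x) 2
  have hV : ∫ x, ‖v x‖ ^ 2 ∂D ≤ 4 * R ^ 2 := (integral_mono hvi hun fun x =>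
    pow_le_pow_left₀ (norm_nonneg _) (norm_truncate_le_norm (u x)) 2).trans hdim
  have hvsq : ∀ a x, inner ℝ a (v x) ^ 2 ≤ inner ℝ a (u x) ^ 2 := fun a x => by
    rcases le_or_gt ‖u x‖ R with h | h
    · rw [hv]; simp only [truncate_of_le h]; exact le_rfl
    · rw [hv]; simpa only [truncate_of_lt h, inner_zero_right, zero_pow two_ne_zero] using sq_nonneg _
  have hvsqi : ∀ a, Integrable (fun x => inner ℝ a (v x) ^ 2) D := fun a =>
    (hui a).mono' (by fun_prop) (ae_of_all _ fun x => by
      rw [Real.norm_eq_abs, abs_of_nonneg (sq_nonneg _)]; exact hvsq a x)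
  have hexi : ∀ a, Integrable (fun x => max (inner ℝ a (u x) ^ 2 - T₀ ^ 2) 0) D := fun a =>
    ((hui a).sub (integrable_const (T₀ ^ 2))).sup (integrable_const 0)
  have hsqL : ∀ a ∈ Metric.closedBall (0 : E) 1, ∀ b ∈ Metric.closedBall (0 : E) 1, ∀ x,
      |inner ℝ a (v x) ^ 2 - inner ℝ b (v x) ^ 2| ≤ 2 * R * |inner ℝ (a - b) (v x)| := by
    intro a ha b hb x
    have hle : ∀ a ∈ Metric.closedBall (0 : E) 1, |inner ℝ a (v x)| ≤ R := fun a ha =>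
      (abs_real_inner_le_norm _ _).trans ((mul_le_of_le_one_left (norm_nonneg _)
        (mem_closedBall_zero_iff.1 ha)).trans (hvR x))
    rw [sq_sub_sq, abs_mul, inner_sub_left]
    exact mul_le_mul_of_nonneg_right ((abs_add_le _ _).trans (by linarith [hle a ha, hle b hb]))
      (abs_nonneg _)
  set A : Set X := {x | R < ‖u x‖} with hA
  have hAm : MeasurableSet A := measurableSet_lt measurable_const hu.norm
  have hind : Integrable (A.indicator (1 : X → ℝ)) D := (integrable_const (1 : ℝ)).indicator hAm
  -- Truncation loses only the squares on `A`. Each is at most `T₀ ^ 2` plus its excess, and `A` has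
  -- measure at most `ε / 10`, so the loss is at most `2 * δ / 10 + 2 * δ`.
  have htail : ∀ a ∈ Metric.closedBall (0 : E) 1,
      ∫ x, (inner ℝ a (u x) ^ 2 - inner ℝ a (v x) ^ 2) ∂D ≤ 3 * δ := by
    intro a ha
    have h1 : ∫ x, (inner ℝ a (u x) ^ 2 - inner ℝ a (v x) ^ 2) ∂D ≤
        ∫ x, (T₀ ^ 2 * A.indicator 1 x + max (inner ℝ a (u x) ^ 2 - T₀ ^ 2) 0) ∂D := by
      refine integral_mono ((hui a).sub (hvsqi a)) ((hind.const_mul _).add (hexi a)) fun x => ?_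
      dsimp only
      rcases le_or_gt ‖u x‖ R with h | h
      · rw [hv]
        simp only [truncate_of_le h, sub_self]
        rw [Set.indicator_of_notMem (show x ∉ A from not_lt.2 h)]
        simp
      · rw [hv]
        simp only [truncate_of_lt h, inner_zero_right]
        rw [Set.indicator_of_mem (show x ∈ A from h)]
        have := le_max_left (inner ℝ a (u x) ^ 2 - T₀ ^ 2) 0
        simp only [Pi.one_apply]
        linarith
    rw [integral_add (hind.const_mul _) (hexi a), integral_const_mul, integral_indicator_one hAm]
      at h1
    have h2 := hexc a (mem_closedBall_zero_iff.1 ha)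
    have h3 := mul_le_mul_of_nonneg_left hlarge (sq_nonneg T₀)
    linarith
  have dev := fun {g : E → X → ℝ} hg hg0 hL =>
    measure_exists_deviation_le D hvm hR0 hvR hV (g := g) hg hg0 hL hε hN
  have bA := measure_many_large_le D hAm hε hlarge N
  have bB := dev (g := fun a x => max (inner ℝ a (v x) ^ 2 - T₀ ^ 2) 0) (fun a => by fun_prop)
    (fun x => by simp [sq_nonneg]) (fun a ha b hb x =>
      (abs_max_sub_max_zero_le _ _ _).trans (hsqL a ha b hb x))
  have bC := dev (g := fun a x => inner ℝ a (v x) ^ 2) (fun a => by fun_prop)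
    (fun x => by simp) hsqL
  have bD := dev (g := fun a x => -inner ℝ a (v x) ^ 2) (fun a => by fun_prop)
    (fun x => by simp) (fun a ha b hb x => by
      rw [neg_sub_neg, abs_sub_comm]; exact hsqL a ha b hb x)
  -- This one-sided bound suffices for the absolute value, since the ball contains `-a` with `a`.
  -- The Lipschitz constant is only `1`, and `1 ≤ 2 * R` fits it into the common form.
  have bE := dev (g := fun a x => f x * inner ℝ a (v x)) (fun a => by fun_prop)
    (fun x => by simp) (fun a ha b hb x => by
      rw [← mul_sub, ← inner_sub_left, abs_mul]
      exact mul_le_mul_of_nonneg_right ((hf1 x).trans hR) (abs_nonneg _))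
  refine le_trans (measure_mono ?_) (((measure_union_le _ _).trans (add_le_add
    ((measure_union_le _ _).trans (add_le_add ((measure_union_le _ _).trans (add_le_add
      ((measure_union_le _ _).trans (add_le_add bA bB)) bC)) bD)) bE)).trans (le_of_eq ?_))
  swap
  · rw [← ENNReal.ofReal_add, ← ENNReal.ofReal_add, ← ENNReal.ofReal_add, ← ENNReal.ofReal_add]
    · norm_num [ENNReal.ofReal_div_of_pos]
    all_goals norm_num
  intro x hx
  by_contra hcon
  simp only [Set.mem_union, Set.mem_ofPred_eq, not_or, not_exists, not_and, not_lt,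
    Finset.sum_sub_distrib, Finset.sum_const, Finset.card_univ, Fintype.card_fin,
    nsmul_eq_mul] at hcon
  obtain ⟨⟨⟨⟨cA, cB⟩, cC⟩, cD⟩, cE⟩ := hcon
  refine hx ⟨cA, fun a => ?_, fun a => ?_, fun a => ?_, fun a => ?_⟩
  · obtain ⟨a', ha', h⟩ := exists_mem_closedBall_smul_eq a
    have h1 := cB a' ha'
    have h2 : ∫ y, max (inner ℝ a' (v y) ^ 2 - T₀ ^ 2) 0 ∂D ≤ 2 * δ := by
      refine le_trans (integral_mono (((hvsqi a').sub (integrable_const (T₀ ^ 2))).sup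
        (integrable_const 0)) (hexi a') fun y => ?_) (hexc a' (mem_closedBall_zero_iff.1 ha'))
      exact max_le_max (sub_le_sub_right (hvsq a' y) _) le_rfl
    have h3 : ∑ k, max (inner ℝ a (v (x k)) ^ 2 - T₀ ^ 2 * ‖a‖ ^ 2) 0 =
        ‖a‖ ^ 2 * ∑ k, max (inner ℝ a' (v (x k)) ^ 2 - T₀ ^ 2) 0 := by
      rw [Finset.mul_sum]
      refine Finset.sum_congr rfl fun k _ => ?_
      rw [mul_max_of_nonneg _ _ (by positivity), mul_zero]
      conv_lhs => rw [show inner ℝ a (v (x k)) = ‖a‖ * inner ℝ a' (v (x k)) by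
        conv_lhs => rw [h, inner_smul_left]
        simp]
      congr 1; ring
    change ∑ k, max (inner ℝ a (v (x k)) ^ 2 - T₀ ^ 2 * ‖a‖ ^ 2) 0 ≤ _
    rw [h3]
    have h4 := mul_le_mul_of_nonneg_left h2 (Nat.cast_nonneg (α := ℝ) N)
    have h5 : ∑ k, max (inner ℝ a' (v (x k)) ^ 2 - T₀ ^ 2) 0 ≤ N * (2 * δ + ε) := by linarith
    nlinarith [mul_le_mul_of_nonneg_left h5 (sq_nonneg ‖a‖)]
  · obtain ⟨a', ha', h⟩ := exists_mem_closedBall_smul_eq a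
    have h1 := cC a' ha'
    have h2 : ∫ y, inner ℝ a' (v y) ^ 2 ∂D ≤ 1 :=
      (integral_mono (hvsqi a') (hui a') (hvsq a')).trans ((huc a').trans
        (pow_le_one₀ (norm_nonneg _) (mem_closedBall_zero_iff.1 ha')))
    have h3 : ∑ k, inner ℝ a (v (x k)) ^ 2 = ‖a‖ ^ 2 * ∑ k, inner ℝ a' (v (x k)) ^ 2 := by
      rw [Finset.mul_sum]
      refine Finset.sum_congr rfl fun k _ => ?_
      conv_lhs => rw [h, inner_smul_left]
      simp; ring
    change ∑ k, inner ℝ a (v (x k)) ^ 2 ≤ _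
    rw [h3]
    have h4 := mul_le_mul_of_nonneg_left h2 (Nat.cast_nonneg (α := ℝ) N)
    have h5 : ∑ k, inner ℝ a' (v (x k)) ^ 2 ≤ N * (1 + ε) := by linarith
    nlinarith [mul_le_mul_of_nonneg_left h5 (sq_nonneg ‖a‖)]
  · obtain ⟨a', ha', h⟩ := exists_mem_closedBall_smul_eq a
    have h1 := cD a' ha'
    have h2 := htail a' ha'
    rw [integral_sub (hui a') (hvsqi a')] at h2
    have h3 : ∑ k, inner ℝ a (v (x k)) ^ 2 = ‖a‖ ^ 2 * ∑ k, inner ℝ a' (v (x k)) ^ 2 := by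
      rw [Finset.mul_sum]
      refine Finset.sum_congr rfl fun k _ => ?_
      conv_lhs => rw [h, inner_smul_left]
      simp; ring
    have h3' : ∫ y, inner ℝ a (u y) ^ 2 ∂D = ‖a‖ ^ 2 * ∫ y, inner ℝ a' (u y) ^ 2 ∂D := by
      rw [← integral_const_mul]
      refine integral_congr_ae (ae_of_all _ fun y => ?_)
      dsimp only
      conv_lhs => rw [h, inner_smul_left]
      simp; ring
    change _ ≤ ∑ k, inner ℝ a (v (x k)) ^ 2
    rw [h3, h3']
    have h4 := mul_le_mul_of_nonneg_left h2 (Nat.cast_nonneg (α := ℝ) N)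
    rw [Finset.sum_neg_distrib, integral_neg] at h1
    have h5 : N * (∫ y, inner ℝ a' (u y) ^ 2 ∂D - (3 * δ + ε)) ≤
      ∑ k, inner ℝ a' (v (x k)) ^ 2 := by linarith
    nlinarith [mul_le_mul_of_nonneg_left h5 (sq_nonneg ‖a‖)]
  · obtain ⟨a', ha', h⟩ := exists_mem_closedBall_smul_eq a
    have h1 := cE a' ha'
    have hna' : -a' ∈ Metric.closedBall (0 : E) 1 := by simpa using ha'
    have h1' := cE (-a') hna'
    have hL1 : ∀ (w : X → E), Measurable w → Integrable (fun x => inner ℝ a' (w x) ^ 2) D →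
        Integrable (fun x => f x * inner ℝ a' (w x)) D := by
      intro w hw hwi
      refine ((integrable_const (1 : ℝ)).add hwi).mono' (by fun_prop) (ae_of_all _ fun y => ?_)
      rw [Real.norm_eq_abs, abs_mul]
      have : |f y| * |inner ℝ a' (w y)| ≤ 1 * |inner ℝ a' (w y)| :=
        mul_le_mul_of_nonneg_right (hf1 y) (abs_nonneg _)
      simp only [Pi.add_apply]
      nlinarith [sq_nonneg (|inner ℝ a' (w y)| - 1), sq_abs (inner ℝ a' (w y)),
        abs_nonneg (inner ℝ a' (w y))]
    have iu := hL1 u hu (hui a')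
    have iv := hL1 v hvm (hvsqi a')
    have h2 : |∫ y, f y * inner ℝ a' (u y) ∂D - ∫ y, f y * inner ℝ a' (v y) ∂D| ≤
        2 * √(ε * δ) := by
      -- Cauchy-Schwarz in the form `t ≤ lam / 2 + t ^ 2 / (2 * lam)` on `A`. This `lam` balances
      -- the measure of `A`, of order `ε`, against the lost second moment, of order `δ`; both terms
      -- become multiples of `√(ε * δ)`.
      set lam := √(δ / ε)
      have hlam : 0 < lam := Real.sqrt_pos.2 (by positivity)
      rw [← integral_sub iu iv, ← Real.norm_eq_abs]
      have hsub : Integrable (fun y => inner ℝ a' (u y) ^ 2 - inner ℝ a' (v y) ^ 2) D :=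
        (hui a').sub (hvsqi a')
      refine (norm_integral_le_of_norm_le (g := fun y => (lam / 2) * A.indicator 1 y +
        (1 / (2 * lam)) * (inner ℝ a' (u y) ^ 2 - inner ℝ a' (v y) ^ 2))
        ((hind.const_mul _).add (hsub.const_mul _)) (ae_of_all _ fun y => ?_)).trans ?_
      · rcases le_or_gt ‖u y‖ R with h | h
        · rw [hv]
          simp only [truncate_of_le h, sub_self]
          rw [Set.indicator_of_notMem (show y ∉ A from not_lt.2 h)]
          simp
        · rw [hv]
          simp only [truncate_of_lt h, inner_zero_right]
          rw [Set.indicator_of_mem (show y ∈ A from h), Real.norm_eq_abs, mul_zero, sub_zero,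
            abs_mul]
          refine (mul_le_of_le_one_left (abs_nonneg _) (hf1 y)).trans ?_
          simp only [Pi.one_apply]
          rw [← sq_abs (inner ℝ a' (u y))]
          set t := |inner ℝ a' (u y)|
          have : lam / 2 * 1 + 1 / (2 * lam) * (t ^ 2 - 0 ^ 2) - t = (t - lam) ^ 2 / (2 * lam) := by
            field_simp; ring
          have h0 : 0 ≤ (t - lam) ^ 2 / (2 * lam) := by positivity
          linarith
      · rw [integral_add (hind.const_mul _) (hsub.const_mul _), integral_const_mul,
          integral_const_mul, integral_indicator_one hAm]
        have e1 : √(ε * δ) = ε * lam := by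
          rw [show ε * δ = ε ^ 2 * (δ / ε) by field_simp, Real.sqrt_mul (by positivity),
            Real.sqrt_sq hε.le]
        have e2 : δ = ε * lam ^ 2 := by
          rw [Real.sq_sqrt (by positivity)]; field_simp
        have b1 := mul_le_mul_of_nonneg_left hlarge (show 0 ≤ lam / 2 by positivity)
        have b2 := mul_le_mul_of_nonneg_left (htail a' ha') (show 0 ≤ 1 / (2 * lam) by positivity)
        have e3 : 1 / (2 * lam) * (3 * δ) = 3 / 2 * (ε * lam) := by
          rw [e2]; field_simp
        rw [e1]
        rw [e3] at b2
        nlinarith [mul_pos hε hlam]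
    have hs : ∀ (w : X → E) y, f y * inner ℝ a (w y) = ‖a‖ * (f y * inner ℝ a' (w y)) := by
      intro w y
      conv_lhs => rw [h, inner_smul_left]
      simp; ring
    change |∑ k, f (x k) * inner ℝ a (v (x k)) - _| ≤ _
    simp only [hs, integral_const_mul]
    rw [← Finset.mul_sum, mul_left_comm, ← mul_sub, abs_mul, abs_norm]
    simp only [inner_neg_left, mul_neg, Finset.sum_neg_distrib, integral_neg] at h1'
    have h5 : |∑ k, f (x k) * inner ℝ a' (v (x k)) - N * ∫ y, f y * inner ℝ a' (u y) ∂D| ≤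
        N * (ε + 2 * √(ε * δ)) := by
      rw [abs_le] at h2 ⊢
      have g1 := mul_le_mul_of_nonneg_left h2.1 (Nat.cast_nonneg (α := ℝ) N)
      have g2 := mul_le_mul_of_nonneg_left h2.2 (Nat.cast_nonneg (α := ℝ) N)
      constructor <;> linarith
    calc _ ≤ ‖a‖ * (N * (ε + 2 * √(ε * δ))) := mul_le_mul_of_nonneg_left h5 (norm_nonneg _)
      _ = _ := by ring

end Probability

end RobustChow

/-! ### Deterministic analysis of the filter -/

namespace RobustChow

/-- `r` is the largest of the numbers `τ i` with `0 < w i`, or zero if there are none. -/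
def IsMaxScore {N : ℕ} (w τ : Fin N → ℝ) (r : ℝ) : Prop :=
  (∀ i, 0 < w i → τ i ≤ r) ∧ (r = 0 ∨ ∃ i, 0 < w i ∧ τ i = r)

/-- Corrupted evaluations of a family of functions: `val a i` is the value at the `i`-th corrupted
point of the function with label `a`. Outside of the bad set it is the inner product of the
coordinate vector `b a` with the (truncated) whitened clean point `z i`. -/
structure CorruptedValues {α E : Type*} [NormedAddCommGroup E] [InnerProductSpace ℝ E] {N : ℕ}
    (val : α → Fin N → ℝ) (q : α → ℝ) (b : α → E) (z : Fin N → E) (Bd : Finset (Fin N))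
    (T₀ ε γ δ : ℝ) : Prop where
  eps_pos : 0 < ε
  delta_pos : 0 < δ
  gamma_nonneg : 0 ≤ γ
  gamma_le : γ ≤ 1 / 2
  trunc : ε * T₀ ^ 2 ≤ 2 * δ
  bad_card : (Bd.card : ℝ) ≤ 6 * ε * N
  val_eq : ∀ a, ∀ i ∉ Bd, val a i = inner ℝ (b a) (z i)
  lower : ∀ a, (1 - γ) * ‖b a‖ ^ 2 ≤ q a
  upper : ∀ a, q a ≤ (1 + γ) * ‖b a‖ ^ 2
  excess_le : ∀ a, ∑ k, max (inner ℝ (b a) (z k) ^ 2 - T₀ ^ 2 * ‖b a‖ ^ 2) 0 ≤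
    N * ((2 * δ + ε) * ‖b a‖ ^ 2)
  second_moment_le : ∀ a, ∑ k, inner ℝ (b a) (z k) ^ 2 ≤ N * ((1 + ε) * ‖b a‖ ^ 2)
  le_second_moment : ∀ a, N * (‖b a‖ ^ 2 - (3 * δ + ε) * ‖b a‖ ^ 2) ≤ ∑ k, inner ℝ (b a) (z k) ^ 2

/-- The weights stay in `[0, 1]`, and no more weight has been removed from good points than from
bad points. -/
structure WeightInvariant {N : ℕ} (Bd : Finset (Fin N)) (w : Fin N → ℝ) : Prop where
  nonneg : ∀ i, 0 ≤ w i
  le_one : ∀ i, w i ≤ 1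
  removed : ∑ i ∈ Bdᶜ, (1 - w i) ≤ ∑ i ∈ Bd, (1 - w i)

namespace CorruptedValues

variable {α E : Type*} [NormedAddCommGroup E] [InnerProductSpace ℝ E] {N : ℕ}
  {val : α → Fin N → ℝ} {q : α → ℝ} {b : α → E} {z : Fin N → E} {Bd : Finset (Fin N)}
  {T₀ ε γ δ : ℝ}

/-- Few points carry little second moment: each square is at most the level `T₀ ^ 2 * ‖b a‖ ^ 2`
plus its excess. The level, charged `12 * ε * N` times, costs `24 * δ`, and the excesses cost `2 * δ
+ ε`. The number `12` allows for the bad points and as much removed good weight. -/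
theorem sum_weighted_sq_le (H : CorruptedValues val q b z Bd T₀ ε γ δ) {c : Fin N → ℝ}
    (h0 : ∀ i, 0 ≤ c i) (h1 : ∀ i, c i ≤ 1) (hc : ∑ i, c i ≤ 12 * ε * N) (a : α) :
    ∑ i, c i * inner ℝ (b a) (z i) ^ 2 ≤ N * (26 * (γ + δ + ε) * ‖b a‖ ^ 2) := by
  have e1 : ∀ i, c i * inner ℝ (b a) (z i) ^ 2 ≤ c i * (T₀ ^ 2 * ‖b a‖ ^ 2) +
      max (inner ℝ (b a) (z i) ^ 2 - T₀ ^ 2 * ‖b a‖ ^ 2) 0 := by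
    intro i
    have l1 := le_max_left (inner ℝ (b a) (z i) ^ 2 - T₀ ^ 2 * ‖b a‖ ^ 2) 0
    have l2 := le_max_right (inner ℝ (b a) (z i) ^ 2 - T₀ ^ 2 * ‖b a‖ ^ 2) 0
    nlinarith [h0 i, h1 i, mul_le_mul_of_nonneg_left l1 (h0 i),
      mul_le_mul_of_nonneg_right (h1 i) l2]
  have e2 := (Finset.sum_le_sum fun i (_ : i ∈ Finset.univ) => e1 i)
  rw [Finset.sum_add_distrib, ← Finset.sum_mul] at e2
  have e3 := H.excess_le a
  have hs : 0 ≤ ‖b a‖ ^ 2 := sq_nonneg _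
  have e4 : (∑ i, c i) * (T₀ ^ 2 * ‖b a‖ ^ 2) ≤ N * (24 * δ * ‖b a‖ ^ 2) := by
    calc _ ≤ 12 * ε * N * (T₀ ^ 2 * ‖b a‖ ^ 2) := mul_le_mul_of_nonneg_right hc (by positivity)
      _ = 12 * N * ‖b a‖ ^ 2 * (ε * T₀ ^ 2) := by ring
      _ ≤ 12 * N * ‖b a‖ ^ 2 * (2 * δ) := mul_le_mul_of_nonneg_left H.trunc (by positivity)
      _ = _ := by ring
  have hN : (0 : ℝ) ≤ N * ‖b a‖ ^ 2 := by positivity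
  nlinarith [mul_nonneg hN H.gamma_nonneg, mul_nonneg hN H.eps_pos.le]

/-- One step of the filter. -/
theorem filter_step (H : CorruptedValues val q b z Bd T₀ ε γ δ) {w : Fin N → ℝ}
    (hw : WeightInvariant Bd w) {a : α}
    (ha : N * ((1 + 100 * (γ + δ + ε)) * q a) < ∑ i, w i * val a i ^ 2) {r : ℝ}
    {τ : Fin N → ℝ} (hτ : ∀ i, τ i = max (val a i ^ 2 - 4 * δ / ε * q a) 0)
    (hr : IsMaxScore w τ r) {w' : Fin N → ℝ} (hw' : ∀ i, w' i = w i - w i * τ i / r) :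
    WeightInvariant Bd w' ∧ (∀ i, w i = 0 → w' i = 0) ∧ ∃ i, w i ≠ 0 ∧ w' i = 0 := by
  have hε := H.eps_pos
  have hδ := H.delta_pos
  have hγ := H.gamma_nonneg
  set s := ‖b a‖ ^ 2 with hs
  have hs0 : 0 ≤ s := sq_nonneg _
  have hq := H.lower a
  have hqs : s / 2 ≤ q a := le_trans (by nlinarith [H.gamma_le]) hq
  have hq0 : 0 ≤ q a := le_trans (by positivity) hqs
  have hN0 : (0 : ℝ) ≤ N := Nat.cast_nonneg N
  set θ := 4 * δ / ε * q a with hθ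
  have hθ0 : 0 ≤ θ := by positivity
  have hεθ : ε * θ = 4 * δ * q a := by rw [hθ]; field_simp
  have hτ0 : ∀ i, 0 ≤ τ i := fun i => by rw [hτ]; exact le_max_right _ _
  -- The computable threshold dominates the unknown level: `T₀ ^ 2 ≤ 2 * δ / ε`, and `s ≤ 2 * q a`.
  -- Scores of good points are therefore bounded by the excesses.
  have hθT : T₀ ^ 2 * s ≤ θ := by
    have h1 : ε * (T₀ ^ 2 * s) ≤ ε * θ := by
      rw [hεθ]
      nlinarith [mul_le_mul_of_nonneg_right H.trunc hs0, mul_le_mul_of_nonneg_left hqs hδ.le]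
    exact le_of_mul_le_mul_left h1 hε
  have good : ∑ i ∈ Bdᶜ, w i * τ i ≤ N * ((2 * δ + ε) * s) := by
    refine le_trans ?_ (H.excess_le a)
    refine (Finset.sum_le_sum (g := fun k => max (inner ℝ (b a) (z k) ^ 2 - T₀ ^ 2 * s) 0)
      fun i hi => ?_).trans (Finset.sum_le_sum_of_subset_of_nonneg (Finset.subset_univ _)
      fun i _ _ => le_max_right _ _)
    refine (mul_le_of_le_one_left (hτ0 i) (hw.le_one i)).trans ?_
    rw [hτ, H.val_eq a i (Finset.mem_compl.1 hi)]
    exact max_le_max (sub_le_sub_left hθT _) le_rfl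
  have good2 : ∑ i ∈ Bdᶜ, w i * val a i ^ 2 ≤ N * ((1 + ε) * s) := by
    refine le_trans ?_ (H.second_moment_le a)
    refine (Finset.sum_le_sum (g := fun k => inner ℝ (b a) (z k) ^ 2)
      fun i hi => ?_).trans (Finset.sum_le_sum_of_subset_of_nonneg (Finset.subset_univ _)
      fun i _ _ => sq_nonneg _)
    rw [← H.val_eq a i (Finset.mem_compl.1 hi)]
    exact mul_le_of_le_one_left (sq_nonneg _) (hw.le_one i)
  -- Subtracting the threshold costs at most `θ` for each of the `6 * ε * N` bad points, and `6 * ε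
  -- * θ = 24 * δ * q a`.
  have bad : ∑ i ∈ Bd, w i * val a i ^ 2 - N * (24 * δ * q a) ≤ ∑ i ∈ Bd, w i * τ i := by
    have h1 : ∀ i ∈ Bd, w i * val a i ^ 2 - θ ≤ w i * τ i := fun i _ => by
      have := le_max_left (val a i ^ 2 - θ) 0
      rw [← hτ] at this
      nlinarith [mul_le_mul_of_nonneg_left this (hw.nonneg i), hw.le_one i]
    have h2 := Finset.sum_le_sum h1
    rw [Finset.sum_sub_distrib, Finset.sum_const, nsmul_eq_mul] at h2
    have h3 := mul_le_mul_of_nonneg_right H.bad_card hθ0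
    have h4 : 6 * ε * N * θ = N * (24 * δ * q a) := by
      calc _ = 6 * N * (ε * θ) := by ring
        _ = _ := by rw [hεθ]; ring
    linarith
  have tot := Finset.sum_add_sum_compl Bd fun i => w i * val a i ^ 2
  -- The good points explain at most `(1 + ε) * s` of the violating second moment. The factor `100`
  -- leaves room for that, for the threshold loss and for the good scores, so the bad scores
  -- outweigh the good ones.
  have strict : N * ((2 * δ + ε) * s) < ∑ i ∈ Bd, w i * τ i := by
    have h1 : N * ((1 + ε) * s + (2 * δ + ε) * s + 24 * δ * q a) ≤
        N * ((1 + 100 * (γ + δ + ε)) * q a) := by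
      refine mul_le_mul_of_nonneg_left ?_ hN0
      nlinarith [mul_le_mul_of_nonneg_left hqs hγ, mul_le_mul_of_nonneg_left hqs hδ.le,
        mul_le_mul_of_nonneg_left hqs hε.le, mul_nonneg hγ hs0, mul_nonneg hδ.le hs0,
        mul_nonneg hε.le hs0]
    linarith
  have hpos : 0 < ∑ i ∈ Bd, w i * τ i := lt_of_le_of_lt (by positivity) strict
  obtain ⟨i₀, _, hi₀⟩ := Finset.exists_lt_of_sum_lt (s := Bd) (f := fun _ => (0 : ℝ))
    (g := fun i => w i * τ i) (by simpa using hpos)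
  have hw0 : 0 < w i₀ := lt_of_le_of_ne (hw.nonneg i₀) fun h => by simp [← h] at hi₀
  have hτ1 : 0 < τ i₀ := lt_of_le_of_ne (hτ0 i₀) fun h => by simp [← h] at hi₀
  have hr0 : 0 < r := hτ1.trans_le (hr.1 i₀ hw0)
  refine ⟨⟨fun i => ?_, fun i => ?_, ?_⟩, fun i hi => ?_, ?_⟩
  · rw [hw', sub_nonneg, div_le_iff₀ hr0]
    rcases (hw.nonneg i).eq_or_lt with h | h
    · simp [← h]
    · exact mul_le_mul_of_nonneg_left (hr.1 i h) h.le
  · rw [hw']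
    have : 0 ≤ w i * τ i / r := div_nonneg (mul_nonneg (hw.nonneg i) (hτ0 i)) hr0.le
    linarith [hw.le_one i]
  · have h1 : ∀ i, 1 - w' i = (1 - w i) + w i * τ i / r := fun i => by rw [hw']; ring
    simp only [h1, Finset.sum_add_distrib, ← Finset.sum_div]
    exact add_le_add hw.removed (div_le_div_of_nonneg_right (good.trans strict.le) hr0.le)
  · rw [hw', hi]; simp
  · rcases hr.2 with h | ⟨i, hi, hi'⟩
    · exact absurd h hr0.ne'
    · exact ⟨i, hi.ne', by rw [hw', hi', mul_div_assoc, div_self hr0.ne']; ring⟩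

/-- Cauchy-Schwarz with weights `c`, after the bounded factors `y i` have been dropped. -/
theorem abs_sum_mul_le_sqrt {ι : Type*} (s : Finset ι) {c x y : ι → ℝ} (hc : ∀ i ∈ s, 0 ≤ c i)
    (hy : ∀ i ∈ s, |y i| ≤ 1) {A B : ℝ} (hA : ∑ i ∈ s, c i ≤ A) (hB : ∑ i ∈ s, c i * x i ^ 2 ≤ B) :
    |∑ i ∈ s, c i * (y i * x i)| ≤ √(A * B) := by
  have h1 : |∑ i ∈ s, c i * (y i * x i)| ≤ ∑ i ∈ s, c i * |x i| := by
    refine (Finset.abs_sum_le_sum_abs _ _).trans (Finset.sum_le_sum fun i hi => ?_)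
    rw [abs_mul, abs_mul, abs_of_nonneg (hc i hi)]
    exact mul_le_mul_of_nonneg_left (mul_le_of_le_one_left (abs_nonneg _) (hy i hi)) (hc i hi)
  refine h1.trans (Real.le_sqrt_of_sq_le ?_)
  refine (Finset.sum_sq_le_sum_mul_sum_of_sq_le_mul s hc
    (g := fun i => c i * x i ^ 2) (fun i hi => mul_nonneg (hc i hi) (sq_nonneg _))
    (fun i _ => by rw [mul_pow, sq_abs]; exact le_of_eq (by ring))).trans ?_
  exact mul_le_mul hA hB (Finset.sum_nonneg fun i hi => mul_nonneg (hc i hi) (sq_nonneg _))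
    ((Finset.sum_nonneg hc).trans hA)

/-- When the weighted second moments are as small as they should be, the weighted correlations are
accurate. -/
theorem abs_correlation_sub_le (H : CorruptedValues val q b z Bd T₀ ε γ δ) {w : Fin N → ℝ}
    (hw : WeightInvariant Bd w) (hN : 0 < N) {a : α}
    (ha : ∑ i, w i * val a i ^ 2 ≤ N * ((1 + 100 * (γ + δ + ε)) * q a))
    {y fx : Fin N → ℝ} (hy : ∀ i, |y i| ≤ 1) (hfx : ∀ i, |fx i| ≤ 1) (hyf : ∀ i ∉ Bd, y i = fx i)
    {I : ℝ} (hI : |∑ k, fx k * inner ℝ (b a) (z k) - N * I| ≤ N * ((ε + 2 * √(ε * δ)) * ‖b a‖)) :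
    |(∑ i, w i * y i * val a i) / N - I| ≤ 100 * √(ε * (γ + δ + ε)) * ‖b a‖ := by
  have hε := H.eps_pos
  have hδ := H.delta_pos
  have hγ := H.gamma_nonneg
  have hN0 : (0 : ℝ) < N := Nat.cast_pos.2 hN
  set η := γ + δ + ε with hη
  have hη0 : 0 < η := by positivity
  set s := ‖b a‖ with hs
  have hs0 : 0 ≤ s := norm_nonneg _
  classical
  -- The part of the clean sample that is missing from the weighted one: the replaced or truncated
  -- points entirely, the other points by their removed weight. By the invariant it totals at most
  -- twice the number of bad points.
  set c : Fin N → ℝ := fun i => if i ∈ Bd then 1 else 1 - w i with hc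
  have hc0 : ∀ i, 0 ≤ c i := fun i => by
    simp only [hc]; split_ifs
    · exact zero_le_one
    · linarith [hw.le_one i]
  have hc1 : ∀ i, c i ≤ 1 := fun i => by
    simp only [hc]; split_ifs
    · exact le_rfl
    · linarith [hw.nonneg i]
  have hBd1 : ∑ i ∈ Bd, (1 - w i) ≤ 6 * ε * N :=
    (Finset.sum_le_card_nsmul _ _ 1 fun i _ => by linarith [hw.nonneg i]).trans
      (by simpa using H.bad_card)
  have hcs : ∑ i, c i ≤ 12 * ε * N := by
    rw [← Finset.sum_add_sum_compl Bd]
    have h1 : ∑ i ∈ Bd, c i = Bd.card := by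
      rw [Finset.sum_congr rfl fun i hi => show c i = 1 from if_pos hi]; simp
    have h2 : ∑ i ∈ Bdᶜ, c i = ∑ i ∈ Bdᶜ, (1 - w i) :=
      Finset.sum_congr rfl fun i hi => if_neg (Finset.mem_compl.1 hi)
    rw [h1, h2]
    linarith [H.bad_card, hw.removed]
  have hc2 := H.sum_weighted_sq_le hc0 hc1 hcs a
  have split : ∀ i, w i * y i * val a i = fx i * inner ℝ (b a) (z i) -
      c i * (fx i * inner ℝ (b a) (z i)) + if i ∈ Bd then w i * (y i * val a i) else 0 := by
    intro i
    by_cases h : i ∈ Bd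
    · simp only [hc, if_pos h]; ring
    · simp only [hc, if_neg h, H.val_eq a i h, hyf i h]; ring
  -- Here `12 * 26 ≤ 18 ^ 2`; below, `6 * 180 ≤ 33 ^ 2`. The three errors add up to `3 + 18 + 33 ≤
  -- 100`.
  have t2 : |∑ i, c i * (fx i * inner ℝ (b a) (z i))| ≤ 18 * N * √(ε * η) * s := by
    refine (abs_sum_mul_le_sqrt _ (fun i _ => hc0 i) (fun i _ => hfx i) hcs hc2).trans ?_
    refine Real.sqrt_le_iff.2 ⟨by positivity, ?_⟩
    rw [mul_pow, mul_pow, Real.sq_sqrt (by positivity)]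
    have : 0 ≤ ε * η * (N * s) ^ 2 := by positivity
    nlinarith
  -- The weighted second moment is nearly the true one in total, and the good points already account
  -- for nearly all of it: the clean empirical moment minus the missing part. Only a multiple of `η`
  -- is left to the bad points.
  have hw2 : ∑ i ∈ Bd, w i * val a i ^ 2 ≤ N * (180 * η * s ^ 2) := by
    have tot := Finset.sum_add_sum_compl Bd fun i => w i * val a i ^ 2
    have h1 : ∑ i ∈ Bdᶜ, w i * val a i ^ 2 =
        ∑ i, inner ℝ (b a) (z i) ^ 2 - ∑ i, c i * inner ℝ (b a) (z i) ^ 2 := by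
      rw [← Finset.sum_sub_distrib, ← Finset.sum_add_sum_compl Bd,
        Finset.sum_eq_zero (s := Bd) fun i hi => by simp only [hc, if_pos hi]; ring, zero_add]
      refine Finset.sum_congr rfl fun i hi => ?_
      rw [H.val_eq a i (Finset.mem_compl.1 hi)]
      simp only [hc, if_neg (Finset.mem_compl.1 hi)]; ring
    have h2 := H.le_second_moment a
    have h3 : (1 + 100 * η) * q a ≤ (1 + γ + 150 * η) * s ^ 2 := by
      refine (mul_le_mul_of_nonneg_left (H.upper a) (by positivity)).trans ?_
      rw [← mul_assoc]
      refine mul_le_mul_of_nonneg_right ?_ (sq_nonneg s)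
      nlinarith [mul_le_mul_of_nonneg_left H.gamma_le hη0.le]
    have h4 := mul_le_mul_of_nonneg_left h3 hN0.le
    have hNs : 0 ≤ N * s ^ 2 := by positivity
    have h5 : N * ((1 + γ + 150 * η) * s ^ 2) - N * (s ^ 2 - (3 * δ + ε) * s ^ 2) +
        N * (26 * η * s ^ 2) ≤ N * (180 * η * s ^ 2) := by
      have : 0 ≤ N * s ^ 2 * (4 * η - γ - 3 * δ - ε) := mul_nonneg hNs (by linarith)
      nlinarith
    linarith
  have t3 : |∑ i ∈ Bd, w i * (y i * val a i)| ≤ 33 * N * √(ε * η) * s := by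
    have hwB : ∑ i ∈ Bd, w i ≤ 6 * ε * N :=
      (Finset.sum_le_card_nsmul _ _ 1 fun i _ => hw.le_one i).trans (by simpa using H.bad_card)
    refine (abs_sum_mul_le_sqrt _ (fun i _ => hw.nonneg i) (fun i _ => hy i) hwB hw2).trans ?_
    refine Real.sqrt_le_iff.2 ⟨by positivity, ?_⟩
    rw [mul_pow, mul_pow, Real.sq_sqrt (by positivity)]
    have : 0 ≤ ε * η * (N * s) ^ 2 := by positivity
    nlinarith
  have t1 : N * ((ε + 2 * √(ε * δ)) * s) ≤ 3 * N * √(ε * η) * s := by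
    have h1 : ε ≤ √(ε * η) := Real.le_sqrt_of_sq_le (by nlinarith)
    have h2 : √(ε * δ) ≤ √(ε * η) := Real.sqrt_le_sqrt (by nlinarith)
    have : 0 ≤ N * s := by positivity
    nlinarith
  have e : (∑ i, w i * y i * val a i) / N - I = ((∑ k, fx k * inner ℝ (b a) (z k) - N * I) -
      ∑ i, c i * (fx i * inner ℝ (b a) (z i)) + ∑ i ∈ Bd, w i * (y i * val a i)) / N := by
    rw [eq_div_iff hN0.ne', sub_mul, div_mul_cancel₀ _ hN0.ne']
    simp only [split, Finset.sum_add_distrib, Finset.sum_sub_distrib]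
    rw [← Finset.sum_filter]
    simp only [Finset.filter_mem_eq_inter, Finset.univ_inter]
    ring
  rw [e, abs_div, abs_of_pos hN0, div_le_iff₀ hN0]
  refine (abs_add_le _ _).trans ((add_le_add ((abs_sub _ _).trans (add_le_add (hI.trans t1) t2))
    t3).trans ?_)
  have : 0 ≤ N * √(ε * η) * s := by positivity
  nlinarith

/-- The weights computed by `N` rounds of filtering. In each round `a` is a label whose weighted
second moment is too large, or none exists and the weights stay as they are. -/
theorem exists_final_weights (H : CorruptedValues val q b z Bd T₀ ε γ δ) {w : ℕ → Fin N → ℝ}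
    (hw0 : ∀ i, w 0 i = 1)
    (hstep : ∀ t < N, (∀ a, ∑ i, w t i * val a i ^ 2 ≤ N * ((1 + 100 * (γ + δ + ε)) * q a)) ∧
        w (t + 1) = w t ∨
      ∃ (a : α) (τ : Fin N → ℝ) (r : ℝ),
        N * ((1 + 100 * (γ + δ + ε)) * q a) < ∑ i, w t i * val a i ^ 2 ∧
        (∀ i, τ i = max (val a i ^ 2 - 4 * δ / ε * q a) 0) ∧ IsMaxScore (w t) τ r ∧
        ∀ i, w (t + 1) i = w t i - w t i * τ i / r) :
    WeightInvariant Bd (w N) ∧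
      ∀ a, ∑ i, w N i * val a i ^ 2 ≤ N * ((1 + 100 * (γ + δ + ε)) * q a) := by
  classical
  -- The number of vanished weights is the potential: as long as a violation occurs, every round
  -- kills at least one more point.
  have key : ∀ t ≤ N, WeightInvariant Bd (w t) ∧
      ((∀ a, ∑ i, w t i * val a i ^ 2 ≤ N * ((1 + 100 * (γ + δ + ε)) * q a)) ∨
        t ≤ (Finset.univ.filter fun i => w t i = 0).card) := by
    intro t
    induction t with
    | zero =>
      intro _
      exact ⟨⟨fun i => by simp [hw0], fun i => by simp [hw0], by simp [hw0]⟩, Or.inr (Nat.zero_le _)⟩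
    | succ t ih =>
      intro ht
      obtain ⟨hinv, hor⟩ := ih (by omega)
      rcases hstep t (by omega) with ⟨hfin, heq⟩ | ⟨a, τ, r, hlt, hτ, hr, hw'⟩
      · rw [heq]
        exact ⟨hinv, Or.inl hfin⟩
      · obtain ⟨h1, h2, i₀, h3, h4⟩ := H.filter_step hinv hlt hτ hr hw'
        refine ⟨h1, Or.inr ?_⟩
        have hcard : t ≤ (Finset.univ.filter fun i => w t i = 0).card :=
          hor.resolve_left fun h => absurd (h a) (not_le.2 hlt)
        refine (Nat.succ_le_succ hcard).trans (Finset.card_lt_card ?_)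
        refine Finset.ssubset_iff_subset_ne.2 ⟨fun i hi => ?_, fun h => ?_⟩
        · simp only [Finset.mem_filter, Finset.mem_univ, true_and] at hi ⊢
          exact h2 i hi
        · have : i₀ ∈ Finset.univ.filter fun i => w (t + 1) i = 0 := by simpa using h4
          rw [← h] at this
          exact h3 (by simpa using this)
  obtain ⟨hinv, h | h⟩ := key N le_rfl
  · exact ⟨hinv, h⟩
  · refine ⟨hinv, fun a => ?_⟩
    -- If violations persisted for `N` rounds, all weights vanish and the second moment bounds hold
    -- trivially.
    have hall : ∀ i, w N i = 0 := by
      have h1 : (Finset.univ.filter fun i => w N i = 0) = Finset.univ :=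
        Finset.eq_univ_of_card _ (le_antisymm (Finset.card_le_univ _) (by simpa using h))
      intro i
      have := Finset.mem_univ i
      rw [← h1] at this
      simpa using this
    have hq : 0 ≤ q a := le_trans
      (mul_nonneg (by linarith [H.gamma_le]) (sq_nonneg _)) (H.lower a)
    have := H.eps_pos
    have := H.delta_pos
    have := H.gamma_nonneg
    simp only [hall, zero_mul, Finset.sum_const_zero]
    positivity

end CorruptedValues

end RobustChow

/-! ### A language of bounded loops and its compilation to the machine -/

namespace RealRAM

/-- Indices: registers and constants. -/
inductive Ix where
  | reg (r : ℕ)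
  | num (k : ℕ)

namespace Ix

def eval (ρ : ℕ → ℕ) : Ix → ℕ
  | reg r => ρ r
  | num k => k

def toNExp : Ix → NExp
  | reg r => .reg r
  | num k => .const k

/-- Only registers below `m` are read. -/
def wf (m : ℕ) : Ix → Bool
  | reg r => decide (r < m)
  | num _ => true

theorem toNExp_eval (i : Ix) (s : Store) : i.toNExp.eval s = i.eval s.idx := by
  cases i <;> rfl

theorem toNExp_size (i : Ix) : i.toNExp.size = 1 := by
  cases i <;> rfl

theorem eval_congr {i : Ix} {m : ℕ} (h : i.wf m = true) {ρ ρ' : ℕ → ℕ} (hρ : ∀ r < m, ρ r = ρ' r) :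
    i.eval ρ = i.eval ρ' := by
  cases i with
  | reg r => exact hρ r (by simpa [wf] using h)
  | num k => rfl

end Ix

inductive BinOp where
  | add
  | sub
  | mul
  | div

namespace BinOp

noncomputable def apply : BinOp → ℝ → ℝ → ℝ
  | add, x, y => x + y
  | sub, x, y => x - y
  | mul, x, y => x * y
  | div, x, y => x / y

def toRExp : BinOp → RExp → RExp → RExp
  | add => .add
  | sub => .sub
  | mul => .mul
  | div => .div

theorem toRExp_eval (op : BinOp) (Q : ℝ → ℝ) (s : Store) (a b : RExp) :
    (op.toRExp a b).eval Q s = op.apply (a.eval Q s) (b.eval Q s) := by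
  cases op <;> rfl

theorem toRExp_size (op : BinOp) (a b : RExp) : (op.toRExp a b).size = a.size + b.size + 1 := by
  cases op <;> rfl

end BinOp

inductive FoldOp where
  | sum
  | prod
  | max

/-- Array number 100 is reserved for intermediate results. -/
def scratch (k : ℕ) : RExp := .get 100 (.const k) (.const 0)

def setScratch (k : ℕ) (a : RExp) : Cmd := .setR 100 (.const k) (.const 0) a

namespace FoldOp

def init : FoldOp → ℚ
  | sum => 0
  | prod => 1
  | max => 0

noncomputable def apply : FoldOp → ℝ → ℝ → ℝ
  | sum, x, y => x + y
  | prod, x, y => x * y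
  | max, x, y => if x < y then y else x

def cmd (k : ℕ) : FoldOp → Cmd
  | sum => setScratch k (.add (scratch k) (scratch (k + 1)))
  | prod => setScratch k (.mul (scratch k) (scratch (k + 1)))
  | max => .ite (.ltR (scratch k) (scratch (k + 1))) (setScratch k (scratch (k + 1))) .skip

/-- The result of folding the values `g 0, …, g (n - 1)`. -/
noncomputable def fold (op : FoldOp) (g : ℕ → ℝ) : ℕ → ℝ
  | 0 => op.init
  | i + 1 => op.apply (fold op g i) (g i)

theorem fold_congr (op : FoldOp) {g g' : ℕ → ℝ} (h : ∀ i, g i = g' i) (n : ℕ) :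
    op.fold g n = op.fold g' n := by
  rw [show g = g' from funext h]

theorem fold_sum (g : ℕ → ℝ) (n : ℕ) : sum.fold g n = ∑ i ∈ Finset.range n, g i := by
  induction n with
  | zero => simp [fold, init]
  | succ n ih => rw [Finset.sum_range_succ, ← ih]; rfl

theorem fold_prod (g : ℕ → ℝ) (n : ℕ) : prod.fold g n = ∏ i ∈ Finset.range n, g i := by
  induction n with
  | zero => simp [fold, init]
  | succ n ih => rw [Finset.prod_range_succ, ← ih]; rfl

/-- The fold starts at zero, hence the alternative that the result is zero and possibly not
attained; `IsMaxScore` has the same form. -/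
theorem fold_max_spec (g : ℕ → ℝ) (n : ℕ) : 0 ≤ max.fold g n ∧ (∀ i < n, g i ≤ max.fold g n) ∧
    (max.fold g n = 0 ∨ ∃ i < n, g i = max.fold g n) := by
  induction n with
  | zero => simp [fold, init]
  | succ n ih =>
    obtain ⟨h0, h1, h2⟩ := ih
    have e : max.fold g (n + 1) = if max.fold g n < g n then g n else max.fold g n := rfl
    rw [e]
    split_ifs with h
    · refine ⟨h0.trans h.le, fun i hi => ?_, Or.inr ⟨n, n.lt_succ_self, rfl⟩⟩
      rcases Nat.lt_succ_iff_lt_or_eq.1 hi with hi | rfl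
      · exact (h1 i hi).trans h.le
      · exact le_rfl
    · refine ⟨h0, fun i hi => ?_, h2.imp_right fun ⟨i, hi, hg⟩ => ⟨i, hi.trans n.lt_succ_self, hg⟩⟩
      rcases Nat.lt_succ_iff_lt_or_eq.1 hi with hi | rfl
      · exact h1 i hi
      · exact not_lt.1 h

end FoldOp

/-- Real-valued expressions with bounded sums, products and maxima. -/
inductive Expr where
  | const (q : ℚ)
  | idx (r : ℕ)
  | get (arr : ℕ) (i j : Ix)
  | bin (op : BinOp) (a b : Expr)
  | ifLt (a b x y : Expr)
  | fold (op : FoldOp) (r b : ℕ) (body : Expr)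

abbrev Mem := ℕ → ℕ → ℕ → ℝ

namespace Expr

instance : Add Expr := ⟨bin .add⟩
instance : Sub Expr := ⟨bin .sub⟩
instance : Mul Expr := ⟨bin .mul⟩
instance : Div Expr := ⟨bin .div⟩

noncomputable def eval (ρ : ℕ → ℕ) (μ : Mem) : Expr → ℝ
  | const q => (q : ℝ)
  | idx r => (ρ r : ℝ)
  | get arr i j => μ arr (i.eval ρ) (j.eval ρ)
  | bin op a b => op.apply (a.eval ρ μ) (b.eval ρ μ)
  | ifLt a b x y => if a.eval ρ μ < b.eval ρ μ then x.eval ρ μ else y.eval ρ μ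
  | fold op r b body => op.fold (fun i => body.eval (Function.update ρ r i) μ) (ρ b)

/-- Only registers below `m` are read, the reserved array is not accessed, and nested folds use
the registers `m, m + 1, …`. -/
def wf (m : ℕ) : Expr → Bool
  | const _ => true
  | idx r => decide (r < m)
  | get arr i j => decide (arr < 100) && i.wf m && j.wf m
  | bin _ a b => a.wf m && b.wf m
  | ifLt a b x y => a.wf m && b.wf m && x.wf m && y.wf m
  | fold _ r b body => decide (r = m) && decide (b < m) && body.wf (m + 1)

/-- The program that evaluates the expression and stores the result in row `k` of the reserved
array; later rows may be overwritten. -/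
def comp (k : ℕ) : Expr → Cmd
  | const q => setScratch k (.const q)
  | idx r => setScratch k (.ofIdx (.reg r))
  | get arr i j => setScratch k (.get arr i.toNExp j.toNExp)
  | bin op a b => .seq (a.comp k) (.seq (b.comp (k + 1))
      (setScratch k (op.toRExp (scratch k) (scratch (k + 1)))))
  | ifLt a b x y => .seq (a.comp k) (.seq (b.comp (k + 1))
      (.ite (.ltR (scratch k) (scratch (k + 1))) (x.comp k) (y.comp k)))
  | fold op r b body => .seq (setScratch k (.const op.init)) (.seq (.setN r (.const 0))
      (.loop (.ltN (.reg r) (.reg b)) (.seq (.seq (body.comp (k + 1)) (op.cmd k))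
        (.setN r (.add (.reg r) (.const 1))))))

/-- A bound for the running time if all registers that are read are at most `B`. -/
def cost (B : ℕ) : Expr → ℕ
  | const _ => 20
  | idx _ => 20
  | get _ _ _ => 20
  | bin _ a b => a.cost B + b.cost B + 20
  | ifLt a b x y => a.cost B + b.cost B + x.cost B + y.cost B + 20
  | fold _ _ _ body => B * (body.cost B + 40) + 20

/-- Evaluating one subexpression spoils loop registers from `m` on and the reserved array. Neither
affects the value of the next subexpression. -/
theorem eval_congr {m : ℕ} {e : Expr} (h : e.wf m = true) {ρ ρ' : ℕ → ℕ} (hρ : ∀ r < m, ρ r = ρ' r)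
    {μ μ' : Mem} (hμ : ∀ arr < 100, μ arr = μ' arr) : e.eval ρ μ = e.eval ρ' μ' := by
  induction e generalizing m ρ ρ' with
  | const q => rfl
  | idx r => simp only [eval, hρ r (by simpa [wf] using h)]
  | get arr i j =>
    simp only [wf, Bool.and_eq_true, decide_eq_true_eq] at h
    simp only [eval, hμ arr h.1.1, i.eval_congr h.1.2 hρ, j.eval_congr h.2 hρ]
  | bin op a b iha ihb =>
    simp only [wf, Bool.and_eq_true] at h
    simp only [eval, iha h.1 hρ, ihb h.2 hρ]
  | ifLt a b x y iha ihb ihx ihy =>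
    simp only [wf, Bool.and_eq_true] at h
    simp only [eval, iha h.1.1.1 hρ, ihb h.1.1.2 hρ, ihx h.1.2 hρ, ihy h.2 hρ]
  | fold op r b body ih =>
    simp only [wf, Bool.and_eq_true, decide_eq_true_eq] at h
    obtain ⟨⟨rfl, hb⟩, hbody⟩ := h
    simp only [eval, hρ b hb]
    refine op.fold_congr (fun i => ih hbody fun r' hr' => ?_) _
    rcases eq_or_ne r' r with rfl | hne
    · simp
    · simp only [Function.update_of_ne hne]
      exact hρ r' (by omega)

end Expr

/-- Nothing that matters changes between `s` and `s'`: registers below `m` and all arrays but the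
reserved one. -/
structure Agree (m : ℕ) (s s' : Store) : Prop where
  idx : ∀ r < m, s'.idx r = s.idx r
  mem : ∀ arr < 100, s'.mem arr = s.mem arr

theorem Agree.trans {m : ℕ} {s s' s'' : Store} (h : Agree m s s') (h' : Agree m s' s'') :
    Agree m s s'' :=
  ⟨fun r hr => (h'.idx r hr).trans (h.idx r hr), fun a ha => (h'.mem a ha).trans (h.mem a ha)⟩

theorem Agree.mono {m m' : ℕ} (hm : m ≤ m') {s s' : Store} (h : Agree m' s s') : Agree m s s' :=
  ⟨fun r hr => h.idx r (hr.trans_le hm), h.mem⟩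

theorem agree_writeR_scratch (m : ℕ) (s : Store) (k j : ℕ) (v : ℝ) :
    Agree m s (s.writeR 100 k j v) := by
  refine ⟨fun _ _ => rfl, fun a ha => ?_⟩
  funext i j'
  simp only [Store.writeR]
  rw [if_neg]
  rintro ⟨rfl, _⟩
  exact absurd ha (lt_irrefl _)

theorem agree_writeN {m r : ℕ} (hr : m ≤ r) (s : Store) (v : ℕ) : Agree m s (s.writeN r v) := by
  refine ⟨fun r' hr' => ?_, fun _ _ => rfl⟩
  simp only [Store.writeN]
  rw [if_neg (by omega)]

theorem setScratch_runs (Q : ℝ → ℝ) (s : Store) (k : ℕ) (a : RExp) :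
    Cmd.Runs Q (setScratch k a) s (s.writeR 100 k 0 (a.eval Q s)) (1 + 1 + a.size + 1) :=
  Cmd.Runs.setR s 100 (.const k) (.const 0) a

theorem writeR_scratch_self (s : Store) (k : ℕ) (v : ℝ) : (s.writeR 100 k 0 v).mem 100 k 0 = v := by
  simp [Store.writeR]

theorem writeR_scratch_of_ne (s : Store) {k k' : ℕ} (h : k' ≠ k) (v : ℝ) :
    (s.writeR 100 k 0 v).mem 100 k' 0 = s.mem 100 k' 0 := by
  simp [Store.writeR, h]

theorem FoldOp.cmd_runs (op : FoldOp) (Q : ℝ → ℝ) (s : Store) (k m : ℕ) :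
    ∃ s' t, Cmd.Runs Q (op.cmd k) s s' t ∧ t ≤ 20 ∧ Agree m s s' ∧
      (∀ k' < k, s'.mem 100 k' 0 = s.mem 100 k' 0) ∧
      s'.mem 100 k 0 = op.apply (s.mem 100 k 0) (s.mem 100 (k + 1) 0) := by
  have hw : ∀ v, (∀ k' < k, (s.writeR 100 k 0 v).mem 100 k' 0 = s.mem 100 k' 0) := fun v k' hk' =>
    writeR_scratch_of_ne s hk'.ne v
  cases op with
  | sum =>
    exact ⟨_, _, setScratch_runs Q s k _, by simp [RExp.size, scratch, NExp.size],
      agree_writeR_scratch m s k 0 _, hw _, writeR_scratch_self s k _⟩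
  | prod =>
    exact ⟨_, _, setScratch_runs Q s k _, by simp [RExp.size, scratch, NExp.size],
      agree_writeR_scratch m s k 0 _, hw _, writeR_scratch_self s k _⟩
  | max =>
    by_cases h : s.mem 100 k 0 < s.mem 100 (k + 1) 0
    · exact ⟨_, _, Cmd.Runs.iteTrue h (setScratch_runs Q s k _),
        by simp [RExp.size, BExp.size, scratch, NExp.size], agree_writeR_scratch m s k 0 _, hw _,
        (writeR_scratch_self s k _).trans (if_pos h).symm⟩
    · exact ⟨_, _, Cmd.Runs.iteFalse h (Cmd.Runs.skip s),
        by simp [RExp.size, BExp.size, scratch, NExp.size], ⟨fun _ _ => rfl, fun _ _ => rfl⟩,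
        fun _ _ => rfl, (if_neg h).symm⟩

/-- Counting loops. -/
theorem loop_runs {Q : ℝ → ℝ} {r b n T : ℕ} {c : Cmd} (hrb : b ≠ r) (I : ℕ → Store → Prop)
    (step : ∀ i < n, ∀ s, I i s → s.idx r = i → s.idx b = n → ∃ s' t, Cmd.Runs Q c s s' t ∧ t ≤ T ∧
      s'.idx r = i ∧ s'.idx b = n ∧ I (i + 1) (s'.writeN r (i + 1))) :
    ∀ j i s, i + j = n → I i s → s.idx r = i → s.idx b = n → ∃ s' t,
      Cmd.Runs Q (.loop (.ltN (.reg r) (.reg b)) (.seq c (.setN r (.add (.reg r) (.const 1)))))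
        s s' t ∧ t ≤ j * (T + 10) + 3 ∧ I n s' := by
  -- Induction on the number `j` of remaining iterations. The invariant is required after the
  -- increment of the counter.
  intro j
  induction j with
  | zero =>
    intro i s hi hI hr hb
    obtain rfl : i = n := by omega
    exact ⟨s, _, Cmd.Runs.loopStop (by simp [BExp.Holds, NExp.eval, hr, hb]),
      by simp [BExp.size, NExp.size], hI⟩
  | succ j ih =>
    intro i s hi hI hr hb
    obtain ⟨s₁, t₁, hrun, ht, hr₁, hb₁, hI₁⟩ := step i (by omega) s hI hr hb
    obtain ⟨s₂, t₂, hrun₂, ht₂, hI₂⟩ := ih (i + 1) (s₁.writeN r (i + 1)) (by omega) hI₁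
      (by simp [Store.writeN]) (by simp [Store.writeN, hrb, hb₁])
    have hset := Cmd.Runs.setN (Q := Q) s₁ r (.add (.reg r) (.const 1))
    have hev : NExp.eval s₁ (.add (.reg r) (.const 1)) = i + 1 := by simp [NExp.eval, hr₁]
    rw [hev] at hset
    refine ⟨s₂, _, Cmd.Runs.loopStep ?_ (Cmd.Runs.seq hrun hset) hrun₂, ?_, hI₂⟩
    · simp only [BExp.Holds, NExp.eval, hr, hb]; omega
    · simp only [BExp.size, NExp.size]
      nlinarith

/-- The reserved array serves as a stack: evaluation at height `k` preserves all rows below `k`, so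
a first operand in row `k` survives the evaluation of the second one at height `k + 1`. Since nested
folds use successive registers, an inner loop cannot disturb the counter of an outer one. -/
theorem Expr.comp_runs (Q : ℝ → ℝ) {B : ℕ} (e : Expr) : ∀ {m : ℕ}, e.wf m = true → ∀ (k : ℕ) (s : Store),
    (∀ r < m, s.idx r ≤ B) → ∃ s' t, Cmd.Runs Q (e.comp k) s s' t ∧ t ≤ e.cost B ∧ Agree m s s' ∧
      (∀ k' < k, s'.mem 100 k' 0 = s.mem 100 k' 0) ∧ s'.mem 100 k 0 = e.eval s.idx s.mem := by
  induction e with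
  | const q =>
    intro m h k s hB
    exact ⟨_, _, setScratch_runs Q s k _, by simp [RExp.size, cost], agree_writeR_scratch m s k 0 _,
      fun k' hk' => writeR_scratch_of_ne s hk'.ne _, writeR_scratch_self s k _⟩
  | idx r =>
    intro m h k s hB
    exact ⟨_, _, setScratch_runs Q s k _, by simp [RExp.size, NExp.size, cost],
      agree_writeR_scratch m s k 0 _,
      fun k' hk' => writeR_scratch_of_ne s hk'.ne _, writeR_scratch_self s k _⟩
  | get arr i j =>
    intro m h k s hB
    exact ⟨_, _, setScratch_runs Q s k _, by simp [RExp.size, Ix.toNExp_size, cost],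
      agree_writeR_scratch m s k 0 _,
      fun k' hk' => writeR_scratch_of_ne s hk'.ne _, (writeR_scratch_self s k _).trans
        (by simp only [RExp.eval, Ix.toNExp_eval, eval])⟩
  | bin op a b iha ihb =>
    intro m h k s hB
    simp only [wf, Bool.and_eq_true] at h
    obtain ⟨s₁, t₁, r₁, c₁, A₁, l₁, v₁⟩ := iha h.1 k s hB
    obtain ⟨s₂, t₂, r₂, c₂, A₂, l₂, v₂⟩ := ihb h.2 (k + 1) s₁ fun r hr => by
      rw [A₁.idx r hr]; exact hB r hr
    refine ⟨_, _, r₁.seq (r₂.seq (setScratch_runs Q s₂ k _)), ?_,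
      (A₁.trans A₂).trans (agree_writeR_scratch m s₂ k 0 _), fun k' hk' => ?_, ?_⟩
    · simp only [BinOp.toRExp_size, RExp.size, scratch, NExp.size, cost]; omega
    · rw [writeR_scratch_of_ne s₂ hk'.ne, l₂ k' (by omega), l₁ k' hk']
    · rw [writeR_scratch_self, BinOp.toRExp_eval]
      simp only [scratch, RExp.eval, NExp.eval, eval]
      rw [v₂, l₂ k (by omega), v₁, b.eval_congr h.2 A₁.idx A₁.mem]
  | ifLt a b x y iha ihb ihx ihy =>
    intro m h k s hB
    simp only [wf, Bool.and_eq_true] at h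
    obtain ⟨s₁, t₁, r₁, c₁, A₁, l₁, v₁⟩ := iha h.1.1.1 k s hB
    obtain ⟨s₂, t₂, r₂, c₂, A₂, l₂, v₂⟩ := ihb h.1.1.2 (k + 1) s₁ fun r hr => by
      rw [A₁.idx r hr]; exact hB r hr
    have A := A₁.trans A₂
    have hB₂ : ∀ r < m, s₂.idx r ≤ B := fun r hr => by rw [A.idx r hr]; exact hB r hr
    have hcond : (BExp.ltR (scratch k) (scratch (k + 1))).Holds Q s₂ ↔
        a.eval s.idx s.mem < b.eval s.idx s.mem := by
      simp only [scratch, BExp.Holds, RExp.eval, NExp.eval]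
      rw [v₂, l₂ k (by omega), v₁, b.eval_congr h.1.1.2 A₁.idx A₁.mem]
    by_cases hlt : a.eval s.idx s.mem < b.eval s.idx s.mem
    · obtain ⟨s₃, t₃, r₃, c₃, A₃, l₃, v₃⟩ := ihx h.1.2 k s₂ hB₂
      refine ⟨_, _, r₁.seq (r₂.seq (Cmd.Runs.iteTrue (hcond.2 hlt) r₃)), ?_, A.trans A₃,
        fun k' hk' => ?_, ?_⟩
      · simp only [BExp.size, RExp.size, scratch, NExp.size, cost]; omega
      · rw [l₃ k' hk', l₂ k' (by omega), l₁ k' hk']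
      · rw [v₃, eval, if_pos hlt, x.eval_congr h.1.2 A.idx A.mem]
    · obtain ⟨s₃, t₃, r₃, c₃, A₃, l₃, v₃⟩ := ihy h.2 k s₂ hB₂
      refine ⟨_, _, r₁.seq (r₂.seq (Cmd.Runs.iteFalse (mt hcond.1 hlt) r₃)), ?_, A.trans A₃,
        fun k' hk' => ?_, ?_⟩
      · simp only [BExp.size, RExp.size, scratch, NExp.size, cost]; omega
      · rw [l₃ k' hk', l₂ k' (by omega), l₁ k' hk']
      · rw [v₃, eval, if_neg hlt, y.eval_congr h.2 A.idx A.mem]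
  | fold op r b body ih =>
    intro m h k s hB
    simp only [wf, Bool.and_eq_true, decide_eq_true_eq] at h
    obtain ⟨⟨rfl, hb⟩, hbody⟩ := h
    set g : ℕ → ℝ := fun i => body.eval (Function.update s.idx r i) s.mem with hg
    -- After `i` iterations, row `k` holds the fold of the first `i` values.
    let I : ℕ → Store → Prop := fun i s' => Agree r s s' ∧
      (∀ k' < k, s'.mem 100 k' 0 = s.mem 100 k' 0) ∧ s'.mem 100 k 0 = op.fold g i
    have step : ∀ i < s.idx b, ∀ s', I i s' → s'.idx r = i → s'.idx b = s.idx b → ∃ s'' t,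
        Cmd.Runs Q (.seq (body.comp (k + 1)) (op.cmd k)) s' s'' t ∧ t ≤ body.cost B + 20 ∧
        s''.idx r = i ∧ s''.idx b = s.idx b ∧ I (i + 1) (s''.writeN r (i + 1)) := by
      rintro i hi s' ⟨A, l, v⟩ hr' hb'
      obtain ⟨s₁, t₁, r₁, c₁, A₁, l₁, v₁⟩ := ih hbody (k + 1) s' fun r' hr => by
        rcases Nat.lt_succ_iff_lt_or_eq.1 hr with h' | rfl
        · rw [A.idx r' h']; exact hB r' h'
        · rw [hr']; exact hi.le.trans (hB b hb)
      obtain ⟨s₂, t₂, r₂, c₂, A₂, l₂, v₂⟩ := op.cmd_runs Q s₁ k (r + 1)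
      have A₁₂ := A₁.trans A₂
      refine ⟨s₂, _, r₁.seq r₂, by omega, ?_, ?_, ?_, ?_, ?_⟩
      · rw [A₁₂.idx r (by omega), hr']
      · rw [A₁₂.idx b (by omega), hb']
      · exact (A.trans (A₁₂.mono (Nat.le_succ r))).trans (agree_writeN le_rfl s₂ _)
      · intro k' hk'
        exact (l₂ k' hk').trans ((l₁ k' (by omega)).trans (l k' hk'))
      · change s₂.mem 100 k 0 = _
        rw [v₂, l₁ k (by omega), v, v₁]
        change _ = op.apply (op.fold g i) (g i)
        rw [hg]
        congr 1
        refine body.eval_congr hbody (fun r' hr => ?_) A.mem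
        rcases Nat.lt_succ_iff_lt_or_eq.1 hr with h' | rfl
        · rw [Function.update_of_ne h'.ne, A.idx r' h']
        · rw [Function.update_self, hr']
    set s₀ := (s.writeR 100 k 0 (op.init : ℝ)).writeN r 0
    have hI0 : I 0 s₀ := ⟨(agree_writeR_scratch r s k 0 _).trans (agree_writeN le_rfl _ _),
      fun k' hk' => writeR_scratch_of_ne s hk'.ne _, writeR_scratch_self s k _⟩
    obtain ⟨s', t, hrun, ht, A, l, v⟩ := loop_runs hb.ne I step (s.idx b) 0 s₀ (Nat.zero_add _) hI0
      (by simp [s₀, Store.writeN]) (by simp [s₀, Store.writeN, hb.ne, Store.writeR])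
    refine ⟨s', _, (setScratch_runs Q s k _).seq ((Cmd.Runs.setN _ r (.const 0)).seq hrun), ?_, A,
      l, v⟩
    have := Nat.mul_le_mul_right (body.cost B + 20 + 10) (hB b hb)
    simp only [RExp.size, NExp.size, cost]
    nlinarith

/-- Each fold contributes one factor `B`, and the nesting depth of a fixed expression is constant.
-/
theorem Expr.cost_le (e : Expr) : ∃ K k : ℕ, ∀ B, 1 ≤ B → e.cost B ≤ K * B ^ k := by
  have mono : ∀ {K k K' k' B : ℕ}, 1 ≤ B → K ≤ K' → k ≤ k' → K * B ^ k ≤ K' * B ^ k' :=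
    fun hB hK hk => Nat.mul_le_mul hK (Nat.pow_le_pow_right hB hk)
  induction e with
  | const q => exact ⟨20, 0, fun B hB => by simp [cost]⟩
  | idx r => exact ⟨20, 0, fun B hB => by simp [cost]⟩
  | get arr i j => exact ⟨20, 0, fun B hB => by simp [cost]⟩
  | bin op a b iha ihb =>
    obtain ⟨K₁, k₁, h₁⟩ := iha
    obtain ⟨K₂, k₂, h₂⟩ := ihb
    refine ⟨K₁ + K₂ + 20, k₁ + k₂, fun B hB => ?_⟩
    have e₁ := (h₁ B hB).trans (mono hB le_rfl (show k₁ ≤ k₁ + k₂ by omega))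
    have e₂ := (h₂ B hB).trans (mono hB le_rfl (show k₂ ≤ k₁ + k₂ by omega))
    have e₃ := Nat.one_le_pow (k₁ + k₂) B hB
    simp only [cost]
    nlinarith
  | ifLt a b x y iha ihb ihx ihy =>
    obtain ⟨K₁, k₁, h₁⟩ := iha
    obtain ⟨K₂, k₂, h₂⟩ := ihb
    obtain ⟨K₃, k₃, h₃⟩ := ihx
    obtain ⟨K₄, k₄, h₄⟩ := ihy
    refine ⟨K₁ + K₂ + K₃ + K₄ + 20, k₁ + k₂ + k₃ + k₄, fun B hB => ?_⟩
    have e₁ := (h₁ B hB).trans (mono hB le_rfl (show k₁ ≤ k₁ + k₂ + k₃ + k₄ by omega))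
    have e₂ := (h₂ B hB).trans (mono hB le_rfl (show k₂ ≤ k₁ + k₂ + k₃ + k₄ by omega))
    have e₃ := (h₃ B hB).trans (mono hB le_rfl (show k₃ ≤ k₁ + k₂ + k₃ + k₄ by omega))
    have e₄ := (h₄ B hB).trans (mono hB le_rfl (show k₄ ≤ k₁ + k₂ + k₃ + k₄ by omega))
    have e₅ := Nat.one_le_pow (k₁ + k₂ + k₃ + k₄) B hB
    simp only [cost]
    nlinarith
  | fold op r b body ih =>
    obtain ⟨K, k, h⟩ := ih
    refine ⟨K + 60, k + 1, fun B hB => ?_⟩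
    have e₁ := Nat.mul_le_mul_left B (h B hB)
    have e₂ := Nat.one_le_pow k B hB
    have e₃ := Nat.one_le_pow (k + 1) B hB
    have e₄ : B ^ (k + 1) = B * B ^ k := pow_succ' B k
    have e₅ : B ≤ B ^ (k + 1) := Nat.le_self_pow (by omega) B
    simp only [cost]
    nlinarith

/-- Structured programs that always halt. -/
inductive St where
  | assign (arr : ℕ) (i j : Ix) (e : Expr)
  | seq (a b : St)
  | forN (r b : ℕ) (body : St)

namespace St

/-- The effect of a program on the arrays. -/
noncomputable def exec (ρ : ℕ → ℕ) : St → Mem → Mem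
  | assign arr i j e, μ => fun a i' j' =>
      if a = arr ∧ i' = i.eval ρ ∧ j' = j.eval ρ then e.eval ρ μ else μ a i' j'
  | seq a b, μ => b.exec ρ (a.exec ρ μ)
  | forN r b body, μ => Nat.rec μ (fun i μ' => body.exec (Function.update ρ r i) μ') (ρ b)

def wf (m : ℕ) : St → Bool
  | assign arr i j e => decide (arr < 100) && i.wf m && j.wf m && e.wf m
  | seq a b => a.wf m && b.wf m
  | forN r b body => decide (r = m) && decide (b < m) && body.wf (m + 1)

def comp : St → Cmd
  | assign arr i j e => .seq (e.comp 0) (.setR arr i.toNExp j.toNExp (scratch 0))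
  | seq a b => .seq a.comp b.comp
  | forN r b body => .seq (.setN r (.const 0)) (.loop (.ltN (.reg r) (.reg b))
      (.seq body.comp (.setN r (.add (.reg r) (.const 1)))))

def cost (B : ℕ) : St → ℕ
  | assign _ _ _ e => e.cost B + 20
  | seq a b => a.cost B + b.cost B
  | forN _ _ body => B * (body.cost B + 20) + 20

theorem exec_congr {m : ℕ} {p : St} (h : p.wf m = true) {ρ ρ' : ℕ → ℕ} (hρ : ∀ r < m, ρ r = ρ' r)
    {μ μ' : Mem} (hμ : ∀ arr < 100, μ arr = μ' arr) :
    ∀ arr < 100, p.exec ρ μ arr = p.exec ρ' μ' arr := by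
  induction p generalizing m ρ ρ' μ μ' with
  | assign arr i j e =>
    simp only [wf, Bool.and_eq_true, decide_eq_true_eq] at h
    intro a ha
    funext i' j'
    simp only [exec, i.eval_congr h.1.1.2 hρ, j.eval_congr h.1.2 hρ, e.eval_congr h.2 hρ hμ, hμ a ha]
  | seq a b iha ihb =>
    simp only [wf, Bool.and_eq_true] at h
    exact ihb h.2 hρ (iha h.1 hρ hμ)
  | forN r b body ih =>
    simp only [wf, Bool.and_eq_true, decide_eq_true_eq] at h
    obtain ⟨⟨rfl, hb⟩, hbody⟩ := h
    simp only [exec, hρ b hb]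
    induction ρ' b with
    | zero => exact hμ
    | succ n ihn =>
      refine ih hbody (fun r' hr' => ?_) ihn
      rcases eq_or_ne r' r with rfl | hne
      · simp
      · simp only [Function.update_of_ne hne]
        exact hρ r' (by omega)

theorem comp_runs (Q : ℝ → ℝ) {B : ℕ} (p : St) : ∀ {m : ℕ}, p.wf m = true → ∀ (s : Store),
    (∀ r < m, s.idx r ≤ B) → ∃ s' t, Cmd.Runs Q p.comp s s' t ∧ t ≤ p.cost B ∧
      (∀ r < m, s'.idx r = s.idx r) ∧ ∀ arr < 100, s'.mem arr = p.exec s.idx s.mem arr := by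
  induction p with
  | assign arr i j e =>
    intro m h s hB
    simp only [wf, Bool.and_eq_true, decide_eq_true_eq] at h
    obtain ⟨s₁, t₁, r₁, c₁, A₁, -, v₁⟩ := e.comp_runs Q h.2 0 s hB
    refine ⟨_, _, r₁.seq (Cmd.Runs.setR s₁ arr i.toNExp j.toNExp (scratch 0)), ?_, A₁.idx, ?_⟩
    · simp only [cost, Ix.toNExp_size, scratch, RExp.size, NExp.size]; omega
    · intro a ha
      funext i' j'
      simp only [Store.writeR, Ix.toNExp_eval, exec, scratch, RExp.eval, NExp.eval, v₁,
        i.eval_congr h.1.1.2 A₁.idx, j.eval_congr h.1.2 A₁.idx, A₁.mem a ha]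
  | seq a b iha ihb =>
    intro m h s hB
    simp only [wf, Bool.and_eq_true] at h
    obtain ⟨s₁, t₁, r₁, c₁, i₁, m₁⟩ := iha h.1 s hB
    obtain ⟨s₂, t₂, r₂, c₂, i₂, m₂⟩ := ihb h.2 s₁ fun r hr => by rw [i₁ r hr]; exact hB r hr
    refine ⟨s₂, _, r₁.seq r₂, by simp only [cost]; omega, fun r hr => (i₂ r hr).trans (i₁ r hr),
      fun arr ha => ?_⟩
    rw [m₂ arr ha]
    exact exec_congr h.2 i₁ m₁ arr ha
  | forN r b body ih =>
    intro m h s hB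
    simp only [wf, Bool.and_eq_true, decide_eq_true_eq] at h
    obtain ⟨⟨rfl, hb⟩, hbody⟩ := h
    set M : ℕ → Mem := fun n =>
      Nat.rec s.mem (fun i μ' => body.exec (Function.update s.idx r i) μ') n
    let I : ℕ → Store → Prop := fun i s' => (∀ r' < r, s'.idx r' = s.idx r') ∧
      ∀ arr < 100, s'.mem arr = M i arr
    have step : ∀ i < s.idx b, ∀ s', I i s' → s'.idx r = i → s'.idx b = s.idx b → ∃ s'' t,
        Cmd.Runs Q body.comp s' s'' t ∧ t ≤ body.cost B ∧
        s''.idx r = i ∧ s''.idx b = s.idx b ∧ I (i + 1) (s''.writeN r (i + 1)) := by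
      rintro i hi s' ⟨hidx, hmem⟩ hr' hb'
      have hidx' : ∀ r' < r + 1, s'.idx r' = Function.update s.idx r i r' := fun r' hr => by
        rcases Nat.lt_succ_iff_lt_or_eq.1 hr with h' | rfl
        · rw [Function.update_of_ne h'.ne, hidx r' h']
        · rw [Function.update_self, hr']
      obtain ⟨s₁, t₁, r₁, c₁, i₁, m₁⟩ := ih hbody s' fun r' hr => by
        rcases Nat.lt_succ_iff_lt_or_eq.1 hr with h' | rfl
        · rw [hidx r' h']; exact hB r' h'
        · rw [hr']; exact hi.le.trans (hB b hb)
      refine ⟨s₁, t₁, r₁, c₁, by rw [i₁ r (by omega), hr'], by rw [i₁ b (by omega), hb'],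
        fun r' hr => ?_, fun arr ha => ?_⟩
      · simp only [Store.writeN, if_neg hr.ne]
        rw [i₁ r' (by omega), hidx r' hr]
      · change s₁.mem arr = body.exec (Function.update s.idx r i) (M i) arr
        rw [m₁ arr ha]
        exact exec_congr hbody hidx' hmem arr ha
    obtain ⟨s', t, hrun, ht, hidx, hmem⟩ := loop_runs hb.ne I step (s.idx b) 0 (s.writeN r 0)
      (Nat.zero_add _) ⟨fun r' hr => by simp [Store.writeN, hr.ne], fun _ _ => rfl⟩
      (by simp [Store.writeN]) (by simp [Store.writeN, hb.ne])
    refine ⟨s', _, (Cmd.Runs.setN s r (.const 0)).seq hrun, ?_, hidx, hmem⟩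
    have := Nat.mul_le_mul_right (body.cost B + 10) (hB b hb)
    simp only [NExp.size, cost]
    nlinarith

theorem cost_le (p : St) : ∃ K k : ℕ, ∀ B, 1 ≤ B → p.cost B ≤ K * B ^ k := by
  induction p with
  | assign arr i j e =>
    obtain ⟨K, k, h⟩ := e.cost_le
    refine ⟨K + 20, k, fun B hB => ?_⟩
    have e₁ := h B hB
    have e₂ := Nat.one_le_pow k B hB
    simp only [cost]
    nlinarith
  | seq a b iha ihb =>
    obtain ⟨K₁, k₁, h₁⟩ := iha
    obtain ⟨K₂, k₂, h₂⟩ := ihb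
    refine ⟨K₁ + K₂, k₁ + k₂, fun B hB => ?_⟩
    have e₁ := (h₁ B hB).trans
      (Nat.mul_le_mul_left K₁ (Nat.pow_le_pow_right hB (show k₁ ≤ k₁ + k₂ by omega)))
    have e₂ := (h₂ B hB).trans
      (Nat.mul_le_mul_left K₂ (Nat.pow_le_pow_right hB (show k₂ ≤ k₁ + k₂ by omega)))
    simp only [cost]
    nlinarith
  | forN r b body ih =>
    obtain ⟨K, k, h⟩ := ih
    refine ⟨K + 40, k + 1, fun B hB => ?_⟩
    have e₁ := Nat.mul_le_mul_left B (h B hB)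
    have e₃ := Nat.one_le_pow (k + 1) B hB
    have e₄ : B ^ (k + 1) = B * B ^ k := pow_succ' B k
    have e₅ : B ≤ B ^ (k + 1) := Nat.le_self_pow (by omega) B
    simp only [cost]
    nlinarith

end St

/-- Programs are deterministic. -/
theorem Cmd.Runs.unique {Q : ℝ → ℝ} {c : Cmd} {s s₁ : Store} {t₁ : ℕ} (h : Cmd.Runs Q c s s₁ t₁) :
    ∀ {s₂ : Store} {t₂ : ℕ}, Cmd.Runs Q c s s₂ t₂ → s₁ = s₂ := by
  induction h with
  | skip s => intro s₂ t₂ h; cases h; rfl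
  | setN s i e => intro s₂ t₂ h; cases h; rfl
  | setR s arr i j e => intro s₂ t₂ h; cases h; rfl
  | seq _ _ ih₁ ih₂ =>
    intro s₂ t₂ h
    cases h with
    | seq h₁ h₂ =>
      obtain rfl := ih₁ h₁
      exact ih₂ h₂
  | iteTrue hb _ ih =>
    intro s₂ t₂ h
    cases h with
    | iteTrue _ h => exact ih h
    | iteFalse hb' _ => exact absurd hb hb'
  | iteFalse hb _ ih =>
    intro s₂ t₂ h
    cases h with
    | iteTrue hb' _ => exact absurd hb' hb
    | iteFalse _ h => exact ih h
  | loopStop hb =>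
    intro s₂ t₂ h
    cases h with
    | loopStop _ => rfl
    | loopStep hb' _ _ => exact absurd hb' hb
  | loopStep hb _ _ ih₁ ih₂ =>
    intro s₂ t₂ h
    cases h with
    | loopStop hb' => exact absurd hb hb'
    | loopStep _ h₁ h₂ =>
      obtain rfl := ih₁ h₁
      exact ih₂ h₂

end RealRAM

/-! ### Reasoning about array-filling loops -/

namespace RealRAM

@[simp] theorem Ix.eval_reg (r : ℕ) (ρ : ℕ → ℕ) : (Ix.reg r).eval ρ = ρ r := rfl
@[simp] theorem Ix.eval_num (k : ℕ) (ρ : ℕ → ℕ) : (Ix.num k).eval ρ = k := rfl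

namespace St

theorem exec_forN_induct {r b : ℕ} {body : St} {ρ : ℕ → ℕ} {μ : Mem} (I : ℕ → Mem → Prop)
    (h0 : I 0 μ) (step : ∀ i < ρ b, ∀ μ', I i μ' → I (i + 1) (body.exec (Function.update ρ r i) μ')) :
    I (ρ b) ((forN r b body).exec ρ μ) := by
  have : ∀ n ≤ ρ b, I n (Nat.rec μ (fun i μ' => body.exec (Function.update ρ r i) μ') n) := by
    intro n
    induction n with
    | zero => exact fun _ => h0
    | succ n ih => exact fun h => step n h _ (ih (by omega))
  exact this _ le_rfl

/-- The array `arr` is written to. -/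
def writes (arr : ℕ) : St → Bool
  | assign a _ _ _ => decide (a = arr)
  | seq p q => p.writes arr || q.writes arr
  | forN _ _ body => body.writes arr

theorem exec_of_not_writes {p : St} {arr : ℕ} (h : p.writes arr = false) (ρ : ℕ → ℕ) (μ : Mem) :
    p.exec ρ μ arr = μ arr := by
  induction p generalizing ρ μ with
  | assign a i j e =>
    simp only [writes, decide_eq_false_iff_not] at h
    funext i' j'
    simp only [exec]
    rw [if_neg fun h' => h h'.1.symm]
  | seq p q ihp ihq =>
    simp only [writes, Bool.or_eq_false_iff] at h
    simp only [exec]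
    rw [ihq h.2, ihp h.1]
  | forN r b body ih =>
    exact exec_forN_induct (fun _ μ' => μ' arr = μ arr) rfl fun i _ μ' h' => by rw [ih h, h']

/-- The expression may read the array that is being filled, namely its other rows and the entries of
the row not yet overwritten. Gram-Schmidt needs the former, and conditional overwriting of an entry
the latter. -/
theorem exec_fill_row {arr r b : ℕ} {i : Ix} {e : Expr} {ρ : ℕ → ℕ} {μ : Mem} {i₀ : ℕ} (val : ℕ → ℝ)
    (hi : ∀ c, i.eval (Function.update ρ r c) = i₀)
    (hval : ∀ c < ρ b, ∀ μ' : Mem, (∀ a, a ≠ arr → μ' a = μ a) →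
      (∀ x y, (x ≠ i₀ ∨ c ≤ y) → μ' arr x y = μ arr x y) → e.eval (Function.update ρ r c) μ' = val c) :
    (forN r b (assign arr i (.reg r) e)).exec ρ μ = fun a x y =>
      if a = arr ∧ x = i₀ ∧ y < ρ b then val y else μ a x y := by
  refine exec_forN_induct (fun c μ' => μ' = fun a x y =>
      if a = arr ∧ x = i₀ ∧ y < c then val y else μ a x y) (by simp) fun c hc μ' hμ' => ?_
  have h1 := hval c hc μ' (fun a ha => by rw [hμ']; funext x y; simp [ha])
    (fun x y hxy => by
      rw [hμ']
      simp only [true_and]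
      rw [if_neg]
      rintro ⟨h1, h2⟩
      rcases hxy with h | h
      · exact h h1
      · omega)
  funext a x y
  simp only [exec, hi, h1, Ix.eval_reg, Function.update_self]
  simp only [hμ']
  by_cases ha : a = arr ∧ x = i₀
  · obtain ⟨rfl, rfl⟩ := ha
    rcases lt_trichotomy y c with h | h | h
    · simp [h.ne, h, h.trans c.lt_succ_self]
    · simp [h]
    · simp [h.ne', not_lt.2 h.le, not_lt.2 (Nat.succ_le_of_lt h)]
  · rw [if_neg fun h => ha ⟨h.1, h.2.1⟩, if_neg fun h => ha ⟨h.1, h.2.1⟩,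
      if_neg fun h => ha ⟨h.1, h.2.1⟩]

theorem exec_fill_col {arr r b j₀ : ℕ} {e : Expr} {ρ : ℕ → ℕ} {μ : Mem} (val : ℕ → ℝ)
    (hval : ∀ c < ρ b, ∀ μ' : Mem, (∀ a, a ≠ arr → μ' a = μ a) →
      (∀ x y, (y ≠ j₀ ∨ c ≤ x) → μ' arr x y = μ arr x y) → e.eval (Function.update ρ r c) μ' = val c) :
    (forN r b (assign arr (.reg r) (.num j₀) e)).exec ρ μ = fun a x y =>
      if a = arr ∧ x < ρ b ∧ y = j₀ then val x else μ a x y := by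
  refine exec_forN_induct (fun c μ' => μ' = fun a x y =>
      if a = arr ∧ x < c ∧ y = j₀ then val x else μ a x y) (by simp) fun c hc μ' hμ' => ?_
  have h1 := hval c hc μ' (fun a ha => by rw [hμ']; funext x y; simp [ha])
    (fun x y hxy => by
      rw [hμ']
      simp only [true_and]
      rw [if_neg]
      rintro ⟨h1, h2⟩
      rcases hxy with h | h
      · exact h h2
      · omega)
  funext a x y
  simp only [exec, h1, Ix.eval_reg, Ix.eval_num, Function.update_self]
  simp only [hμ']
  by_cases ha : a = arr ∧ y = j₀
  · obtain ⟨rfl, rfl⟩ := ha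
    rcases lt_trichotomy x c with h | h | h
    · simp [h.ne, h, h.trans c.lt_succ_self]
    · simp [h]
    · simp [h.ne', not_lt.2 h.le, not_lt.2 (Nat.succ_le_of_lt h)]
  · rw [if_neg fun h => ha ⟨h.1, h.2.2⟩, if_neg fun h => ha ⟨h.1, h.2.2⟩,
      if_neg fun h => ha ⟨h.1, h.2.2⟩]

theorem exec_fill {arr r₁ b₁ r₂ b₂ : ℕ} (hr : r₁ ≠ r₂) (hb : b₂ ≠ r₁) {e : Expr} {ρ : ℕ → ℕ} {μ : Mem}
    (val : ℕ → ℕ → ℝ)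
    (hval : ∀ x < ρ b₁, ∀ y < ρ b₂, ∀ μ' : Mem, (∀ a, a ≠ arr → μ' a = μ a) →
      e.eval (Function.update (Function.update ρ r₁ x) r₂ y) μ' = val x y) :
    (forN r₁ b₁ (forN r₂ b₂ (assign arr (.reg r₁) (.reg r₂) e))).exec ρ μ = fun a x y =>
      if a = arr ∧ x < ρ b₁ ∧ y < ρ b₂ then val x y else μ a x y := by
  refine exec_forN_induct (fun c μ' => μ' = fun a x y =>
      if a = arr ∧ x < c ∧ y < ρ b₂ then val x y else μ a x y) (by simp) fun c hc μ' hμ' => ?_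
  rw [exec_fill_row (i₀ := c) (val c)]
  · funext a x y
    simp only [hμ', Function.update_of_ne hb]
    by_cases ha : a = arr ∧ y < ρ b₂
    · obtain ⟨rfl, hy⟩ := ha
      rcases lt_trichotomy x c with h | h | h
      · simp [h.ne, h, h.trans c.lt_succ_self]
      · simp [h, hy]
      · simp [h.ne', not_lt.2 h.le, not_lt.2 (Nat.succ_le_of_lt h)]
    · rw [if_neg fun h => ha ⟨h.1, h.2.2⟩, if_neg fun h => ha ⟨h.1, h.2.2⟩,
        if_neg fun h => ha ⟨h.1, h.2.2⟩]
  · intro y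
    simp [Ix.eval, Function.update_of_ne hr]
  · intro y hy μ'' h1 _
    rw [Function.update_of_ne hb] at hy
    refine hval c hc y hy μ'' fun a ha => ?_
    rw [h1 a ha, hμ']
    funext x y
    simp [ha]

end St

namespace Expr

@[simp] theorem eval_add (a b : Expr) (ρ : ℕ → ℕ) (μ : Mem) :
    (a + b).eval ρ μ = a.eval ρ μ + b.eval ρ μ := rfl
@[simp] theorem eval_sub (a b : Expr) (ρ : ℕ → ℕ) (μ : Mem) :
    (a - b).eval ρ μ = a.eval ρ μ - b.eval ρ μ := rfl
@[simp] theorem eval_mul (a b : Expr) (ρ : ℕ → ℕ) (μ : Mem) :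
    (a * b).eval ρ μ = a.eval ρ μ * b.eval ρ μ := rfl
@[simp] theorem eval_div (a b : Expr) (ρ : ℕ → ℕ) (μ : Mem) :
    (a / b).eval ρ μ = a.eval ρ μ / b.eval ρ μ := rfl
@[simp] theorem eval_const (q : ℚ) (ρ : ℕ → ℕ) (μ : Mem) : (const q).eval ρ μ = q := rfl
@[simp] theorem eval_idx (r : ℕ) (ρ : ℕ → ℕ) (μ : Mem) : (idx r).eval ρ μ = ρ r := rfl
@[simp] theorem eval_get (arr : ℕ) (i j : Ix) (ρ : ℕ → ℕ) (μ : Mem) :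
    (get arr i j).eval ρ μ = μ arr (i.eval ρ) (j.eval ρ) := rfl
@[simp] theorem eval_ifLt (a b x y : Expr) (ρ : ℕ → ℕ) (μ : Mem) : (ifLt a b x y).eval ρ μ =
    if a.eval ρ μ < b.eval ρ μ then x.eval ρ μ else y.eval ρ μ := rfl
@[simp] theorem eval_fold_sum (r b : ℕ) (e : Expr) (ρ : ℕ → ℕ) (μ : Mem) :
    (fold .sum r b e).eval ρ μ =
      ∑ i ∈ Finset.range (ρ b), e.eval (Function.update ρ r i) μ := FoldOp.fold_sum _ _
@[simp] theorem eval_fold_prod (r b : ℕ) (e : Expr) (ρ : ℕ → ℕ) (μ : Mem) :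
    (fold .prod r b e).eval ρ μ =
      ∏ i ∈ Finset.range (ρ b), e.eval (Function.update ρ r i) μ := FoldOp.fold_prod _ _
@[simp] theorem eval_fold_max (r b : ℕ) (e : Expr) (ρ : ℕ → ℕ) (μ : Mem) :
    (fold .max r b e).eval ρ μ =
      FoldOp.max.fold (fun i => e.eval (Function.update ρ r i) μ) (ρ b) := rfl

end Expr

end RealRAM

/-! ### Gram-Schmidt as a test of positive semidefiniteness -/

namespace RobustChow

section GramSchmidt

open Matrix

/-- If Gram-Schmidt orthogonalization with respect to a symmetric matrix produces no negative square
and no isotropic vector outside of the kernel, then the matrix is positive semidefinite. -/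
theorem nonneg_of_gramSchmidt {ℓ : ℕ} {A : Matrix (Fin ℓ) (Fin ℓ) ℝ} (hA : Aᵀ = A)
    {V : ℕ → Fin ℓ → ℝ} {δ : ℕ → ℝ}
    (hV : ∀ k : Fin ℓ, V k = Pi.single k 1 -
      ∑ l ∈ Finset.range k, ((A *ᵥ V l) k / δ l) • V l)
    (hδ : ∀ k : Fin ℓ, δ k = V k ⬝ᵥ A *ᵥ V k) (h0 : ∀ k : Fin ℓ, 0 ≤ δ k)
    (hker : ∀ k : Fin ℓ, δ k = 0 → A *ᵥ V k = 0) (x : Fin ℓ → ℝ) : 0 ≤ x ⬝ᵥ A *ᵥ x := by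
  have symm : ∀ x y, x ⬝ᵥ A *ᵥ y = y ⬝ᵥ A *ᵥ x := fun x y => by
    conv_lhs => rw [← hA]
    rw [dotProduct_mulVec, vecMul_transpose, dotProduct_comm]
  -- The usual argument, with one exception: for `δ l = 0` the projection coefficient is zero by
  -- convention, and orthogonality holds because `V l` lies in the kernel.
  have orth : ∀ k : ℕ, k < ℓ → ∀ l < k, V k ⬝ᵥ A *ᵥ V l = 0 := by
    intro k
    induction k using Nat.strong_induction_on with
    | _ k ih =>
      intro hk l hl
      have h1 := hV ⟨k, hk⟩
      simp only at h1
      rw [h1, sub_dotProduct, single_one_dotProduct, sum_dotProduct, Finset.sum_eq_single l]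
      · rw [smul_dotProduct, ← hδ ⟨l, hl.trans hk⟩, smul_eq_mul]
        by_cases h : δ l = 0
        · rw [hker ⟨l, hl.trans hk⟩ h]; simp
        · simp only
          rw [div_mul_cancel₀ _ h, sub_self]
      · intro l' hl' hne
        rw [Finset.mem_range] at hl'
        rw [smul_dotProduct]
        rcases lt_or_gt_of_ne hne with h | h
        · rw [symm, ih l hl (hl.trans hk) l' h, smul_zero]
        · rw [ih l' hl' (hl'.trans hk) l h, smul_zero]
      · intro h
        exact absurd (Finset.mem_range.2 hl) h
  -- The change from unit vectors to the `V k` is unitriangular.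
  have hspan : ∀ y : Fin ℓ → ℝ, y ∈ Submodule.span ℝ (Set.range fun k : Fin ℓ => V k) := by
    intro y
    have hk : ∀ k : Fin ℓ, Pi.single k (1 : ℝ) ∈ Submodule.span ℝ (Set.range fun k : Fin ℓ => V k) := by
      intro k
      have h1 := hV k
      rw [eq_sub_iff_add_eq] at h1
      rw [← h1]
      refine Submodule.add_mem _ (Submodule.subset_span ⟨k, rfl⟩) (Submodule.sum_mem _ fun l hl => ?_)
      rw [Finset.mem_range] at hl
      exact Submodule.smul_mem _ _ (Submodule.subset_span ⟨⟨l, hl.trans k.2⟩, rfl⟩)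
    rw [← Finset.univ_sum_single y]
    refine Submodule.sum_mem _ fun k _ => ?_
    have : Pi.single k (y k) = y k • Pi.single (M := fun _ : Fin ℓ => ℝ) k (1 : ℝ) := by
      rw [← Pi.single_smul]; simp
    rw [this]
    exact Submodule.smul_mem _ _ (hk k)
  obtain ⟨c, rfl⟩ := (Submodule.mem_span_range_iff_exists_fun ℝ).1 (hspan x)
  -- In terms of the `V k` the form is diagonal with entries `δ k`.
  rw [sum_dotProduct]
  refine Finset.sum_nonneg fun k _ => ?_
  rw [mulVec_sum, dotProduct_sum, Finset.sum_eq_single k]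
  · rw [mulVec_smul, smul_dotProduct, dotProduct_smul, ← hδ k, smul_eq_mul, smul_eq_mul, ← mul_assoc]
    exact mul_nonneg (mul_self_nonneg _) (h0 k)
  · intro l _ hne
    rw [mulVec_smul, smul_dotProduct, dotProduct_smul]
    rcases lt_or_gt_of_ne hne with h | h
    · rw [orth k k.2 l h]; simp
    · rw [symm, orth l l.2 k h]; simp
  · simp

/-- For an isotropic `y` this is affine in `s`, with slope `2 * (A *ᵥ y) i`. An isotropic vector
outside the kernel thus leads to negative values. -/
theorem dotProduct_mulVec_single_add {ℓ : ℕ} {A : Matrix (Fin ℓ) (Fin ℓ) ℝ} (hA : Aᵀ = A)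
    (i : Fin ℓ) (s : ℝ) (y : Fin ℓ → ℝ) :
    (Pi.single i 1 + s • y) ⬝ᵥ A *ᵥ (Pi.single i 1 + s • y) =
      A i i + 2 * s * (A *ᵥ y) i + s * s * (y ⬝ᵥ A *ᵥ y) := by
  have h1 : y ⬝ᵥ A *ᵥ Pi.single i 1 = (A *ᵥ y) i := by
    conv_lhs => rw [← hA]
    rw [dotProduct_mulVec, vecMul_transpose, dotProduct_single_one]
  have h2 : (A *ᵥ Pi.single i (1 : ℝ)) i = A i i := by simp
  rw [mulVec_add, mulVec_smul, add_dotProduct, dotProduct_add, dotProduct_add, smul_dotProduct,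
    smul_dotProduct, dotProduct_smul, dotProduct_smul, single_one_dotProduct, single_one_dotProduct,
    h1, h2]
  simp only [smul_eq_mul]
  ring

end GramSchmidt

end RobustChow

/-! ### The program and its specification -/

namespace RobustChow

namespace ChowProgram

open RealRAM RealRAM.Expr Matrix

/-- The Kronecker delta of two registers. -/
def delta (i j : ℕ) : Expr := ifLt (idx i) (idx j) (const 0) (ifLt (idx j) (idx i) (const 0) (const 1))

theorem eval_delta (i j : ℕ) (ρ : ℕ → ℕ) (μ : Mem) :
    (delta i j).eval ρ μ = if ρ i = ρ j then 1 else 0 := by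
  rcases lt_trichotomy (ρ i) (ρ j) with h | h | h
  · simp [delta, h, h.ne]
  · simp [delta, h]
  · simp [delta, h, h.ne', not_lt.2 h.le]

/-- Row `k` (register 5) of array 10 becomes the `k`-th vector of Gram-Schmidt orthogonalization with
respect to the matrix in array 8; array 11 holds the squares of the vectors. -/
def gramSchmidtRow : St := .forN 6 3 (.assign 10 (.reg 5) (.reg 6)
  (delta 5 6 - fold .sum 7 5 (fold .sum 8 3 (get 8 (.reg 5) (.reg 8) * get 10 (.reg 7) (.reg 8)) /
    get 11 (.reg 7) (.num 0) * get 10 (.reg 7) (.reg 6))))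

/-- Array 12 becomes the product of the matrix and the new vector. -/
def imageRow : St := .forN 6 3 (.assign 12 (.num 0) (.reg 6)
  (fold .sum 7 3 (get 8 (.reg 6) (.reg 7) * get 10 (.reg 5) (.reg 7))))

def squareEntry : St := .assign 11 (.reg 5) (.num 0)
  (fold .sum 6 3 (get 10 (.reg 5) (.reg 6) * get 12 (.num 0) (.reg 6)))

/-- Array 9 becomes the new vector if its square is negative. -/
def tryVector : St := .forN 6 3 (.assign 9 (.num 0) (.reg 6)
  (ifLt (get 11 (.reg 5) (.num 0)) (const 0) (get 10 (.reg 5) (.reg 6)) (get 9 (.num 0) (.reg 6))))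

/-- The multiple that gives the square the value `-1` if the new vector is isotropic. When the
denominator vanishes or the vector is not isotropic the candidate may be useless, but `tryShifted`
tests the actual value before accepting it. -/
def shift : St := .assign 13 (.num 0) (.num 0)
  ((const (-1) - get 8 (.reg 6) (.reg 6)) / (const 2 * get 12 (.num 0) (.reg 6)))

/-- Array 9 becomes the `i`-th unit vector (register 6) plus a multiple of the new vector if this
has a negative square. -/
def tryShifted : St := .forN 7 3 (.assign 9 (.num 0) (.reg 7)
  (ifLt (get 8 (.reg 6) (.reg 6) + const 2 * get 13 (.num 0) (.num 0) * get 12 (.num 0) (.reg 6) +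
      get 13 (.num 0) (.num 0) * get 13 (.num 0) (.num 0) * get 11 (.reg 5) (.num 0)) (const 0)
    (delta 6 7 + get 13 (.num 0) (.num 0) * get 10 (.reg 5) (.reg 7)) (get 9 (.num 0) (.reg 7))))

def gramSchmidtStep : St := .seq gramSchmidtRow (.seq imageRow (.seq squareEntry (.seq tryVector
  (.forN 6 3 (.seq shift tryShifted)))))

/-- Array 9 becomes a vector with negative square if there is one, and zero otherwise. -/
def findNegative : St := .seq (.forN 5 3 (.assign 9 (.num 0) (.reg 5) (const 0)))
  (.forN 5 3 gramSchmidtStep)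

/-- The vector of length `ℓ` in row `k` of an array. -/
def rowVec (ℓ : ℕ) (M : ℕ → ℕ → ℝ) (k : ℕ) : Fin ℓ → ℝ := fun j => M k j

/-- The matrix of size `ℓ` in an array. -/
def toMat (ℓ : ℕ) (M : ℕ → ℕ → ℝ) : Matrix (Fin ℓ) (Fin ℓ) ℝ := Matrix.of fun i j => M i j

theorem mulVec_rowVec (ℓ : ℕ) (M W : ℕ → ℕ → ℝ) (k : ℕ) (i : Fin ℓ) :
    (toMat ℓ M *ᵥ rowVec ℓ W k) i = ∑ j ∈ Finset.range ℓ, M i j * W k j := by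
  rw [Finset.sum_range]; rfl

theorem single_mk_apply {ℓ i : ℕ} (hi : i < ℓ) (j : Fin ℓ) :
    Pi.single (M := fun _ => ℝ) (⟨i, hi⟩ : Fin ℓ) 1 j = if i = j then 1 else 0 := by
  rw [Pi.single_apply]
  exact if_congr (by rw [Fin.ext_iff, eq_comm]) rfl rfl

/-- One step of the recurrence in `nonneg_of_gramSchmidt`, with its dichotomy: either the candidate
in array 9 has a negative square, or it is untouched and the new vector meets the sign and kernel
conditions. A candidate found earlier survives, since only vectors of negative square overwrite it.
-/
theorem gramSchmidtStep_spec {ℓ k : ℕ} (hk : k < ℓ) {ρ : ℕ → ℕ} (h3 : ρ 3 = ℓ) (h5 : ρ 5 = k)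
    {μ : Mem} (hA : (toMat ℓ (μ 8))ᵀ = toMat ℓ (μ 8)) {μ' : Mem}
    (hμ' : μ' = gramSchmidtStep.exec ρ μ) :
    (∀ l, l ≠ k → μ' 10 l = μ 10 l ∧ μ' 11 l = μ 11 l) ∧
    rowVec ℓ (μ' 10) k = Pi.single ⟨k, hk⟩ 1 - ∑ l ∈ Finset.range k,
      ((toMat ℓ (μ 8) *ᵥ rowVec ℓ (μ 10) l) ⟨k, hk⟩ / μ 11 l 0) • rowVec ℓ (μ 10) l ∧
    μ' 11 k 0 = rowVec ℓ (μ' 10) k ⬝ᵥ toMat ℓ (μ 8) *ᵥ rowVec ℓ (μ' 10) k ∧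
    (rowVec ℓ (μ' 9) 0 ⬝ᵥ toMat ℓ (μ 8) *ᵥ rowVec ℓ (μ' 9) 0 < 0 ∨
      rowVec ℓ (μ' 9) 0 = rowVec ℓ (μ 9) 0 ∧ 0 ≤ μ' 11 k 0 ∧
        (μ' 11 k 0 = 0 → toMat ℓ (μ 8) *ᵥ rowVec ℓ (μ' 10) k = 0)) := by
  set A := toMat ℓ (μ 8) with hAdef
  set μ₁ := gramSchmidtRow.exec ρ μ with hμ₁
  have e₁ : μ₁ = fun a x y => if a = 10 ∧ x = k ∧ y < ρ 3 then
      (if k = y then 1 else 0) - ∑ l ∈ Finset.range k,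
        (∑ i ∈ Finset.range ℓ, μ 8 k i * μ 10 l i) / μ 11 l 0 * μ 10 l y else μ a x y := by
    refine St.exec_fill_row _ (fun c => by simp [h5]) fun c hc μ' h1 h2 => ?_
    simp only [eval_sub, eval_delta, eval_fold_sum, eval_mul, eval_div, eval_get, Ix.eval_reg,
      Ix.eval_num, Function.update_apply]
    simp only [Nat.reduceEqDiff, if_false, if_true, h5, h3]
    congr 1
    refine Finset.sum_congr rfl fun l hl => ?_
    have hl' := (Finset.mem_range.1 hl).ne
    rw [h1 8 (by decide), h1 11 (by decide), h2 l c (Or.inl hl')]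
    congr 2
    exact Finset.sum_congr rfl fun i _ => by rw [h2 l i (Or.inl hl')]
  set μ₂ := imageRow.exec ρ μ₁ with hμ₂
  have e₂ : μ₂ = fun a x y => if a = 12 ∧ x = 0 ∧ y < ρ 3 then
      ∑ j ∈ Finset.range ℓ, μ 8 y j * μ₁ 10 k j else μ₁ a x y := by
    refine St.exec_fill_row _ (fun c => by simp) fun c hc μ' h1 h2 => ?_
    simp only [eval_fold_sum, eval_mul, eval_get, Ix.eval_reg, Function.update_apply]
    simp only [Nat.reduceEqDiff, if_false, if_true, h5, h3]
    rw [h1 8 (by decide), h1 10 (by decide), hμ₁,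
      St.exec_of_not_writes (by decide : gramSchmidtRow.writes 8 = false)]
  set U := rowVec ℓ (μ₁ 10) k with hU
  have hAU : ∀ i : Fin ℓ, μ₂ 12 0 i = (A *ᵥ U) i := fun i => by
    rw [hAdef, hU, mulVec_rowVec, e₂]
    simp [h3]
  set μ₃ := squareEntry.exec ρ μ₂ with hμ₃
  have e₃ : μ₃ = fun a x y => if a = 11 ∧ x = k ∧ y = 0 then U ⬝ᵥ A *ᵥ U else μ₂ a x y := by
    rw [hμ₃]
    funext a x y
    have : ∑ i ∈ Finset.range ℓ, μ₂ 10 k i * μ₂ 12 0 i = U ⬝ᵥ A *ᵥ U := by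
      rw [Finset.sum_range]
      refine Finset.sum_congr rfl fun i _ => ?_
      rw [hAU]
      congr 1
      rw [hμ₂, St.exec_of_not_writes (by decide : imageRow.writes 10 = false)]
      rfl
    simp only [squareEntry, St.exec, eval_fold_sum, eval_mul, eval_get, Ix.eval_reg, Ix.eval_num,
      Function.update_apply]
    simp only [Nat.reduceEqDiff, if_false, if_true, h5, h3, this]
  set d := U ⬝ᵥ A *ᵥ U with hd
  set μ₄ := tryVector.exec ρ μ₃ with hμ₄
  have e₄ : μ₄ = fun a x y => if a = 9 ∧ x = 0 ∧ y < ρ 3 then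
      (if d < 0 then μ₁ 10 k y else μ 9 0 y) else μ₃ a x y := by
    refine St.exec_fill_row _ (fun c => by simp) fun c hc μ' h1 h2 => ?_
    simp only [eval_ifLt, eval_const, eval_get, Ix.eval_reg, Ix.eval_num, Function.update_apply]
    simp only [Nat.reduceEqDiff, if_false, if_true, h5, Rat.cast_zero]
    rw [h1 11 (by decide), h1 10 (by decide), h2 0 c (Or.inr le_rfl)]
    have f1 : μ₃ 11 k 0 = d := by rw [e₃]; simp
    have f2 : μ₃ 10 = μ₁ 10 := by
      rw [hμ₃, St.exec_of_not_writes (by decide : squareEntry.writes 10 = false), hμ₂,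
        St.exec_of_not_writes (by decide : imageRow.writes 10 = false)]
    have f3 : μ₃ 9 = μ 9 := by
      rw [hμ₃, St.exec_of_not_writes (by decide : squareEntry.writes 9 = false), hμ₂,
        St.exec_of_not_writes (by decide : imageRow.writes 9 = false), hμ₁,
        St.exec_of_not_writes (by decide : gramSchmidtRow.writes 9 = false)]
    rw [f1, f2, f3]
  have fin : μ' = (St.forN 6 3 (.seq shift tryShifted)).exec ρ μ₄ := hμ'
  have g10 : μ' 10 = μ₁ 10 := by
    rw [fin, St.exec_of_not_writes (by decide), hμ₄,
      St.exec_of_not_writes (by decide : tryVector.writes 10 = false), hμ₃,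
      St.exec_of_not_writes (by decide : squareEntry.writes 10 = false), hμ₂,
      St.exec_of_not_writes (by decide : imageRow.writes 10 = false)]
  have g11 : μ' 11 = μ₃ 11 := by
    rw [fin, St.exec_of_not_writes (by decide), hμ₄,
      St.exec_of_not_writes (by decide : tryVector.writes 11 = false)]
  have g11k : μ' 11 k 0 = d := by rw [g11, e₃]; simp
  have hUV : rowVec ℓ (μ' 10) k = U := by rw [g10]
  refine ⟨fun l hl => ⟨?_, ?_⟩, ?_, ?_, ?_⟩
  · rw [g10, e₁]; funext y; simp [hl]
  · rw [g11, e₃, hμ₂]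
    funext y
    simp only [hl, false_and, and_false, if_false]
    rw [St.exec_of_not_writes (by decide : imageRow.writes 11 = false), hμ₁,
        St.exec_of_not_writes (by decide : gramSchmidtRow.writes 11 = false)]
  · rw [hUV]
    funext j
    have : U j = μ₁ 10 k j := rfl
    rw [this, e₁]
    simp only [h3, j.2, and_self, if_true, Pi.sub_apply, Finset.sum_apply, Pi.smul_apply, smul_eq_mul,
      hAdef, mulVec_rowVec, single_mk_apply]
    rfl
  · rw [hUV, g11k]
  · rw [hUV, g11k]
    let Ok : Mem → Prop := fun ν => rowVec ℓ (ν 9) 0 ⬝ᵥ A *ᵥ rowVec ℓ (ν 9) 0 < 0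
    have start : Ok μ₄ ∨ (rowVec ℓ (μ₄ 9) 0 = rowVec ℓ (μ 9) 0 ∧ 0 ≤ d) := by
      by_cases hlt : d < 0
      · left
        have : rowVec ℓ (μ₄ 9) 0 = U := by
          funext j
          simp only [rowVec, e₄, h3, j.2, hlt, hU]
          simp
        simp only [Ok, this]
        exact hlt
      · right
        refine ⟨?_, not_lt.1 hlt⟩
        funext j
        simp only [rowVec, e₄, h3, j.2, hlt]
        simp
    -- If no shifted candidate has been accepted, the first `i` entries of the image of an isotropic
    -- new vector are zero.
    let I : ℕ → Mem → Prop := fun i ν => (∀ a, a ≠ 9 → a ≠ 13 → ν a = μ₄ a) ∧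
      (Ok ν ∨ (rowVec ℓ (ν 9) 0 = rowVec ℓ (μ 9) 0 ∧ 0 ≤ d ∧
        (d = 0 → ∀ i' : Fin ℓ, i'.1 < i → (A *ᵥ U) i' = 0)))
    have main : I (ρ 3) μ' := by
      rw [fin]
      refine St.exec_forN_induct I ⟨fun a _ _ => rfl, start.imp_right fun h =>
        ⟨h.1, h.2, fun _ i' hi' => absurd hi' (Nat.not_lt_zero _)⟩⟩ ?_
      rintro i hi ν ⟨hν, hor⟩
      rw [h3] at hi
      set ν₁ := shift.exec (Function.update ρ 6 i) ν with hν₁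
      have f8 : ν 8 = μ 8 := by
        rw [hν 8 (by decide) (by decide), hμ₄,
          St.exec_of_not_writes (by decide : tryVector.writes 8 = false), hμ₃,
          St.exec_of_not_writes (by decide : squareEntry.writes 8 = false), hμ₂,
          St.exec_of_not_writes (by decide : imageRow.writes 8 = false), hμ₁,
          St.exec_of_not_writes (by decide : gramSchmidtRow.writes 8 = false)]
      have f10 : ν 10 = μ₁ 10 := by
        rw [hν 10 (by decide) (by decide), hμ₄,
          St.exec_of_not_writes (by decide : tryVector.writes 10 = false), hμ₃,
          St.exec_of_not_writes (by decide : squareEntry.writes 10 = false), hμ₂,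
          St.exec_of_not_writes (by decide : imageRow.writes 10 = false)]
      have f11 : ν 11 k 0 = d := by
        rw [hν 11 (by decide) (by decide), hμ₄,
          St.exec_of_not_writes (by decide : tryVector.writes 11 = false), e₃]
        simp
      have f12 : ν 12 0 i = (A *ᵥ U) ⟨i, hi⟩ := by
        rw [hν 12 (by decide) (by decide), hμ₄,
          St.exec_of_not_writes (by decide : tryVector.writes 12 = false), hμ₃,
          St.exec_of_not_writes (by decide : squareEntry.writes 12 = false)]
        exact hAU ⟨i, hi⟩
      set s := (-1 - A ⟨i, hi⟩ ⟨i, hi⟩) / (2 * (A *ᵥ U) ⟨i, hi⟩) with hs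
      have eν₁ : ν₁ = fun a x y => if a = 13 ∧ x = 0 ∧ y = 0 then s else ν a x y := by
        rw [hν₁]
        funext a x y
        simp only [shift, St.exec, eval_sub, eval_div, eval_mul, eval_const, eval_get, Ix.eval_reg,
          Ix.eval_num, Function.update_self, f8, f12, hs, hAdef, toMat, Matrix.of_apply]
        norm_num
      set val := A ⟨i, hi⟩ ⟨i, hi⟩ + 2 * s * (A *ᵥ U) ⟨i, hi⟩ + s * s * d with hval
      have eν₂ : tryShifted.exec (Function.update ρ 6 i) ν₁ = fun a x y =>
          if a = 9 ∧ x = 0 ∧ y < Function.update ρ 6 i 3 then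
            (if val < 0 then (if i = y then 1 else 0) + s * μ₁ 10 k y else ν 9 0 y)
          else ν₁ a x y := by
        refine St.exec_fill_row _ (fun c => by simp) fun c hc μ' h1 h2 => ?_
        simp only [eval_ifLt, eval_const, eval_get, Ix.eval_reg, Ix.eval_num, Function.update_apply,
          eval_delta, eval_add, eval_mul]
        simp only [Nat.reduceEqDiff, if_false, if_true, h5, Rat.cast_zero,
          Rat.cast_ofNat]
        rw [h1 11 (by decide), h1 10 (by decide), h1 8 (by decide), h1 12 (by decide),
          h1 13 (by decide), h2 0 c (Or.inr le_rfl), eν₁]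
        simp only [Nat.reduceEqDiff, if_false, false_and, true_and, if_true, f11,
          f10, f8, f12, and_self]
        rfl
      have hrow : rowVec ℓ ((tryShifted.exec (Function.update ρ 6 i) ν₁) 9) 0 =
          if val < 0 then Pi.single ⟨i, hi⟩ 1 + s • U else rowVec ℓ (ν 9) 0 := by
        funext j
        simp only [rowVec, eν₂, Function.update_apply]
        simp only [Nat.reduceEqDiff, if_false, h3, j.2, and_self, if_true]
        by_cases hlt : val < 0
        · simp only [if_pos hlt, Pi.add_apply, Pi.smul_apply, smul_eq_mul, single_mk_apply, hU, rowVec]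
        · simp only [if_neg hlt, rowVec]
      refine ⟨fun a ha9 ha13 => ?_, ?_⟩
      · change tryShifted.exec (Function.update ρ 6 i) ν₁ a = _
        rw [eν₂, eν₁, ← hν a ha9 ha13]
        funext x y
        simp [ha9, ha13]
      · change Ok (tryShifted.exec (Function.update ρ 6 i) ν₁) ∨
          (rowVec ℓ ((tryShifted.exec (Function.update ρ 6 i) ν₁) 9) 0 = _ ∧ _)
        simp only [Ok, hrow]
        by_cases hlt : val < 0
        · left
          simp only [hlt, if_true]
          rw [dotProduct_mulVec_single_add hA]
          exact hlt
        · simp only [hlt, if_false]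
          refine hor.imp_right fun ⟨h1, h2, h4⟩ => ⟨h1, h2, fun hd0 i' hi' => ?_⟩
          rcases Nat.lt_succ_iff_lt_or_eq.1 hi' with h | h
          · exact h4 hd0 i' h
          · by_contra hne
            have hi'' : i' = ⟨i, hi⟩ := Fin.ext h
            rw [hi''] at hne
            apply hlt
            -- A nonzero entry would have produced a candidate of square `-1`, which the test would
            -- have accepted.
            have : val = -1 := by
              rw [hval, hd0, hs]
              field_simp
              ring
            rw [this]
            norm_num
    obtain ⟨-, h | ⟨h1, h2, h4⟩⟩ := main
    · exact Or.inl h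
    · refine Or.inr ⟨h1, h2, fun hd0 => funext fun i => h4 hd0 i ?_⟩
      rw [h3]; exact i.2

/-- If no candidate is ever accepted, the hypotheses of `nonneg_of_gramSchmidt` hold for all steps.
The default value zero then makes all scores vanish, so a round without a violation needs no
separate branch. -/
theorem findNegative_spec {ℓ : ℕ} {ρ : ℕ → ℕ} (h3 : ρ 3 = ℓ) {μ : Mem}
    (hA : (toMat ℓ (μ 8))ᵀ = toMat ℓ (μ 8)) {v : Fin ℓ → ℝ}
    (hv : v = rowVec ℓ (findNegative.exec ρ μ 9) 0) :
    v ⬝ᵥ toMat ℓ (μ 8) *ᵥ v < 0 ∨ v = 0 ∧ ∀ x : Fin ℓ → ℝ, 0 ≤ x ⬝ᵥ toMat ℓ (μ 8) *ᵥ x := by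
  set A := toMat ℓ (μ 8) with hAdef
  set μ₁ := (St.forN 5 3 (.assign 9 (.num 0) (.reg 5) (const 0))).exec ρ μ with hμ₁
  have e₁ : μ₁ = fun a x y => if a = 9 ∧ x = 0 ∧ y < ρ 3 then 0 else μ a x y :=
    St.exec_fill_row (fun _ => 0) (fun c => by simp) fun c hc μ' h1 h2 => by simp
  let I : ℕ → Mem → Prop := fun k ν => ν 8 = μ 8 ∧
    (∀ k' (hk' : k' < ℓ), k' < k → rowVec ℓ (ν 10) k' = Pi.single ⟨k', hk'⟩ 1 -
      ∑ l ∈ Finset.range k', ((A *ᵥ rowVec ℓ (ν 10) l) ⟨k', hk'⟩ / ν 11 l 0) • rowVec ℓ (ν 10) l) ∧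
    (∀ k' < k, ν 11 k' 0 = rowVec ℓ (ν 10) k' ⬝ᵥ A *ᵥ rowVec ℓ (ν 10) k') ∧
    (rowVec ℓ (ν 9) 0 ⬝ᵥ A *ᵥ rowVec ℓ (ν 9) 0 < 0 ∨ rowVec ℓ (ν 9) 0 = 0 ∧
      ∀ k' < k, 0 ≤ ν 11 k' 0 ∧ (ν 11 k' 0 = 0 → A *ᵥ rowVec ℓ (ν 10) k' = 0))
  have main : I (ρ 3) (findNegative.exec ρ μ) := by
    refine St.exec_forN_induct I ⟨?_, fun _ _ h => absurd h (Nat.not_lt_zero _),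
      fun _ h => absurd h (Nat.not_lt_zero _), Or.inr ⟨?_, fun _ h => absurd h (Nat.not_lt_zero _)⟩⟩ ?_
    · change μ₁ 8 = _
      rw [e₁]; rfl
    · change rowVec ℓ (μ₁ 9) 0 = 0
      funext j
      simp [rowVec, e₁, h3]
    · rintro k hk ν ⟨i1, i2, i3, i4⟩
      rw [h3] at hk
      set ν' := gramSchmidtStep.exec (Function.update ρ 5 k) ν with hν'
      have hA' : (toMat ℓ (ν 8))ᵀ = toMat ℓ (ν 8) := by rw [i1]; exact hA
      obtain ⟨s1, s2, s3, s4⟩ := gramSchmidtStep_spec hk (ρ := Function.update ρ 5 k) (by simp [h3])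
        (by simp) hA' hν'
      rw [i1, ← hAdef] at s2 s3 s4
      have old10 : ∀ l, l < k → rowVec ℓ (ν' 10) l = rowVec ℓ (ν 10) l := fun l hl => by
        funext j
        simp only [rowVec]
        rw [(s1 l hl.ne).1]
      have old11 : ∀ l, l < k → ν' 11 l 0 = ν 11 l 0 := fun l hl => by rw [(s1 l hl.ne).2]
      refine ⟨?_, fun k' hk' hlt => ?_, fun k' hlt => ?_, ?_⟩
      · rw [hν', St.exec_of_not_writes (by decide : gramSchmidtStep.writes 8 = false), i1]
      · have hsum : ∀ l ∈ Finset.range k',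
            ((A *ᵥ rowVec ℓ (ν' 10) l) ⟨k', hk'⟩ / ν' 11 l 0) • rowVec ℓ (ν' 10) l =
              ((A *ᵥ rowVec ℓ (ν 10) l) ⟨k', hk'⟩ / ν 11 l 0) • rowVec ℓ (ν 10) l := fun l hl => by
          rw [Finset.mem_range] at hl
          rw [old10 l (by omega), old11 l (by omega)]
        rw [Finset.sum_congr rfl hsum]
        rcases Nat.lt_succ_iff_lt_or_eq.1 hlt with h | rfl
        · rw [old10 k' h, i2 k' hk' h]
        · exact s2
      · rcases Nat.lt_succ_iff_lt_or_eq.1 hlt with h | rfl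
        · rw [old10 k' h, old11 k' h, i3 k' h]
        · exact s3
      · rcases s4 with h | ⟨h1, h2, h4⟩
        · exact Or.inl h
        · rw [h1]
          refine i4.imp_right fun ⟨j1, j2⟩ => ⟨j1, fun k' hlt => ?_⟩
          rcases Nat.lt_succ_iff_lt_or_eq.1 hlt with h | rfl
          · rw [old10 k' h, old11 k' h]; exact j2 k' h
          · exact ⟨h2, h4⟩
  rw [hv]
  obtain ⟨-, m2, m3, m4⟩ := main
  rw [h3] at m2 m3 m4
  refine m4.imp_right fun ⟨h1, h2⟩ => ⟨h1, fun x => ?_⟩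
  exact nonneg_of_gramSchmidt hA (V := fun k => rowVec ℓ (findNegative.exec ρ μ 10) k)
    (δ := fun k => findNegative.exec ρ μ 11 k 0) (fun k => m2 k k.2 k.2) (fun k => m3 k k.2)
    (fun k => (h2 k k.2).1) (fun k => (h2 k k.2).2) x

def eps : Expr := get 0 (.num 0) (.num 0)
def gam : Expr := get 0 (.num 0) (.num 1)
def del : Expr := get 0 (.num 0) (.num 2)

/-- Array 8 becomes the gap between the admissible second moments and the weighted ones. -/
def formMatrix : St := .forN 5 3 (.forN 6 3 (.assign 8 (.reg 5) (.reg 6)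
  ((const 1 + const 100 * (gam + del + eps)) * get 3 (.reg 5) (.reg 6) -
    fold .sum 7 2 (get 7 (.reg 7) (.num 0) * get 6 (.reg 7) (.reg 5) * get 6 (.reg 7) (.reg 6)) /
      idx 2)))

def values : St := .forN 5 2 (.assign 14 (.reg 5) (.num 0)
  (fold .sum 6 3 (get 9 (.num 0) (.reg 6) * get 6 (.reg 5) (.reg 6))))

/-- A computable substitute for `T₀ ^ 2 * ‖b a‖ ^ 2`: neither `T₀` nor the exact 2-norm is known,
but `2 * δ / ε` bounds the former squared and twice the form of `Sg` bounds the latter squared. -/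
def threshold : St := .assign 15 (.num 0) (.num 0) (const 4 * del / eps *
  fold .sum 5 3 (fold .sum 6 3 (get 9 (.num 0) (.reg 5) * get 3 (.reg 5) (.reg 6) *
    get 9 (.num 0) (.reg 6))))

def scores : St := .forN 5 2 (.assign 16 (.reg 5) (.num 0)
  (ifLt (get 15 (.num 0) (.num 0)) (get 14 (.reg 5) (.num 0) * get 14 (.reg 5) (.num 0))
    (get 14 (.reg 5) (.num 0) * get 14 (.reg 5) (.num 0) - get 15 (.num 0) (.num 0)) (const 0)))

/-- Points without weight are disregarded, so that a positive maximum is attained at a point that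
the round newly kills. -/
def maxScore : St := .assign 17 (.num 0) (.num 0)
  (fold .max 5 2 (ifLt (const 0) (get 7 (.reg 5) (.num 0)) (get 16 (.reg 5) (.num 0)) (const 0)))

/-- If the maximal score is zero, division by zero yields zero and the weights stay. -/
def updateWeights : St := .forN 5 2 (.assign 7 (.reg 5) (.num 0)
  (get 7 (.reg 5) (.num 0) - get 7 (.reg 5) (.num 0) * get 16 (.reg 5) (.num 0) /
    get 17 (.num 0) (.num 0)))

def round : St := .seq formMatrix (.seq findNegative (.seq values (.seq threshold (.seq scores
  (.seq maxScore updateWeights)))))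

/-- The matrix whose quadratic form compares the admissible second moments with the weighted ones. -/
noncomputable def gapMatrix {N ℓ : ℕ} (ε γ δ : ℝ) (Sg : Matrix (Fin ℓ) (Fin ℓ) ℝ)
    (m : Fin N → Fin ℓ → ℝ) (w : Fin N → ℝ) : Matrix (Fin ℓ) (Fin ℓ) ℝ :=
  Matrix.of fun i j => (1 + 100 * (γ + δ + ε)) * Sg i j - (∑ k, w k * m k i * m k j) / N

/-- The weights `w'` are obtained from `w` by one round of filtering. -/
def FilterRound {N ℓ : ℕ} (ε γ δ : ℝ) (Sg : Matrix (Fin ℓ) (Fin ℓ) ℝ)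
    (m : Fin N → Fin ℓ → ℝ) (w w' : Fin N → ℝ) : Prop :=
  ∃ v : Fin ℓ → ℝ, (v ⬝ᵥ gapMatrix ε γ δ Sg m w *ᵥ v < 0 ∨
      v = 0 ∧ ∀ x : Fin ℓ → ℝ, 0 ≤ x ⬝ᵥ gapMatrix ε γ δ Sg m w *ᵥ x) ∧
    ∃ (τ : Fin N → ℝ) (r : ℝ), (∀ i, τ i = max ((v ⬝ᵥ m i) ^ 2 - 4 * δ / ε * (v ⬝ᵥ Sg *ᵥ v)) 0) ∧
      IsMaxScore w τ r ∧ ∀ i, w' i = w i - w i * τ i / r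

theorem round_spec {N ℓ : ℕ} {ρ : ℕ → ℕ} (h2 : ρ 2 = N) (h3 : ρ 3 = ℓ) {μ : Mem}
    (hS : (toMat ℓ (μ 3))ᵀ = toMat ℓ (μ 3)) :
    FilterRound (μ 0 0 0) (μ 0 0 1) (μ 0 0 2) (toMat ℓ (μ 3)) (fun i : Fin N => rowVec ℓ (μ 6) i)
      (fun i => μ 7 i 0) (fun i => round.exec ρ μ 7 i 0) := by
  set ε := μ 0 0 0
  set γ := μ 0 0 1
  set δ := μ 0 0 2
  set A := gapMatrix ε γ δ (toMat ℓ (μ 3)) (fun i : Fin N => rowVec ℓ (μ 6) i)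
    (fun i => μ 7 i 0) with hAdef
  set μ₁ := formMatrix.exec ρ μ with hμ₁
  have k₁ : ∀ a, a ≠ 8 → μ₁ a = μ a := fun a ha =>
    St.exec_of_not_writes (by simp [formMatrix, St.writes, ha.symm]) _ _
  have e₁ : toMat ℓ (μ₁ 8) = A := by
    have : μ₁ = fun a x y => if a = 8 ∧ x < ρ 3 ∧ y < ρ 3 then
        (1 + 100 * (γ + δ + ε)) * μ 3 x y -
          (∑ k ∈ Finset.range N, μ 7 k 0 * μ 6 k x * μ 6 k y) / N else μ a x y := by
      refine St.exec_fill (by decide) (by decide) _ fun x hx y hy μ' h1 => ?_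
      simp only [eval_sub, eval_mul, eval_add, eval_div, eval_const, eval_get, eval_fold_sum, eval_idx,
        Ix.eval_reg, Ix.eval_num, Function.update_apply, gam, del, eps]
      simp only [Nat.reduceEqDiff, if_false, if_true, h2, Rat.cast_one, Rat.cast_ofNat]
      rw [h1 0 (by decide), h1 3 (by decide), h1 6 (by decide), h1 7 (by decide)]
    ext i j
    rw [this, hAdef]
    simp only [toMat, gapMatrix, Matrix.of_apply, h3, i.2, j.2, and_self, if_true, Finset.sum_range]
    rfl
  have hAs : (toMat ℓ (μ₁ 8))ᵀ = toMat ℓ (μ₁ 8) := by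
    rw [e₁, hAdef]
    ext i j
    have := congrFun (congrFun hS i) j
    simp only [Matrix.transpose_apply] at this
    simp only [Matrix.transpose_apply, gapMatrix, Matrix.of_apply, this]
    congr 2
    exact Finset.sum_congr rfl fun k _ => by ring
  set μ₂ := findNegative.exec ρ μ₁ with hμ₂
  set v := rowVec ℓ (μ₂ 9) 0 with hv
  have dich := findNegative_spec h3 hAs hv
  rw [e₁] at dich
  have k₂ : ∀ a, findNegative.writes a = false → μ₂ a = μ₁ a := fun a ha =>
    St.exec_of_not_writes ha _ _
  set μ₃ := values.exec ρ μ₂ with hμ₃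
  have k₃ : ∀ a, a ≠ 14 → μ₃ a = μ₂ a := fun a ha =>
    St.exec_of_not_writes (by simp [values, St.writes, ha.symm]) _ _
  have e₃ : ∀ i < N, μ₃ 14 i 0 = v ⬝ᵥ rowVec ℓ (μ 6) i := by
    have : μ₃ = fun a x y => if a = 14 ∧ x < ρ 2 ∧ y = 0 then
        ∑ j ∈ Finset.range ℓ, μ₂ 9 0 j * μ₂ 6 x j else μ₂ a x y := by
      refine St.exec_fill_col _ fun c hc μ' h1 _ => ?_
      simp only [eval_fold_sum, eval_mul, eval_get, Ix.eval_reg, Ix.eval_num, Function.update_apply]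
      simp only [Nat.reduceEqDiff, if_false, if_true, h3]
      rw [h1 9 (by decide), h1 6 (by decide)]
    intro i hi
    rw [this]
    simp only [h2, hi, and_self, if_true, Finset.sum_range]
    rw [k₂ 6 (by decide), k₁ 6 (by decide)]
    rfl
  set μ₄ := threshold.exec ρ μ₃ with hμ₄
  have k₄ : ∀ a, a ≠ 15 → μ₄ a = μ₃ a := fun a ha =>
    St.exec_of_not_writes (by simp [threshold, St.writes, ha.symm]) _ _
  set θ := 4 * δ / ε * (v ⬝ᵥ toMat ℓ (μ 3) *ᵥ v) with hθ
  have e₄ : μ₄ 15 0 0 = θ := by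
    simp only [hμ₄, threshold, St.exec, Ix.eval_num, and_self, if_true, eval_mul, eval_div, eval_const,
      eval_get, eval_fold_sum, Ix.eval_reg, Function.update_apply, del, eps]
    simp only [Nat.reduceEqDiff, if_false, h3, Rat.cast_ofNat]
    rw [k₃ 0 (by decide), k₂ 0 (by decide), k₁ 0 (by decide), k₃ 3 (by decide), k₂ 3 (by decide),
      k₁ 3 (by decide), k₃ 9 (by decide), hθ]
    congr 1
    simp only [Finset.sum_range, dotProduct, mulVec, Finset.mul_sum]
    exact Finset.sum_congr rfl fun i _ => Finset.sum_congr rfl fun j _ => mul_assoc _ _ _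
  set μ₅ := scores.exec ρ μ₄ with hμ₅
  have k₅ : ∀ a, a ≠ 16 → μ₅ a = μ₄ a := fun a ha =>
    St.exec_of_not_writes (by simp [scores, St.writes, ha.symm]) _ _
  set τ : ℕ → ℝ := fun i => max ((v ⬝ᵥ rowVec ℓ (μ 6) i) ^ 2 - θ) 0 with hτ
  have e₅ : ∀ i < N, μ₅ 16 i 0 = τ i := by
    have : μ₅ = fun a x y => if a = 16 ∧ x < ρ 2 ∧ y = 0 then
        (if θ < μ₄ 14 x 0 * μ₄ 14 x 0 then μ₄ 14 x 0 * μ₄ 14 x 0 - θ else 0) else μ₄ a x y := by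
      refine St.exec_fill_col _ fun c hc μ' h1 _ => ?_
      simp only [eval_ifLt, eval_sub, eval_mul, eval_const, eval_get, Ix.eval_reg, Ix.eval_num,
        Function.update_self]
      rw [h1 15 (by decide), h1 14 (by decide), e₄]
      simp
    intro i hi
    rw [this]
    simp only [h2, hi, and_self, if_true]
    rw [k₄ 14 (by decide), e₃ i hi, hτ]
    simp only [sq]
    split_ifs with h
    · rw [max_eq_left (by linarith)]
    · rw [max_eq_right (by linarith)]
  set μ₆ := maxScore.exec ρ μ₅ with hμ₆
  have k₆ : ∀ a, a ≠ 17 → μ₆ a = μ₅ a := fun a ha =>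
    St.exec_of_not_writes (by simp [maxScore, St.writes, ha.symm]) _ _
  have w₅ : μ₅ 7 = μ 7 := by
    rw [k₅ 7 (by decide), k₄ 7 (by decide), k₃ 7 (by decide), k₂ 7 (by decide), k₁ 7 (by decide)]
  set g : ℕ → ℝ := fun i => if 0 < μ 7 i 0 then μ₅ 16 i 0 else 0 with hg
  have e₆ : μ₆ 17 0 0 = FoldOp.max.fold g N := by
    simp only [hμ₆, maxScore, St.exec, Ix.eval_num, and_self, if_true, eval_fold_max, eval_ifLt,
      eval_const, eval_get, Ix.eval_reg, Function.update_self, h2, w₅, Rat.cast_zero, hg]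
  set r := FoldOp.max.fold g N with hr
  have e₇ : ∀ i < N, round.exec ρ μ 7 i 0 = μ 7 i 0 - μ 7 i 0 * τ i / r := by
    have : updateWeights.exec ρ μ₆ = fun a x y => if a = 7 ∧ x < ρ 2 ∧ y = 0 then
        μ₆ 7 x 0 - μ₆ 7 x 0 * μ₆ 16 x 0 / r else μ₆ a x y := by
      refine St.exec_fill_col _ fun c hc μ' h1 h1' => ?_
      simp only [eval_sub, eval_div, eval_mul, eval_get, Ix.eval_reg, Ix.eval_num,
        Function.update_self]
      rw [h1 16 (by decide), h1 17 (by decide), e₆, h1' c 0 (Or.inr le_rfl)]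
    intro i hi
    change updateWeights.exec ρ μ₆ 7 i 0 = _
    rw [this]
    simp only [h2, hi, and_self, if_true]
    rw [k₆ 7 (by decide), w₅, k₆ 16 (by decide), e₅ i hi]
  obtain ⟨-, hmax, hatt⟩ := FoldOp.fold_max_spec g N
  refine ⟨v, dich, fun i => τ i, r, fun i => rfl, ⟨fun i hi => ?_, ?_⟩, fun i => e₇ i i.2⟩
  · have := hmax i i.2
    simp only [hg, if_pos hi, e₅ i i.2] at this
    exact this
  · rcases hatt with h | ⟨i, hi, h⟩
    · exact Or.inl h
    · by_cases hw : 0 < μ 7 i 0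
      · refine Or.inr ⟨⟨i, hi⟩, hw, ?_⟩
        simp only [hg, if_pos hw, e₅ i hi] at h
        exact h
      · left
        rw [hr, ← h]
        simp only [hg, if_neg hw]

/-- Array 6 becomes the values of the monomials at the sample points. -/
def monomials : St := .forN 4 2 (.forN 5 3 (.assign 6 (.reg 4) (.reg 5)
  (fold .prod 6 0 (fold .prod 7 1 (ifLt (idx 7) (get 4 (.reg 5) (.reg 6))
    (get 1 (.reg 4) (.reg 6)) (const 1))))))

def initWeights : St := .forN 4 2 (.assign 7 (.reg 4) (.num 0) (const 1))

def correlations : St := .forN 4 3 (.assign 5 (.reg 4) (.num 0)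
  (fold .sum 5 2 (get 7 (.reg 5) (.num 0) * get 2 (.reg 5) (.num 0) * get 6 (.reg 5) (.reg 4)) /
    idx 2))

/-- The whole algorithm for noise rates below one. -/
def filter : St := .seq monomials (.seq initWeights (.seq (.forN 4 2 round) correlations))

theorem filter_spec {n d N ℓ : ℕ} {ρ : ℕ → ℕ} (h0 : ρ 0 = n) (h1 : ρ 1 = d) (h2 : ρ 2 = N)
    (h3 : ρ 3 = ℓ) {μ : Mem} (hS : (toMat ℓ (μ 3))ᵀ = toMat ℓ (μ 3)) {m : Fin N → Fin ℓ → ℝ}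
    (hm : ∀ i j, m i j = ∏ k ∈ Finset.range n, ∏ t ∈ Finset.range d,
      if (t : ℝ) < μ 4 j k then μ 1 i k else 1) :
    ∃ w : ℕ → Fin N → ℝ, (∀ i, w 0 i = 1) ∧
      (∀ t < N, FilterRound (μ 0 0 0) (μ 0 0 1) (μ 0 0 2) (toMat ℓ (μ 3)) m (w t) (w (t + 1))) ∧
      ∀ j : Fin ℓ, filter.exec ρ μ 5 j 0 = (∑ i, w N i * μ 2 i 0 * m i j) / N := by
  set μ₁ := monomials.exec ρ μ with hμ₁
  have k₁ : ∀ a, a ≠ 6 → μ₁ a = μ a := fun a ha =>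
    St.exec_of_not_writes (by simp [monomials, St.writes, ha.symm]) _ _
  have e₁ : ∀ i : Fin N, rowVec ℓ (μ₁ 6) i = m i := by
    have : μ₁ = fun a x y => if a = 6 ∧ x < ρ 2 ∧ y < ρ 3 then
        ∏ k ∈ Finset.range n, ∏ t ∈ Finset.range d, (if (t : ℝ) < μ 4 y k then μ 1 x k else 1)
        else μ a x y := by
      refine St.exec_fill (by decide) (by decide) _ fun x hx y hy μ' h => ?_
      simp only [eval_fold_prod, eval_ifLt, eval_const, eval_get, eval_idx, Ix.eval_reg,
        Function.update_apply]
      simp only [Nat.reduceEqDiff, if_false, if_true, h0, h1, Rat.cast_one]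
      rw [h 4 (by decide), h 1 (by decide)]
    intro i
    funext j
    rw [hm, this]
    simp only [rowVec, h2, h3, i.2, j.2, and_self, if_true]
  set μ₂ := initWeights.exec ρ μ₁ with hμ₂
  have k₂ : ∀ a, a ≠ 7 → μ₂ a = μ₁ a := fun a ha =>
    St.exec_of_not_writes (by simp [initWeights, St.writes, ha.symm]) _ _
  have e₂ : ∀ i : Fin N, μ₂ 7 i 0 = 1 := by
    have : μ₂ = fun a x y => if a = 7 ∧ x < ρ 2 ∧ y = 0 then 1 else μ₁ a x y :=
      St.exec_fill_col (fun _ => 1) fun c hc μ' h _ => by simp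
    intro i
    rw [this]
    simp [h2, i.2]
  set M : ℕ → Mem := fun t => Nat.rec μ₂ (fun i μ' => round.exec (Function.update ρ 4 i) μ') t
    with hM
  have kM : ∀ t a, round.writes a = false → M t a = μ₂ a := by
    intro t a ha
    induction t with
    | zero => rfl
    | succ t ih =>
      change round.exec (Function.update ρ 4 t) (M t) a = _
      rw [St.exec_of_not_writes ha, ih]
  have kMμ : ∀ t a, round.writes a = false → a ≠ 6 → a ≠ 7 → M t a = μ a := fun t a h h' h'' => by
    rw [kM t a h, k₂ a h'', k₁ a h']
  have rowM : ∀ t (i : Fin N), rowVec ℓ (M t 6) i = m i := fun t i => by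
    rw [kM t 6 (by decide), k₂ 6 (by decide), e₁]
  refine ⟨fun t i => M t 7 i 0, e₂, fun t ht => ?_, fun j => ?_⟩
  · have hS' : (toMat ℓ (M t 3))ᵀ = toMat ℓ (M t 3) := by
      rw [kMμ t 3 (by decide) (by decide) (by decide)]; exact hS
    have := round_spec (ρ := Function.update ρ 4 t) (N := N) (by simp [h2]) (by simp [h3]) hS'
    rw [kMμ t 3 (by decide) (by decide) (by decide), kMμ t 0 (by decide) (by decide) (by decide)]
      at this
    simp only [rowM] at this
    exact this
  · change correlations.exec ρ (M (ρ 2)) 5 j 0 = _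
    have : correlations.exec ρ (M (ρ 2)) = fun a x y => if a = 5 ∧ x < ρ 3 ∧ y = 0 then
        (∑ i ∈ Finset.range N, M N 7 i 0 * M N 2 i 0 * M N 6 i x) / N else M (ρ 2) a x y := by
      refine St.exec_fill_col _ fun c hc μ' h _ => ?_
      simp only [eval_div, eval_fold_sum, eval_mul, eval_get, eval_idx, Ix.eval_reg, Ix.eval_num,
        Function.update_apply]
      simp only [Nat.reduceEqDiff, if_false, if_true, h2]
      rw [h 7 (by decide), h 2 (by decide), h 6 (by decide), h2]
    rw [this]
    simp only [h3, j.2, and_self, if_true, Finset.sum_range]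
    congr 1
    refine Finset.sum_congr rfl fun i _ => ?_
    rw [kMμ N 2 (by decide) (by decide) (by decide)]
    congr 1
    exact congrFun (rowM N i) j

end ChowProgram

end RobustChow

/-! ### Monomials, the moment matrix and the trivial output -/

namespace RobustChow

section Monomials

variable {n d ℓ : ℕ} (e : Fin ℓ ≃ Expo n d)

/-- The variables are distinct monomials; similarly, the powers of one variable give `d < ℓ` below.
Every loop bound is then controlled by the sample size once `ℓ` is. -/
theorem card_variables_le {n d ℓ : ℕ} (e : Fin ℓ ≃ Expo n d) (hd : 0 < d) : n ≤ ℓ := by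
  have : Function.Injective fun j : Fin n => e.symm ⟨Finsupp.single j 1, by
      rw [Finset.sum_eq_single j (fun k _ hk => Finsupp.single_eq_of_ne hk) (by simp)]
      simpa using Nat.succ_le_of_lt hd⟩ := fun j k h => by
    have := congrArg Subtype.val (e.symm.injective h)
    exact (Finsupp.single_left_inj one_ne_zero).1 this
  simpa using Fintype.card_le_of_injective _ this

theorem degree_lt_card {n d ℓ : ℕ} (e : Fin ℓ ≃ Expo n d) (hn : 0 < n) : d < ℓ := by
  have : Function.Injective fun t : Fin (d + 1) => e.symm ⟨Finsupp.single ⟨0, hn⟩ (t : ℕ), by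
      rw [Finset.sum_eq_single (⟨0, hn⟩ : Fin n) (fun k _ hk => Finsupp.single_eq_of_ne hk) (by simp)]
      simpa using Nat.lt_succ_iff.1 t.2⟩ := fun s t h => by
    have := congrArg Subtype.val (e.symm.injective h)
    exact Fin.ext (Finsupp.single_injective _ this)
  simpa using Fintype.card_le_of_injective _ this

/-- The vector `m(x)` of all monomials at `x`. -/
noncomputable def monomialVec (x : Fin n → ℝ) : EuclideanSpace ℝ (Fin ℓ) :=
  WithLp.toLp 2 fun i => monomialFn e i x

theorem inner_toLp_monomialVec (a : Fin ℓ → ℝ) (x : Fin n → ℝ) :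
    inner ℝ (WithLp.toLp 2 a) (monomialVec e x) = ∑ i, a i * monomialFn e i x := by
  simp [monomialVec, PiLp.inner_apply, mul_comm]

theorem measurable_monomialFn (i : Fin ℓ) : Measurable (monomialFn e i) := by
  unfold monomialFn
  fun_prop

theorem measurable_monomialVec : Measurable (monomialVec e) :=
  (WithLp.measurable_toLp 2 _).comp (measurable_pi_lambda _ fun i => measurable_monomialFn e i)

variable {D : Measure (Fin n → ℝ)} {ε γ δ Tmax : ℝ} {Q : ℝ → ℝ} {Sg : Matrix (Fin ℓ) (Fin ℓ) ℝ}

theorem IsReasonable.memLp_monomialFn {e : Fin ℓ ≃ Expo n d} (H : IsReasonable D e ε Q Sg γ δ Tmax)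
    (i : Fin ℓ) : MemLp (monomialFn e i) 2 D := by
  obtain ⟨p, hp, h⟩ := exists_polynomial_of_coeffs e (Pi.single i 1)
  have := H.memLp p hp
  simp only [h] at this
  simpa [Pi.single_apply] using this

open Matrix in
theorem dotProduct_momentMatrix_mulVec {e : Fin ℓ ≃ Expo n d}
    (H : IsReasonable D e ε Q Sg γ δ Tmax) (a : Fin ℓ → ℝ) :
    a ⬝ᵥ momentMatrix D e *ᵥ a =
      ∫ x, inner ℝ (WithLp.toLp 2 a) (monomialVec e x) ^ 2 ∂D := by
  have hi : ∀ i j, Integrable (fun x => a i * (monomialFn e i x * monomialFn e j x * a j)) D :=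
    fun i j => (((H.memLp_monomialFn i).integrable_mul (H.memLp_monomialFn j)).mul_const _).const_mul _
  have : ∀ x, inner ℝ (WithLp.toLp 2 a) (monomialVec e x) ^ 2 =
      ∑ i, ∑ j, a i * (monomialFn e i x * monomialFn e j x * a j) := fun x => by
    rw [inner_toLp_monomialVec, sq, Finset.sum_mul_sum]
    exact Finset.sum_congr rfl fun i _ => Finset.sum_congr rfl fun j _ => by ring
  simp only [this]
  rw [integral_finsetSum _ fun i _ => integrable_finsetSum _ fun j _ => hi i j]
  simp only [dotProduct, mulVec, momentMatrix, Matrix.of_apply, Finset.mul_sum]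
  refine Finset.sum_congr rfl fun i _ => ?_
  rw [integral_finsetSum _ fun j _ => hi i j]
  refine Finset.sum_congr rfl fun j _ => ?_
  rw [integral_const_mul, integral_mul_const]

open Matrix in
theorem IsReasonable.form_bounds {e : Fin ℓ ≃ Expo n d}
    (H : IsReasonable D e ε Q Sg γ δ Tmax) (a : Fin ℓ → ℝ) :
    (1 - γ) * (a ⬝ᵥ momentMatrix D e *ᵥ a) ≤ a ⬝ᵥ Sg *ᵥ a ∧
      a ⬝ᵥ Sg *ᵥ a ≤ (1 + γ) * (a ⬝ᵥ momentMatrix D e *ᵥ a) := by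
  have h1 := H.lower.dotProduct_mulVec_nonneg a
  have h2 := H.upper.dotProduct_mulVec_nonneg a
  simp only [star_trivial, sub_mulVec, smul_mulVec, dotProduct_sub, dotProduct_smul,
    smul_eq_mul] at h1 h2
  exact ⟨by linarith, by linarith⟩

open Matrix in
theorem IsReasonable.transpose_eq {e : Fin ℓ ≃ Expo n d}
    (H : IsReasonable D e ε Q Sg γ δ Tmax) : Sgᵀ = Sg := by
  have hM : (momentMatrix D e)ᵀ = momentMatrix D e := by
    ext i j
    simp [momentMatrix, mul_comm]
  have := H.lower.1
  rw [Matrix.IsHermitian, conjTranspose_eq_transpose_of_trivial, transpose_sub, transpose_smul, hM]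
    at this
  exact sub_left_injective this

end Monomials

/-- Cauchy-Schwarz, in the form of a nonnegative variance, bounds the correlation of `f` with `p` by
the norm of `p`. This settles noise rates `ε ≥ 1`. -/
theorem approximatesChow_zero {n d ℓ : ℕ} (e : Fin ℓ ≃ Expo n d) {D : Measure (Fin n → ℝ)}
    [IsProbabilityMeasure D] (hD : ∀ p : MvPolynomial (Fin n) ℝ, p.totalDegree ≤ d →
      MemLp (fun x => MvPolynomial.eval x p) 2 D)
    {f : (Fin n → ℝ) → ℝ} (hf : Measurable f) (hf1 : ∀ x, |f x| ≤ 1) {v : Fin ℓ → ℝ} (hv : v = 0)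
    {η : ℝ} (hη : 1 ≤ η) : ApproximatesChow D f e v η := by
  intro p hp
  have hp2 := hD p hp
  have hfp : MemLp (fun x => f x * MvPolynomial.eval x p) 2 D := by
    refine hp2.mono (hf.aestronglyMeasurable.mul hp2.1) (.of_forall fun x => ?_)
    rw [Real.norm_eq_abs, Real.norm_eq_abs, abs_mul]
    exact mul_le_of_le_one_left (abs_nonneg _) (hf1 x)
  have hvar := ProbabilityTheory.variance_nonneg (fun x => f x * MvPolynomial.eval x p) D
  rw [ProbabilityTheory.variance_eq_sub hfp] at hvar
  have hle : ∫ x, (f x * MvPolynomial.eval x p) ^ 2 ∂D ≤ ∫ x, (MvPolynomial.eval x p) ^ 2 ∂D := by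
    refine integral_mono hfp.integrable_sq hp2.integrable_sq fun x => ?_
    refine sq_le_sq.2 ?_
    rw [abs_mul]
    exact mul_le_of_le_one_left (abs_nonneg _) (hf1 x)
  have : |∫ x, f x * MvPolynomial.eval x p ∂D| ≤ polyNorm D p := by
    refine Real.abs_le_sqrt (le_trans ?_ hle)
    simp only [Pi.pow_apply] at hvar
    linarith
  simp only [hv, Pi.zero_apply, mul_zero, Finset.sum_const_zero, zero_sub, abs_neg]
  exact this.trans (le_mul_of_one_le_left (Real.sqrt_nonneg _) hη)

end RobustChow

/-! ### From corrupted samples to the analysis of the filter -/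

namespace RobustChow

open Matrix ChowProgram

theorem dotProduct_gapMatrix_mulVec {N ℓ : ℕ} (ε γ δ : ℝ) (Sg : Matrix (Fin ℓ) (Fin ℓ) ℝ)
    (m : Fin N → Fin ℓ → ℝ) (w : Fin N → ℝ) (v : Fin ℓ → ℝ) :
    v ⬝ᵥ gapMatrix ε γ δ Sg m w *ᵥ v =
      (1 + 100 * (γ + δ + ε)) * (v ⬝ᵥ Sg *ᵥ v) - (∑ k, w k * (v ⬝ᵥ m k) ^ 2) / N := by
  have h : gapMatrix ε γ δ Sg m w = (1 + 100 * (γ + δ + ε)) • Sg -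
      (N : ℝ)⁻¹ • ∑ k, w k • vecMulVec (m k) (m k) := by
    ext i j
    simp [gapMatrix, Matrix.sum_apply, vecMulVec_apply, div_eq_inv_mul, mul_assoc]
  rw [h, sub_mulVec, smul_mulVec, smul_mulVec, dotProduct_sub, dotProduct_smul, dotProduct_smul,
    smul_eq_mul, smul_eq_mul, div_eq_inv_mul, sum_mulVec, dotProduct_sum]
  congr 2
  refine Finset.sum_congr rfl fun k _ => ?_
  rw [smul_mulVec, vecMulVec_mulVec, dotProduct_smul, op_smul_eq_smul, dotProduct_smul, smul_eq_mul,
    smul_eq_mul, dotProduct_comm v (m k)]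
  ring

/-- A round of filtering either leaves the weights unchanged, all weighted second moments being
admissible, or it lowers the weights according to the scores of a violating polynomial. -/
theorem filterRound_dichotomy {N ℓ : ℕ} (hN : 0 < N) {ε γ δ : ℝ} {Sg : Matrix (Fin ℓ) (Fin ℓ) ℝ}
    {m : Fin N → Fin ℓ → ℝ} {w w' : Fin N → ℝ} (h : FilterRound ε γ δ Sg m w w') :
    ((∀ a : Fin ℓ → ℝ, ∑ i, w i * (a ⬝ᵥ m i) ^ 2 ≤
        N * ((1 + 100 * (γ + δ + ε)) * (a ⬝ᵥ Sg *ᵥ a))) ∧ w' = w) ∨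
      ∃ (a : Fin ℓ → ℝ) (τ : Fin N → ℝ) (r : ℝ),
        N * ((1 + 100 * (γ + δ + ε)) * (a ⬝ᵥ Sg *ᵥ a)) < ∑ i, w i * (a ⬝ᵥ m i) ^ 2 ∧
        (∀ i, τ i = max ((a ⬝ᵥ m i) ^ 2 - 4 * δ / ε * (a ⬝ᵥ Sg *ᵥ a)) 0) ∧
        IsMaxScore w τ r ∧ ∀ i, w' i = w i - w i * τ i / r := by
  have hN' : (0 : ℝ) < N := Nat.cast_pos.2 hN
  obtain ⟨v, hv, τ, r, hτ, hr, hw⟩ := h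
  simp only [dotProduct_gapMatrix_mulVec] at hv
  rcases hv with hv | ⟨rfl, hv⟩
  · refine .inr ⟨v, τ, r, ?_, hτ, hr, hw⟩
    rw [sub_neg, lt_div_iff₀ hN'] at hv
    linarith
  · refine .inl ⟨fun a => ?_, funext fun i => ?_⟩
    · have := hv a
      rw [sub_nonneg, div_le_iff₀ hN'] at this
      linarith
    · rw [hw, hτ]
      simp

variable {n d ℓ N : ℕ} {e : Fin ℓ ≃ Expo n d} {D : Measure (Fin n → ℝ)} {ε γ δ Tmax : ℝ}
  {Q : ℝ → ℝ} {Sg : Matrix (Fin ℓ) (Fin ℓ) ℝ}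

/-- On a corrupted input, the program `filter` runs the filter. -/
theorem filter_exec_inputStore (hS : Sgᵀ = Sg) (S : Fin N → (Fin n → ℝ) × ℝ) :
    ∃ w : ℕ → Fin N → ℝ, (∀ i, w 0 i = 1) ∧
      (∀ t < N, FilterRound ε γ δ Sg (fun i j => monomialFn e j (S i).1) (w t) (w (t + 1))) ∧
      ∀ j : Fin ℓ, filter.exec (inputStore e ε γ δ Tmax Sg S).idx (inputStore e ε γ δ Tmax Sg S).mem
        5 j 0 = (∑ i, w N i * (S i).2 * monomialFn e j (S i).1) / N := by
  have hSg : toMat ℓ ((inputStore e ε γ δ Tmax Sg S).mem 3) = Sg := by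
    ext i j
    simp [toMat, inputStore, pad]
  have key := filter_spec (n := n) (d := d) (N := N) (ℓ := ℓ)
    (ρ := (inputStore e ε γ δ Tmax Sg S).idx) rfl rfl rfl rfl
    (μ := (inputStore e ε γ δ Tmax Sg S).mem) (by rw [hSg, hS])
    (m := fun i j => monomialFn e j (S i).1) fun i j => by
      rw [monomialFn, Finset.prod_range]
      refine Finset.prod_congr rfl fun k _ => ?_
      have hk : (e j).1 k ≤ d :=
        (Finset.single_le_sum (f := fun k => (e j).1 k) (fun _ _ => Nat.zero_le _)
          (Finset.mem_univ k)).trans (e j).2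
      have h4 : (inputStore e ε γ δ Tmax Sg S).mem 4 j k = ((e j).1 k : ℝ) := by
        simp [inputStore, pad]
      have h1 : (inputStore e ε γ δ Tmax Sg S).mem 1 i k = (S i).1 k := by
        simp [inputStore, pad]
      simp only [h4, h1, Nat.cast_lt]
      -- The machine has no powers: a power is a product of `d` factors, of which only as many as
      -- the exponent are nontrivial. Every exponent is at most `d`.
      rw [← Finset.prod_filter, Finset.prod_const]
      congr 1
      have : (Finset.range d).filter (fun t => t < (e j).1 k) = Finset.range ((e j).1 k) := by
        ext t
        simp only [Finset.mem_filter, Finset.mem_range]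
        omega
      rw [this, Finset.card_range]
  rw [hSg] at key
  have h2 : ∀ i : Fin N, (inputStore e ε γ δ Tmax Sg S).mem 2 i 0 = (S i).2 := fun i => by
    simp [inputStore, pad]
  simp only [h2] at key
  simpa [inputStore, pad] using key

variable {f : (Fin n → ℝ) → ℝ} {u : (Fin n → ℝ) → EuclideanSpace ℝ (Fin ℓ)}
  {b : EuclideanSpace ℝ (Fin ℓ) → EuclideanSpace ℝ (Fin ℓ)} {T₀ R : ℝ} {x : Fin N → Fin n → ℝ}
  {S : Fin N → (Fin n → ℝ) × ℝ} {π : Equiv.Perm (Fin N)}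

open Classical in
/-- The points of a corrupted sample that are not to be trusted. -/
noncomputable def badPoints (f : (Fin n → ℝ) → ℝ) (u : (Fin n → ℝ) → EuclideanSpace ℝ (Fin ℓ))
    (R : ℝ) (x : Fin N → Fin n → ℝ) (S : Fin N → (Fin n → ℝ) × ℝ) (π : Equiv.Perm (Fin N)) :
    Finset (Fin N) :=
  Finset.univ.filter fun i => S i ≠ (x (π i), f (x (π i))) ∨ R < ‖u (x (π i))‖

/-- The adversary accounts for `ε * N` points, and long clean vectors, carried along by the
permutation, for `5 * ε * N`. -/
theorem card_badPoints_le (hlarge : (({k | R < ‖u (x k)‖} : Set (Fin N)).ncard : ℝ) ≤ 5 * ε * N)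
    (hπ : (({i | S i ≠ (x (π i), f (x (π i)))} : Set (Fin N)).ncard : ℝ) ≤ ε * N) :
    ((badPoints f u R x S π).card : ℝ) ≤ 6 * ε * N := by
  classical
  have h1 : (badPoints f u R x S π : Set (Fin N)) =
      {i | S i ≠ (x (π i), f (x (π i)))} ∪ π ⁻¹' {k | R < ‖u (x k)‖} := by
    ext i
    simp [badPoints]
  have h2 : (π ⁻¹' {k | R < ‖u (x k)‖}).ncard = ({k | R < ‖u (x k)‖} : Set (Fin N)).ncard := by
    rw [← Set.ncard_image_of_injective _ π.injective, Set.image_preimage_eq _ π.surjective]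
  have h3 := Set.ncard_union_le {i | S i ≠ (x (π i), f (x (π i)))} (π ⁻¹' {k | R < ‖u (x k)‖})
  rw [← h1, Set.ncard_coe_finset, h2] at h3
  have : ((badPoints f u R x S π).card : ℝ) ≤ (_ + _ : ℕ) := Nat.cast_le.2 h3
  push_cast at this
  linarith

theorem correct_of_notMem_badPoints {i : Fin N} (h : i ∉ badPoints f u R x S π) :
    S i = (x (π i), f (x (π i))) ∧ ‖u (x (π i))‖ ≤ R := by
  simpa [badPoints] using h

/-- A corruption of a good sample satisfies the hypotheses of the analysis of the filter. -/
theorem corruptedValues_of_isGoodSample (H : IsReasonable D e ε Q Sg γ δ Tmax) (hγ : γ ≤ 1 / 2)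
    (hε : 0 < ε) (hT : ε * T₀ ^ 2 ≤ 2 * δ)
    (hb : ∀ a, ‖b a‖ ^ 2 = ∫ y, inner ℝ a (monomialVec e y) ^ 2 ∂D)
    (hbu : ∀ᵐ y ∂D, ∀ a, inner ℝ a (monomialVec e y) = inner ℝ (b a) (u y))
    (hx : ∀ k a, inner ℝ a (monomialVec e (x k)) = inner ℝ (b a) (u (x k)))
    (good : IsGoodSample D u f R T₀ ε δ x)
    (hπ : (({i | S i ≠ (x (π i), f (x (π i)))} : Set (Fin N)).ncard : ℝ) ≤ ε * N) :
    CorruptedValues (fun (a : Fin ℓ → ℝ) i => a ⬝ᵥ fun j => monomialFn e j (S i).1)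
      (fun a => a ⬝ᵥ Sg *ᵥ a) (fun a => b (WithLp.toLp 2 a))
      (fun i => truncate R (u (x (π i)))) (badPoints f u R x S π) T₀ ε γ δ where
  eps_pos := hε
  delta_pos := H.delta_pos
  gamma_nonneg := H.gamma_nonneg
  gamma_le := hγ
  trunc := hT
  bad_card := card_badPoints_le good.few_large hπ
  val_eq a i hi := by
    obtain ⟨h1, h2⟩ := correct_of_notMem_badPoints hi
    rw [truncate_of_le h2, ← hx, inner_toLp_monomialVec, h1]
    rfl
  lower a := by
    rw [hb, ← dotProduct_momentMatrix_mulVec H]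
    exact (H.form_bounds a).1
  upper a := by
    rw [hb, ← dotProduct_momentMatrix_mulVec H]
    exact (H.form_bounds a).2
  excess_le a := by
    -- The order of presentation does not matter to sums over the whole clean sample.
    rw [Equiv.sum_comp π fun k => max (inner ℝ (b (WithLp.toLp 2 a)) (truncate R (u (x k))) ^ 2 -
      T₀ ^ 2 * ‖b (WithLp.toLp 2 a)‖ ^ 2) 0]
    exact good.excess_le _
  second_moment_le a := by
    rw [Equiv.sum_comp π fun k => inner ℝ (b (WithLp.toLp 2 a)) (truncate R (u (x k))) ^ 2]
    exact good.second_moment_le _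
  le_second_moment a := by
    rw [Equiv.sum_comp π fun k => inner ℝ (b (WithLp.toLp 2 a)) (truncate R (u (x k))) ^ 2]
    refine le_trans (le_of_eq ?_) (good.le_second_moment _)
    congr 2
    rw [hb]
    refine integral_congr_ae ?_
    filter_upwards [hbu] with y hy
    rw [hy]

/-- On every corruption of a good sample, the filter approximates the Chow parameters. -/
theorem approximatesChow_of_isGoodSample (H : IsReasonable D e ε Q Sg γ δ Tmax) (hγ : γ ≤ 1 / 2)
    (hε : 0 < ε) (hN : 0 < N) (hT : ε * T₀ ^ 2 ≤ 2 * δ) (hf1 : ∀ y, |f y| ≤ 1)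
    (hb : ∀ a, ‖b a‖ ^ 2 = ∫ y, inner ℝ a (monomialVec e y) ^ 2 ∂D)
    (hbu : ∀ᵐ y ∂D, ∀ a, inner ℝ a (monomialVec e y) = inner ℝ (b a) (u y))
    (hx : ∀ k a, inner ℝ a (monomialVec e (x k)) = inner ℝ (b a) (u (x k)))
    (good : IsGoodSample D u f R T₀ ε δ x)
    (hS : IsCorruption ε (fun k => (x k, f (x k))) S) :
    ApproximatesChow D f e (fun j => filter.exec (inputStore e ε γ δ Tmax Sg S).idx
      (inputStore e ε γ δ Tmax Sg S).mem 5 j 0) (100 * √(ε * (γ + δ + ε))) := by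
  obtain ⟨hy, π, hπ⟩ := hS
  have HC := corruptedValues_of_isGoodSample H hγ hε hT hb hbu hx good hπ
  obtain ⟨w, hw0, hw, hout⟩ := filter_exec_inputStore (e := e) (ε := ε) (γ := γ) (δ := δ)
    (Tmax := Tmax) H.transpose_eq S
  obtain ⟨hinv, hadm⟩ := HC.exists_final_weights hw0 fun t ht => filterRound_dichotomy hN (hw t ht)
  intro p hp
  set a : Fin ℓ → ℝ := fun i => p.coeff (e i).1 with ha
  have hpa : ∀ y, MvPolynomial.eval y p = inner ℝ (WithLp.toLp 2 a) (monomialVec e y) := fun y => by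
    rw [inner_toLp_monomialVec, eval_eq_sum_monomialFn e hp]
  have hnorm : polyNorm D p = ‖b (WithLp.toLp 2 a)‖ := by
    rw [polyNorm]
    simp only [hpa]
    rw [← hb, Real.sqrt_sq (norm_nonneg _)]
  have hint : ∫ y, f y * MvPolynomial.eval y p ∂D =
      ∫ y, f y * inner ℝ (b (WithLp.toLp 2 a)) (u y) ∂D := by
    refine integral_congr_ae ?_
    filter_upwards [hbu] with y hy
    rw [hpa, hy]
  have hsum : ∑ i, p.coeff (e i).1 * filter.exec (inputStore e ε γ δ Tmax Sg S).idx
      (inputStore e ε γ δ Tmax Sg S).mem 5 i 0 =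
      (∑ i, w N i * (S i).2 * (a ⬝ᵥ fun j => monomialFn e j (S i).1)) / N := by
    simp only [hout, ← mul_div_assoc, ← Finset.sum_div, dotProduct, Finset.mul_sum]
    rw [Finset.sum_comm]
    congr 1
    refine Finset.sum_congr rfl fun i _ => Finset.sum_congr rfl fun j _ => ?_
    rw [ha]
    ring
  rw [hsum, hint, hnorm]
  refine HC.abs_correlation_sub_le hinv hN (hadm a) (fun i => abs_le.2 ⟨(hy i).1, (hy i).2⟩)
    (fx := fun i => f (x (π i))) (fun i => hf1 _) (fun i hi => ?_) ?_
  · rw [(correct_of_notMem_badPoints hi).1]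
  · rw [Equiv.sum_comp π fun k => f (x k) *
      inner ℝ (b (WithLp.toLp 2 a)) (truncate R (u (x k)))]
    exact good.correlation _

end RobustChow

/-! ### Success probability, running time and the main theorem -/

namespace RobustChow

open ChowProgram

theorem exists_le_abs_coord_of_lt_norm {ℓ : ℕ} {z : EuclideanSpace ℝ (Fin ℓ)} {T : ℝ}
    (hT : 0 ≤ T) (h : T / 2 < ‖z‖) : ∃ j, T / (2 * √ℓ) ≤ |z j| := by
  by_contra! hc
  have h1 : ‖z‖ ^ 2 ≤ (T / 2) ^ 2 := by
    rw [EuclideanSpace.real_norm_sq_eq]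
    rcases Nat.eq_zero_or_pos ℓ with rfl | hℓ
    · simpa using sq_nonneg (T / 2)
    have hℓ' : (0 : ℝ) < ℓ := Nat.cast_pos.2 hℓ
    refine (Finset.sum_le_card_nsmul _ _ ((T / (2 * √ℓ)) ^ 2) fun j _ =>
      sq_le_sq' (neg_le_of_abs_le (hc j).le) (le_of_abs_le (hc j).le)).trans (le_of_eq ?_)
    rw [Finset.card_univ, Fintype.card_fin, nsmul_eq_mul, div_pow, mul_pow, Real.sq_sqrt hℓ'.le]
    field_simp
  exact absurd (le_of_sq_le_sq h1 (by positivity)) (not_le.2 h)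

variable {n d ℓ N : ℕ} {e : Fin ℓ ≃ Expo n d} {D : Measure (Fin n → ℝ)} {ε γ δ Tmax : ℝ}
  {Q : ℝ → ℝ} {Sg : Matrix (Fin ℓ) (Fin ℓ) ℝ} {f : (Fin n → ℝ) → ℝ}

/-- With probability at least `9/10`, the filter succeeds on every corruption of the sample. -/
theorem measure_exists_bad_corruption_le [IsProbabilityMeasure D]
    (H : IsReasonable D e ε Q Sg γ δ Tmax) (hγ : γ ≤ 1 / 2) (hε : 0 < ε) (hℓ : 0 < ℓ) (hN : 0 < N)
    (hNε : 10000 * (Tmax ^ 4 / ε ^ 2) ≤ N) (hf : Measurable f) (hf1 : ∀ y, |f y| ≤ 1) :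
    Measure.pi (fun _ : Fin N => D) {x | ∃ S, IsCorruption ε (fun k => (x k, f (x k))) S ∧
      ¬ ApproximatesChow D f e (fun j => filter.exec (inputStore e ε γ δ Tmax Sg S).idx
        (inputStore e ε γ δ Tmax Sg S).mem 5 j 0) (100 * √(ε * (γ + δ + ε)))} ≤ 1 / 10 := by
  have hℓ' : (1 : ℝ) ≤ ℓ := Nat.one_le_cast.2 hℓ
  have hT1 : 1 ≤ Tmax := (Real.one_le_sqrt.2 hℓ').trans H.Tmax_ge
  have hTℓ : (ℓ : ℝ) ≤ Tmax ^ 2 := (Real.sqrt_le_left (by linarith)).1 H.Tmax_ge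
  obtain ⟨u, b, hu, hum, hu1, hb, hbu⟩ := exists_whitening D (measurable_monomialVec e)
    fun i => H.memLp_monomialFn i
  have hpoly : ∀ c, ∃ p : MvPolynomial (Fin n) ℝ, p.totalDegree ≤ d ∧
      ∀ x, MvPolynomial.eval x p = inner ℝ c (u x) := fun c => by
    obtain ⟨c', hc'⟩ := hum c
    obtain ⟨p, hp, h⟩ := exists_polynomial_of_coeffs e c'.ofLp
    exact ⟨p, hp, fun x => by rw [h, hc', ← inner_toLp_monomialVec]⟩
  have hLp : ∀ c, MemLp (fun x => inner ℝ c (u x)) 2 D := fun c => by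
    obtain ⟨p, hp, h⟩ := hpoly c
    simpa only [h] using H.memLp p hp
  -- Functionals of `u` are polynomials everywhere, not only almost everywhere, and have norm at
  -- most `‖c‖`; the concentration hypothesis applies to them.
  have htail : ∀ c, ‖c‖ ≤ 1 → ∀ T, 0 < T → D.real {x | T ≤ |inner ℝ c (u x)|} ≤ Q T :=
    fun c hc T hT => by
      obtain ⟨p, hp, h⟩ := hpoly c
      have := H.tail p hp (by
        simp only [polyNorm, h]
        exact Real.sqrt_le_one.2 ((hu1 c).trans (pow_le_one₀ (norm_nonneg _) hc))) T hT
      simpa only [h] using this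
  have hcoord : ∀ j x, inner ℝ (EuclideanSpace.single j (1 : ℝ)) (u x) = u x j := fun j x => by
    simp [EuclideanSpace.inner_single_left]
  have hnorm : ∀ x, ‖u x‖ ^ 2 = ∑ j, inner ℝ (EuclideanSpace.single j (1 : ℝ)) (u x) ^ 2 :=
    fun x => by simp only [EuclideanSpace.real_norm_sq_eq, hcoord]
  obtain ⟨T₀, hT₀, hT₀ε, hexc⟩ := exists_truncation D
    {h | ∃ c : EuclideanSpace ℝ (Fin ℓ), ‖c‖ ≤ 1 ∧ h = fun x => inner ℝ c (u x)}
    (Q := Q) (ε := ε) (δ := δ)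
    (by rintro h ⟨c, -, rfl⟩; exact measurable_const.inner hu)
    (by rintro h ⟨c, -, rfl⟩; exact (hLp c).integrable_sq)
    (by rintro h ⟨c, hc, rfl⟩; exact (hu1 c).trans (pow_le_one₀ (norm_nonneg _) hc))
    (by rintro h ⟨c, hc, rfl⟩; exact htail c hc)
    hε H.delta_pos H.delta_bound
  -- A long vector has a coordinate of size at least `Tmax / (2 * √ℓ)`. The union bound over `ℓ`
  -- coordinates costs `ℓ * (ε / (10 * ℓ))`.
  have hlarge : D.real {x | Tmax / 2 < ‖u x‖} ≤ ε / 10 := by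
    have hsub : {x | Tmax / 2 < ‖u x‖} ⊆
        ⋃ j, {x | Tmax / (2 * √ℓ) ≤ |inner ℝ (EuclideanSpace.single j (1 : ℝ)) (u x)|} := by
      intro x hx
      obtain ⟨j, hj⟩ := exists_le_abs_coord_of_lt_norm (by linarith) hx
      exact Set.mem_iUnion.2 ⟨j, by simpa only [Set.mem_ofPred_eq, hcoord] using hj⟩
    refine (measureReal_mono hsub).trans ((measureReal_iUnion_fintype_le _).trans ?_)
    refine (Finset.sum_le_card_nsmul _ _ (ε / (10 * ℓ)) fun j _ =>
      (htail _ (by simp) _ (by positivity)).trans H.Tmax_tail).trans (le_of_eq ?_)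
    rw [Finset.card_univ, Fintype.card_fin, nsmul_eq_mul]
    field_simp
  have hun : Integrable (fun x => ‖u x‖ ^ 2) D := by
    simp only [hnorm]
    exact integrable_finsetSum _ fun j _ => (hLp _).integrable_sq
  -- Each whitened coordinate has second moment at most one, so the total is at most `ℓ ≤ Tmax ^ 2`.
  have hdim : ∫ x, ‖u x‖ ^ 2 ∂D ≤ 4 * (Tmax / 2) ^ 2 := by
    simp only [hnorm]
    rw [integral_finsetSum _ fun j _ => (hLp _).integrable_sq]
    refine (Finset.sum_le_card_nsmul _ _ 1 fun j _ => (hu1 _).trans (by simp)).trans ?_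
    rw [Finset.card_univ, Fintype.card_fin, nsmul_eq_mul]
    linarith
  -- With `R = Tmax / 2`, the requirement `160000 * R ^ 4` becomes `10000 * Tmax ^ 4`.
  have hgood := measure_not_isGoodSample_le (N := N) (R := Tmax / 2) (T₀ := T₀) D hu hu1
    (fun c => (hLp c).integrable_sq) (by linarith) hun hdim hε H.delta_pos hT₀ε
    (fun c hc => hexc _ ⟨c, hc, rfl⟩) hlarge (le_trans (le_of_eq (by ring)) hNε) hf hf1
  have hnull : Measure.pi (fun _ : Fin N => D)
      {x | ¬ ∀ k a, inner ℝ a (monomialVec e (x k)) = inner ℝ (b a) (u (x k))} = 0 := by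
    refine ae_iff.1 (ae_all_iff.2 fun k => ?_)
    exact (measurePreserving_eval (fun _ : Fin N => D) k).quasiMeasurePreserving.ae hbu
  -- The exceptional event depends on the clean sample only. Off it every corruption is harmless, so
  -- the adversary may depend on the sample in any way.
  refine le_trans (measure_mono (t := {x | ¬ IsGoodSample D u f (Tmax / 2) T₀ ε δ x} ∪
      {x | ¬ ∀ k a, inner ℝ a (monomialVec e (x k)) = inner ℝ (b a) (u (x k))}) ?_)
    ((measure_union_le _ _).trans (le_trans (le_of_eq (by rw [hnull, add_zero])) hgood))
  rintro x ⟨S, hS, hbad⟩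
  by_contra hx
  rw [Set.mem_union, not_or] at hx
  simp only [Set.mem_ofPred_eq, not_not] at hx
  exact hbad (approximatesChow_of_isGoodSample H hγ hε hN hT₀ε hf1 hb hbu hx.2 hx.1 hS)

/-- The filter, preceded by a test that the noise rate is below one. -/
def chowProgram : RealRAM.Cmd :=
  .ite (.ltR (.get 0 (.const 0) (.const 0)) (.const 1)) filter.comp .skip

theorem chowProgram_runs_of_lt_one (hε : ε < 1) (hn : n ≤ N) (hd : d ≤ N) (hℓ : ℓ ≤ N)
    (S : Fin N → (Fin n → ℝ) × ℝ) :
    ∃ s' t, chowProgram.Runs Q (inputStore e ε γ δ Tmax Sg S) s' t ∧ t ≤ 5 + filter.cost N ∧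
      output ℓ s' = fun j : Fin ℓ => filter.exec (inputStore e ε γ δ Tmax Sg S).idx
        (inputStore e ε γ δ Tmax Sg S).mem 5 j 0 := by
  obtain ⟨s', t, h, ht, -, hout⟩ := RealRAM.St.comp_runs Q (B := N) filter (m := 4) (by decide)
    (inputStore e ε γ δ Tmax Sg S) (fun r hr => by
      interval_cases r
      exacts [hn, hd, le_rfl, hℓ])
  refine ⟨s', 5 + t, .iteTrue ?_ h, by omega, ?_⟩
  · simpa [RealRAM.BExp.Holds, RealRAM.RExp.eval, RealRAM.NExp.eval, inputStore, pad] using hε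
  · funext j
    rw [output, hout 5 (by norm_num)]

theorem chowProgram_runs_of_one_le (hε : 1 ≤ ε) (S : Fin N → (Fin n → ℝ) × ℝ) :
    chowProgram.Runs Q (inputStore e ε γ δ Tmax Sg S) (inputStore e ε γ δ Tmax Sg S) 6 := by
  refine .iteFalse ?_ (.skip _)
  simpa [RealRAM.BExp.Holds, RealRAM.RExp.eval, RealRAM.NExp.eval, inputStore, pad] using hε

end RobustChow

theorem mainTheorem4 :
    ∃ (P : RealRAM.Cmd) (γ₀ C₀ C K : ℝ) (k : ℕ), 0 < γ₀ ∧ 0 < C₀ ∧ 0 < C ∧ 0 < K ∧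
      ∀ (n d ℓ : ℕ) (e : Fin ℓ ≃ RobustChow.Expo n d), 0 < n → 0 < d →
      ∀ (ε : ℝ), 0 < ε →
      ∀ (D : Measure (Fin n → ℝ)) [IsProbabilityMeasure D]
        (Q : ℝ → ℝ) (Sg : Matrix (Fin ℓ) (Fin ℓ) ℝ) (γ δ Tmax : ℝ),
        RobustChow.IsReasonable D e ε Q Sg γ δ Tmax → γ ≤ γ₀ →
      ∀ (N : ℕ), C₀ * ((n : ℝ) ^ d * Tmax ^ 4 / ε ^ 2) ≤ N →
        (∀ S' : Fin N → (Fin n → ℝ) × ℝ, ∃ (s' : RealRAM.Store) (t : ℕ),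
          P.Runs Q (RobustChow.inputStore e ε γ δ Tmax Sg S') s' t ∧ (t : ℝ) ≤ K * (N : ℝ) ^ k) ∧
        ∀ (f : (Fin n → ℝ) → ℝ), Measurable f → (∀ x, f x ∈ Set.Icc (-1 : ℝ) 1) →
          Measure.pi (fun _ : Fin N => D)
            {x | ∃ S' : Fin N → (Fin n → ℝ) × ℝ,
              RobustChow.IsCorruption ε (fun i => (x i, f (x i))) S' ∧
              ∃ (s' : RealRAM.Store) (t : ℕ),
                P.Runs Q (RobustChow.inputStore e ε γ δ Tmax Sg S') s' t ∧
                ¬ RobustChow.ApproximatesChow D f e (RobustChow.output ℓ s')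
                  (C * Real.sqrt (ε * (γ + δ + ε)))} ≤ 1 / 10 := by
  obtain ⟨K₀, k₀, hcost⟩ := RobustChow.ChowProgram.filter.cost_le
  refine ⟨RobustChow.chowProgram, 1 / 2, 10000, 100, K₀ + 10, k₀, by norm_num, by norm_num,
    by norm_num, by positivity, ?_⟩
  intro n d ℓ e hn hd ε hε D _ Q Sg γ δ Tmax H hγ N hN
  have hnℓ := RobustChow.card_variables_le e hd
  have hdℓ := RobustChow.degree_lt_card e hn
  have hℓ : 0 < ℓ := hn.trans_le hnℓ
  have hℓ' : (1 : ℝ) ≤ ℓ := Nat.one_le_cast.2 hℓ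
  have hT1 : 1 ≤ Tmax := (Real.one_le_sqrt.2 hℓ').trans H.Tmax_ge
  have hTℓ : (ℓ : ℝ) ≤ Tmax ^ 2 := (Real.sqrt_le_left (by linarith)).1 H.Tmax_ge
  -- The factor `n ^ d` is not needed: the relation of the dimension to `Tmax` already enters
  -- through `ℓ ≤ Tmax ^ 2`.
  have hNε : 10000 * (Tmax ^ 4 / ε ^ 2) ≤ N := by
    refine le_trans ?_ hN
    gcongr
    exact le_mul_of_one_le_left (by positivity) (one_le_pow₀ (Nat.one_le_cast.2 hn))
  have hN0 : 0 < N := Nat.cast_pos.1 (lt_of_lt_of_le (by positivity) hNε)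
  have hN1 : (1 : ℝ) ≤ (N : ℝ) ^ k₀ := one_le_pow₀ (Nat.one_le_cast.2 hN0)
  -- For `ε < 1` the sample size dominates `Tmax ^ 4`, hence `ℓ`, `n` and `d`, and the cost is
  -- polynomial in `N`. For `ε ≥ 1` the sample may be smaller than `ℓ`, but the program stops at
  -- once and array 5 is still zero.
  rcases lt_or_ge ε 1 with hε1 | hε1
  · have hℓN : ℓ ≤ N := by
      rw [← Nat.cast_le (α := ℝ)]
      refine le_trans ?_ hNε
      have h4 : Tmax ^ 4 ≤ Tmax ^ 4 / ε ^ 2 :=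
        le_div_self (by positivity) (by positivity) (pow_le_one₀ hε.le hε1.le)
      nlinarith
    have hrun := RobustChow.chowProgram_runs_of_lt_one (e := e) (γ := γ) (δ := δ) (Tmax := Tmax)
      (Q := Q) (Sg := Sg) hε1 (hnℓ.trans hℓN) (hdℓ.le.trans hℓN) hℓN
    refine ⟨fun S => ?_, fun f hf hf1 => ?_⟩
    · obtain ⟨s', t, h, ht, -⟩ := hrun S
      refine ⟨s', t, h, ?_⟩
      have : (t : ℝ) ≤ (5 + K₀ * N ^ k₀ : ℕ) :=
        Nat.cast_le.2 (ht.trans (Nat.add_le_add_left (hcost N hN0) 5))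
      push_cast at this
      linarith
    · refine le_trans (measure_mono ?_) (RobustChow.measure_exists_bad_corruption_le H hγ hε hℓ hN0
        hNε hf fun y => abs_le.2 (hf1 y))
      rintro x ⟨S, hS, s', t, h, hbad⟩
      obtain ⟨s'', t', h', -, hout⟩ := hrun S
      -- By determinism the hypothetical failing run ends in the same memory as the run known to be
      -- correct.
      rw [h.unique h', hout] at hbad
      exact ⟨S, hS, hbad⟩
  · have hrun := RobustChow.chowProgram_runs_of_one_le (e := e) (γ := γ) (δ := δ) (Tmax := Tmax)
      (Q := Q) (Sg := Sg) (N := N) hε1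
    refine ⟨fun S => ⟨_, 6, hrun S, ?_⟩, fun f hf hf1 => ?_⟩
    · have : (0 : ℝ) ≤ K₀ * (N : ℝ) ^ k₀ := by positivity
      push_cast
      linarith
    · refine le_trans (le_of_eq ?_) zero_le
      refine (congrArg _ (Set.eq_empty_of_forall_notMem ?_)).trans measure_empty
      rintro x ⟨S, hS, s', t, h, hbad⟩
      rw [h.unique (hrun S)] at hbad
      refine hbad (RobustChow.approximatesChow_zero e H.memLp hf (fun y => abs_le.2 (hf1 y)) rfl ?_)
      have hγ0 := H.gamma_nonneg
      have hδ0 := H.delta_pos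
      have : 1 ≤ √(ε * (γ + δ + ε)) := Real.one_le_sqrt.2 (one_le_mul_of_one_le_of_one_le hε1
        (by linarith))
      linarith
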